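/- **Setting.** Let $A$ be a finite non-empty set and let $\mathcal H$ be the Connes–Kreimer Hopf algebra of rooted trees with vertices decorated by $A$: the real vector space with basis the set $\mathcal F$ of (non-planar) decorated forests, with product the disjoint union (unit the empty forest $\mathbf 1$), graded by the number $|h|$ of vertices, with coproduct determined by multiplicativity and $\Delta[h]_a=(\mathrm{id}\otimes[\cdot]_a)\Delta h+[h]_a\otimes\mathbf 1$, where $[h]_a$ grafts the trees of $h$ to a new root labelled $a$. For $\phi,\psi\in\mathcal H^*$ put $\phi\star\psi=m\circ(\phi\otimes\psi)\circ\Delta$ ($m$ being the multiplication of $\mathbb R$); a forest $h$ is identified with the functional reading off the coefficient of $h$, and for $Z\in\mathcal H$ we write $Z^\phi=\langle\phi,Z\rangle$. For forests $h,h'$ let $h\top h'$ be the sum, over all vertices $v$ of $h'$, of the forests obtained by grafting $h$ to $v$, divided by $|h'|$, extended bilinearly, and let $\top(x_1,\dots,x_k)=(\cdots(x_1\top x_2)\cdots)\top x_k$ (equal to $\mathbf 1$ for $k=0$). Fix a basis $\mathcal P$ of the space of primitive elements $\{x:\Delta x=x\otimes\mathbf 1+\mathbf 1\otimes x\}$ consisting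 of homogeneous elements. The elements $\rho=\top(p_1,\dots,p_k)$, $p_j\in\mathcal P$, $k\ge0$, form a basis $\mathcal P^\top$ of $\mathcal H$; write $\rho^*$ for the dual functionals. Let $T>0$ and $\alpha\in(0,1)$ with $\alpha\ne1/n$ for all $n\in\mathbb N$, $N=\lfloor1/\alpha\rfloor$, and $\varepsilon\in(0,1-N\alpha)$. For $g:[0,T]^2\to\mathbb R$ put $\|g\|_\gamma=\sup_{s\ne t}|g_{s,t}|/|t-s|^\gamma$, and for a path $g$ put $\|g\|_\gamma=\|\delta g\|_\gamma$ with $\delta g_{s,t}=g_t-g_s$. An $\alpha$-Hölder branched rough path $\mathbf X$ is a family of characters $\mathbf X_{s,t}$ of $\mathcal H$, $s,t\in[0,T]$, with $\mathbf X_{s,u}\star\mathbf X_{u,t}=\mathbf X_{s,t}$ for all $s,u,t\in[0,T]$ and $\|\mathbf X^h\|_{|h|\alpha}<\infty$ for all $h\in\mathcal F$, where $\mathbf X^x_{s,t}=\langle\mathbf X_{s,t},x\rangle$. Let $$\rho_\alpha(\mathbf X,\tilde{\mathbf X})=\max_{1\le|h|\le N}\|\mathbf X^h-\tilde{\mathbf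 X}^h\|_{|h|\alpha},\qquad \|\mathbf X\|_\alpha=\max_{1\le|h|\le N}\|\mathbf X^h\|_{|h|\alpha}.$$ A path controlled by $\mathbf X$ is a path $\mathbf Z$ on $[0,T]$ with values in the span of the forests with $|h|\le N-1$ whose remainders $R^h_{s,t}=\langle h,\mathbf Z_t\rangle-\langle\mathbf X_{s,t}\star h,\mathbf Z_s\rangle$ satisfy $\|R^h\|_{(N-|h|)\alpha}<\infty$ for $|h|\le N-1$. For $\mathbf Z,\tilde{\mathbf Z}$ controlled by $\mathbf X,\tilde{\mathbf X}$ with remainders $R^h,\tilde R^h$, let $$\|\mathbf Z;\tilde{\mathbf Z}\|_\alpha=\sum_{|h|\le N-1}\Big(|\langle h,\mathbf Z_0-\tilde{\mathbf Z}_0\rangle|+\|R^h-\tilde R^h\|_{(N-|h|)\alpha}\Big).$$ Let $\mathcal S_N$ be the set of families $f=(f^h)_{|h|\le N-1}$ of paths in the closure of $C^\infty([0,T])$ under the norm $|g_0|+\|g\|_{1-\varepsilon}$, and let $|f|=\max_{|h|\le N-1}\|f^h\|_{1-\varepsilon}$. The path $\Gamma_{\mathbf X}(f)=\sum_{|h|\le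 N-1}\Gamma_{\mathbf X}(f)^h\,h$ is defined by descending recursion on $|h|$ by $$\Gamma_{\mathbf X}(f)^h_t=\sum_{p\in\mathcal P,\ |p|<N-|h|}\int_0^t\Gamma_{\mathbf X}(f)^{p^*\star h}_r\,\mathrm d\mathbf X^p_r+f^h_t,$$ (so $\Gamma_{\mathbf X}(f)^h=f^h$ if $|h|=N-1$), where $$\int_0^t\Gamma_{\mathbf X}(f)^{p^*\star h}_r\,\mathrm d\mathbf X^p_r=\lim_{|\pi|\to0}\sum_{[a,b]\in\pi}\ \sum_{\rho\in\mathcal P^\top,\ |\rho|<N-|h|-|p|}\Gamma_{\mathbf X}(f)^{\rho^*\star p^*\star h}_a\,\mathbf X^{\rho\top p}_{a,b}$$ is the limit of Riemann sums over partitions $\pi$ of $[0,t]$ as their mesh tends to $0$. **Theorem.** For every $\alpha$-Hölder branched rough path $\mathbf X$ and every $f\in\mathcal S_N$ these limits exist for all $t\in[0,T]$, so that $\Gamma_{\mathbf X}(f)$ is well defined, and $\Gamma_{\mathbf X}(f)$ is controlled by $\mathbf X$. Moreover, for every $M\ge0$ there is a constant $C$, depending only on $A,\mathcal P,\alpha,\varepsilon,T$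 and $M$, such that for all $\alpha$-Hölder branched rough paths $\mathbf X,\tilde{\mathbf X}$ with $\|\mathbf X\|_\alpha\le M$ and $\|\tilde{\mathbf X}\|_\alpha\le M$ and all $f\in\mathcal S_N$, $$\|\Gamma_{\mathbf X}(f);\Gamma_{\tilde{\mathbf X}}(f)\|_\alpha\le C\,|f|\,\rho_\alpha(\mathbf X,\tilde{\mathbf X}).$$ -/

import Mathlib

open scoped TensorProduct NNReal ENNReal ContDiff
open Set

noncomputable section

namespace BranchedRP

/-! ## Decorated rooted trees and forests -/

/-- Ordered (planar) forests of rooted trees with vertices labelled by `A`: a forest is empty, or it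
consists of a first tree, with root label `a` whose branches form the forest `children`, followed by
the forest `rest` of the remaining trees. -/
inductive PlanarForest (A : Type*)
  | nil : PlanarForest A
  | cons (a : A) (children rest : PlanarForest A) : PlanarForest A

namespace PlanarForest

variable {A : Type*}

/-- Juxtaposition of planar forests. -/
def append : PlanarForest A → PlanarForest A → PlanarForest A
  | nil, g => g
  | cons a c r, g => cons a c (append r g)

/-- The number of vertices. -/
def deg : PlanarForest A → ℕ
  | nil => 0
  | cons _ c r => deg c + 1 + deg r

/-- Forgetting the planar structure: neighbouring trees of the forest may be exchanged, and so may
neighbouring branches at each vertex. -/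
inductive Rel : PlanarForest A → PlanarForest A → Prop
  | swap (a b : A) (c d r : PlanarForest A) :
      Rel (cons a c (cons b d r)) (cons b d (cons a c r))
  | children (a : A) {c c' : PlanarForest A} (r : PlanarForest A) :
      Rel c c' → Rel (cons a c r) (cons a c' r)
  | rest (a : A) (c : PlanarForest A) {r r' : PlanarForest A} :
      Rel r r' → Rel (cons a c r) (cons a c r')

theorem append_nil (f : PlanarForest A) : append f nil = f := by
  induction f with
  | nil => rfl
  | cons a c r _ ih => simp [append, ih]

theorem append_assoc (f g h : PlanarForest A) :
    append (append f g) h = append f (append g h) := by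
  induction f with
  | nil => rfl
  | cons a c r _ ih => simp [append, ih]

theorem Rel.append_right {f f' : PlanarForest A} (h : Rel f f') (g : PlanarForest A) :
    Rel (append f g) (append f' g) := by
  induction h with
  | swap a b c d r => exact Rel.swap a b c d _
  | children a r hc _ => exact Rel.children a _ hc
  | rest a c _ ih => exact Rel.rest a c ih

theorem Rel.append_left (f : PlanarForest A) {g g' : PlanarForest A} (h : Rel g g') :
    Rel (append f g) (append f g') := by
  induction f with
  | nil => exact h
  | cons a c r _ ih => exact Rel.rest a c ih

theorem Rel.deg_eq {f g : PlanarForest A} (h : Rel f g) : deg f = deg g := by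
  induction h with
  | swap a b c d r => simp only [deg]; omega
  | children a r _ ih => simp only [deg, ih]
  | rest a c _ ih => simp only [deg, ih]

theorem finite_deg_le [Finite A] (n : ℕ) : {f : PlanarForest A | deg f ≤ n}.Finite := by
  induction n with
  | zero =>
    refine (Set.finite_singleton (nil : PlanarForest A)).subset ?_
    rintro (_ | ⟨a, c, r⟩) hf
    · rfl
    · simp [deg] at hf
  | succ n ih =>
    refine ((((Set.finite_univ (α := A)).prod (ih.prod ih)).image
      (fun x => cons x.1 x.2.1 x.2.2)).insert nil).subset ?_
    rintro (_ | ⟨a, c, r⟩) hf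
    · exact Set.mem_insert _ _
    · refine Set.mem_insert_of_mem _ ⟨(a, c, r), ⟨Set.mem_univ _, ?_, ?_⟩, rfl⟩ <;>
      · simp only [deg, Set.mem_ofPred_eq] at hf ⊢
        omega

end PlanarForest

/-- Forests of (nonplanar) rooted trees with labels in `A`. -/
def Forest (A : Type*) : Type _ := Quot (PlanarForest.Rel (A := A))

namespace Forest

variable {A : Type*}

/-- The underlying forest of a planar forest. -/
def mk (f : PlanarForest A) : Forest A := Quot.mk _ f

/-- `tree a h` is the tree `[h]_a` in which the trees of `h` are grafted to a new root labelled
`a`. -/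
def tree (a : A) : Forest A → Forest A :=
  Quot.map (fun c => PlanarForest.cons a c .nil) (fun _ _ h => .children a _ h)

/-- The number of vertices of a forest. -/
def deg : Forest A → ℕ := Quot.lift PlanarForest.deg (fun _ _ h => h.deg_eq)

instance : Mul (Forest A) :=
  ⟨Quot.map₂ PlanarForest.append (fun f _ _ h => PlanarForest.Rel.append_left f h)
    (fun _ _ g h => h.append_right g)⟩

instance : One (Forest A) := ⟨mk .nil⟩

theorem mk_mul_mk (f g : PlanarForest A) : mk f * mk g = mk (f.append g) := rfl

theorem mk_nil : mk (.nil : PlanarForest A) = 1 := rfl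

theorem mk_cons (a : A) (c r : PlanarForest A) :
    mk (.cons a c r) = tree a (mk c) * mk r := rfl

theorem mk_append_cons (g : PlanarForest A) (a : A) (c r : PlanarForest A) :
    mk (g.append (.cons a c r)) = mk (.cons a c (g.append r)) := by
  induction g with
  | nil => rfl
  | cons b d g _ ih =>
    have h1 : ∀ {x y : PlanarForest A}, mk x = mk y → mk (.cons b d x) = mk (.cons b d y) :=
      fun {x y} h => congrArg (Quot.map (PlanarForest.cons b d) (fun _ _ h => .rest b d h)) h
    exact (h1 ih).trans (Quot.sound (.swap b a d c _))

/-- Forests form a commutative monoid under disjoint union, with the empty forest as unit. -/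
instance : CommMonoid (Forest A) where
  mul_assoc := by
    rintro ⟨f⟩ ⟨g⟩ ⟨h⟩
    exact congrArg mk (PlanarForest.append_assoc f g h)
  one_mul := by
    rintro ⟨f⟩
    rfl
  mul_one := by
    rintro ⟨f⟩
    exact congrArg mk (PlanarForest.append_nil f)
  mul_comm := by
    rintro ⟨f⟩ ⟨g⟩
    change mk (f.append g) = mk (g.append f)
    induction f with
    | nil => exact (congrArg mk (PlanarForest.append_nil g)).symm
    | cons a c r _ ih =>
      rw [mk_append_cons]
      exact congrArg (Quot.map (PlanarForest.cons a c) (fun _ _ h => .rest a c h)) ih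

theorem finite_deg_le [Finite A] (n : ℕ) : {f : Forest A | deg f ≤ n}.Finite := by
  refine ((PlanarForest.finite_deg_le (A := A) n).image mk).subset ?_
  rintro ⟨f⟩ hf
  exact ⟨f, hf, rfl⟩

/-- The finite set of forests with at most `n` vertices. -/
def upTo (A : Type*) [Finite A] (n : ℕ) : Finset (Forest A) :=
  (finite_deg_le (A := A) n).toFinset

end Forest

/-! ## The Connes-Kreimer Hopf algebra -/

/-- The polynomial algebra on decorated rooted trees: its basis consists of the forests, and the
product of forests is their disjoint union. -/
abbrev CK (A : Type*) : Type _ := MonoidAlgebra ℝ (Forest A)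

variable {A : Type*}

/-- A forest as an element of the Hopf algebra. -/
def ofForest (h : Forest A) : CK A := MonoidAlgebra.single h 1

/-- The linear map with prescribed values on forests. -/
def extend {V : Type*} [AddCommMonoid V] [Module ℝ V] (g : Forest A → V) : CK A →ₗ[ℝ] V :=
  Finsupp.linearCombination ℝ g ∘ₗ (MonoidAlgebra.coeffLinearEquiv ℝ).toLinearMap

/-- The linear functional `δ_h`, which reads off the coefficient of the forest `h`. -/
def coef (h : Forest A) : CK A →ₗ[ℝ] ℝ :=
  Finsupp.lapply h ∘ₗ (MonoidAlgebra.coeffLinearEquiv ℝ).toLinearMap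

/-- The linear map `h ↦ [h]_a`. -/
def graftRoot (a : A) : CK A →ₗ[ℝ] CK A := extend fun h => ofForest (Forest.tree a h)

/-- The coproduct of a planar forest, by recursion from
`Δ 1 = 1 ⊗ 1`, `Δ (h₁ h₂) = Δ h₁ Δ h₂` and `Δ [h]_a = (id ⊗ [·]_a) Δ h + [h]_a ⊗ 1`. -/
def planarCoproduct : PlanarForest A → CK A ⊗[ℝ] CK A
  | .nil => 1
  | .cons a c r =>
      (TensorProduct.map LinearMap.id (graftRoot a) (planarCoproduct c)
        + ofForest (Forest.tree a (Forest.mk c)) ⊗ₜ[ℝ] 1) * planarCoproduct r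

theorem planarCoproduct_rel {f g : PlanarForest A} (h : PlanarForest.Rel f g) :
    planarCoproduct f = planarCoproduct g := by
  induction h with
  | swap a b c d r => simp only [planarCoproduct]; ring
  | @children a c c' r h ih =>
    have : Forest.mk c = Forest.mk c' := Quot.sound h
    simp only [planarCoproduct, ih, this]
  | rest a c _ ih => simp only [planarCoproduct, ih]

theorem planarCoproduct_append (f g : PlanarForest A) :
    planarCoproduct (f.append g) = planarCoproduct f * planarCoproduct g := by
  induction f with
  | nil => simp [PlanarForest.append, planarCoproduct]
  | cons a c r _ ih => simp only [PlanarForest.append, planarCoproduct, ih, mul_assoc]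

/-- The coproduct on forests. -/
def forestCoproduct : Forest A →* CK A ⊗[ℝ] CK A where
  toFun := Quot.lift planarCoproduct fun _ _ h => planarCoproduct_rel h
  map_one' := rfl
  map_mul' := by
    rintro ⟨f⟩ ⟨g⟩
    exact planarCoproduct_append f g

/-- The coproduct `Δ`. -/
def coproduct : CK A →ₐ[ℝ] CK A ⊗[ℝ] CK A :=
  MonoidAlgebra.lift ℝ (CK A ⊗[ℝ] CK A) (Forest A) forestCoproduct

theorem coproduct_ofForest (h : Forest A) : coproduct (ofForest h) = forestCoproduct h := by
  simp [coproduct, ofForest]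

theorem graftRoot_ofForest (a : A) (h : Forest A) : graftRoot a (ofForest h) = ofForest (Forest.tree a h) := by
  simp [graftRoot, extend, ofForest]

/-- The defining relation of the coproduct. -/
theorem coproduct_graftRoot (a : A) (x : CK A) :
    coproduct (graftRoot a x) =
      TensorProduct.map LinearMap.id (graftRoot a) (coproduct x) + graftRoot a x ⊗ₜ[ℝ] 1 := by
  induction x using MonoidAlgebra.induction_linear with
  | zero => simp
  | add x y hx hy => simp only [map_add, hx, hy, TensorProduct.add_tmul]; abel
  | single h r =>
    have : (MonoidAlgebra.single h r : CK A) = r • ofForest h := by simp [ofForest]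
    simp only [this, map_smul, graftRoot_ofForest, coproduct_ofForest, ← TensorProduct.smul_tmul']
    rw [← smul_add]
    congr 1
    obtain ⟨c⟩ := h
    exact mul_one _

/-- The convolution product `φ ⋆ ψ = m ∘ (φ ⊗ ψ) ∘ Δ` of linear functionals. -/
def conv (φ ψ : CK A →ₗ[ℝ] ℝ) : CK A →ₗ[ℝ] ℝ :=
  LinearMap.mul' ℝ ℝ ∘ₗ TensorProduct.map φ ψ ∘ₗ coproduct.toLinearMap

/-- The space of primitive elements. -/
def Prim (A : Type*) : Submodule ℝ (CK A) where
  carrier := {x | coproduct x = x ⊗ₜ[ℝ] 1 + 1 ⊗ₜ[ℝ] x}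
  zero_mem' := by simp
  add_mem' := by
    intro x y hx hy
    simp only [Set.mem_ofPred_eq] at hx hy ⊢
    rw [map_add, hx, hy, TensorProduct.add_tmul, TensorProduct.tmul_add]
    abel
  smul_mem' := by
    intro c x hx
    simp only [Set.mem_ofPred_eq] at hx ⊢
    rw [map_smul, hx, smul_add, TensorProduct.smul_tmul', TensorProduct.tmul_smul]

/-- The homogeneous component of degree `n`, spanned by the forests with `n` vertices. -/
def homogeneous (A : Type*) (n : ℕ) : Submodule ℝ (CK A) :=
  Submodule.span ℝ (ofForest '' {h : Forest A | h.deg = n})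

/-! ## Natural growth -/

/-- For a forest `h` and a planar forest, the sum over all vertices `v` of the latter of the forest
obtained by grafting all trees of `h` to `v`. -/
def planarGrowth (h : Forest A) : PlanarForest A → CK A
  | .nil => 0
  | .cons a c r =>
      ofForest (Forest.tree a (h * Forest.mk c)) * ofForest (Forest.mk r)
        + graftRoot a (planarGrowth h c) * ofForest (Forest.mk r)
        + ofForest (Forest.tree a (Forest.mk c)) * planarGrowth h r

theorem ofForest_mul (f g : Forest A) : ofForest (f * g) = ofForest f * ofForest g := by
  simp [ofForest, MonoidAlgebra.single_mul_single]

theorem planarGrowth_rel (h : Forest A) {f g : PlanarForest A} (hfg : PlanarForest.Rel f g) :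
    planarGrowth h f = planarGrowth h g := by
  induction hfg with
  | swap a b c d r => simp only [planarGrowth, Forest.mk_cons, ofForest_mul]; ring
  | @children a c c' r hc ih =>
    have : Forest.mk c = Forest.mk c' := Quot.sound hc
    simp only [planarGrowth, ih, this]
  | @rest a c r r' hr ih =>
    have : Forest.mk r = Forest.mk r' := Quot.sound hr
    simp only [planarGrowth, ih, this]

/-- The sum over all vertices `v` of `h'` of the forest obtained by grafting `h` to `v`. -/
def forestGrowth (h : Forest A) : Forest A → CK A :=
  Quot.lift (planarGrowth h) fun _ _ hfg => planarGrowth_rel h hfg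

/-- The natural growth operator `x ⊤ y`: the bilinear operation given on forests by grafting `h` to
every vertex of `h'`, normalised by the number of vertices of `h'`. -/
def growth : CK A →ₗ[ℝ] CK A →ₗ[ℝ] CK A :=
  extend fun h => extend fun h' => (h'.deg : ℝ)⁻¹ • forestGrowth h h'

/-- The iterated operation `⊤(x₁, …, x_k) = (⋯(x₁ ⊤ x₂) ⊤ ⋯) ⊤ x_k`, equal to the empty forest for
the empty list. -/
def iterGrowth : List (CK A) → CK A
  | [] => 1
  | x :: l => l.foldl (fun y z => growth y z) x

/-- A basis of the space of primitive elements consisting of homogeneous elements. -/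
structure PrimBasis (A : Type*) (ι : Type*) where
  /-- the basis -/
  basis : Module.Basis ι ℝ (Prim A)
  /-- the degrees of the basis elements -/
  deg : ι → ℕ
  mem_homogeneous : ∀ i, (basis i : CK A) ∈ homogeneous A (deg i)

namespace PrimBasis

variable {ι : Type*} (P : PrimBasis A ι)

/-- The basis element `p_i`. -/
def elt (i : ι) : CK A := P.basis i

/-- The element `⊤(p_{i₁}, …, p_{i_k})` of the Hopf algebra attached to a word `i₁ ⋯ i_k`. By a
theorem of Foissy these elements form a basis of the Hopf algebra. -/
def word (w : List ι) : CK A := iterGrowth (w.map P.elt)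

/-- The degree of `⊤(p_{i₁}, …, p_{i_k})`. -/
def wordDeg (w : List ι) : ℕ := (w.map P.deg).sum

open Classical in
/-- The dual basis: `P.dual w` is the linear functional with value `1` on `P.word w` and `0` on the
other elements `P.word v`. -/
def dual (w : List ι) : CK A →ₗ[ℝ] ℝ :=
  Classical.epsilon fun φ => ∀ v : List ι, φ (P.word v) = if v = w then 1 else 0

theorem homogeneous_zero_inf_prim {x : CK A} (h0 : x ∈ homogeneous A 0) (hx : x ∈ Prim A) :
    x = 0 := by
  have hset : ofForest '' {h : Forest A | h.deg = 0} ⊆ {(1 : CK A)} := by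
    rintro _ ⟨⟨f⟩, hf, rfl⟩
    cases f with
    | nil => rfl
    | cons a c r =>
      change PlanarForest.deg (PlanarForest.cons a c r) = 0 at hf
      simp [PlanarForest.deg] at hf
  obtain ⟨c, rfl⟩ := Submodule.mem_span_singleton.1 (Submodule.span_mono hset h0)
  change coproduct (c • (1 : CK A)) = (c • (1 : CK A)) ⊗ₜ[ℝ] 1 + 1 ⊗ₜ[ℝ] (c • (1 : CK A)) at hx
  rw [map_smul, map_one, Algebra.TensorProduct.one_def, TensorProduct.smul_tmul',
    ← TensorProduct.smul_tmul (R := ℝ)] at hx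
  have h2 : (c • (1 : CK A)) ⊗ₜ[ℝ] (1 : CK A) = 0 := by
    simpa using hx
  have h3 := congrArg (LinearMap.mul' ℝ ℝ ∘ TensorProduct.map (coef 1) (coef 1)) h2
  have h4 : coef (1 : Forest A) (1 : CK A) = 1 := by
    simp [coef, MonoidAlgebra.one_def]
  simp [h4] at h3
  simp [h3]

theorem deg_pos (i : ι) : 0 < P.deg i := by
  rcases Nat.eq_zero_or_pos (P.deg i) with h | h
  · have h0 := P.mem_homogeneous i
    rw [h] at h0
    exact absurd (Subtype.ext (homogeneous_zero_inf_prim h0 (P.basis i).2)) (P.basis.ne_zero i)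
  · exact h

theorem finite_deg_le [Finite A] (n : ℕ) : {i : ι | P.deg i ≤ n}.Finite := by
  let W : Submodule ℝ (CK A) := Submodule.span ℝ (ofForest '' {h : Forest A | h.deg ≤ n})
  have : FiniteDimensional ℝ W :=
    FiniteDimensional.span_of_finite ℝ ((Forest.finite_deg_le n).image _)
  have hmem : ∀ i : {i : ι | P.deg i ≤ n}, (P.basis i : CK A) ∈ W := by
    rintro ⟨i, hi⟩
    refine Submodule.span_mono (Set.image_mono ?_) (P.mem_homogeneous i)
    intro h hh
    exact le_of_eq_of_le hh hi
  have hli : LinearIndependent ℝ (fun i : {i : ι | P.deg i ≤ n} => (P.basis i : CK A)) :=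
    (P.basis.linearIndependent.map' (Prim A).subtype (Submodule.ker_subtype _)).comp _
      Subtype.val_injective
  have hli' : LinearIndependent ℝ
      (fun i : {i : ι | P.deg i ≤ n} => (⟨P.basis i, hmem i⟩ : W)) :=
    LinearIndependent.of_comp W.subtype hli
  have := hli'.finite
  exact Set.toFinite _

theorem finite_wordDeg_le [Finite A] (n : ℕ) : {w : List ι | P.wordDeg w ≤ n}.Finite := by
  induction n with
  | zero =>
    refine (Set.finite_singleton ([] : List ι)).subset ?_
    rintro (_ | ⟨i, w⟩) hw
    · rfl
    · have := P.deg_pos i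
      simp [wordDeg] at hw
      omega
  | succ n ih =>
    refine ((((P.finite_deg_le (n + 1)).prod ih).image (fun x => x.1 :: x.2)).insert []).subset ?_
    rintro (_ | ⟨i, w⟩) hw
    · exact Set.mem_insert _ _
    · have := P.deg_pos i
      refine Set.mem_insert_of_mem _ ⟨(i, w), ⟨?_, ?_⟩, rfl⟩ <;>
      · simp only [wordDeg, List.map_cons, List.sum_cons, Set.mem_ofPred_eq] at hw ⊢
        omega

theorem finite_deg_lt [Finite A] (n : ℕ) : {i : ι | P.deg i < n}.Finite :=
  (P.finite_deg_le n).subset fun i (h : P.deg i < n) => show P.deg i ≤ n from h.le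

theorem finite_wordDeg_lt [Finite A] (n : ℕ) : {w : List ι | P.wordDeg w < n}.Finite :=
  (P.finite_wordDeg_le n).subset fun w (h : P.wordDeg w < n) => show P.wordDeg w ≤ n from h.le

end PrimBasis

/-! ## Hölder norms -/

/-- The `γ`-Hölder norm `sup_{s ≠ t} |g_{s,t}| / |t - s|^γ` on `[0,T]` of a function of two
variables. -/
def holderNorm (T γ : ℝ) (g : ℝ → ℝ → ℝ) : ℝ≥0∞ :=
  ⨆ s ∈ Icc 0 T, ⨆ t ∈ Icc 0 T, ⨆ _ : s ≠ t, ENNReal.ofReal (|g s t| / |t - s| ^ γ)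

/-- The increments `δ f_{s,t} = f_t - f_s` of a path. -/
def incr (f : ℝ → ℝ) (s t : ℝ) : ℝ := f t - f s

/-- The path `f` belongs on `[0,T]` to the closure of the smooth functions under the norm
`|f_0| + ‖δ f‖_γ`. -/
def IsLittleHolder (T γ : ℝ) (f : ℝ → ℝ) : Prop :=
  ∀ η : ℝ≥0∞, 0 < η → ∃ g : ℝ → ℝ, ContDiff ℝ ∞ g ∧
    ENNReal.ofReal |f 0 - g 0| + holderNorm T γ (incr fun t => f t - g t) ≤ η

/-! ## Branched rough paths and controlled paths -/

/-- An `α`-Hölder branched rough path on `[0,T]`. Only the characters `X_{s,t}` with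
`s, t ∈ [0,T]` matter. -/
structure RoughPath (A : Type*) (α T : ℝ) where
  /-- the characters `X_{s,t}` -/
  char : ℝ → ℝ → (CK A →ₐ[ℝ] ℝ)
  chen : ∀ s ∈ Icc 0 T, ∀ u ∈ Icc 0 T, ∀ t ∈ Icc 0 T,
    conv (char s u).toLinearMap (char u t).toLinearMap = (char s t).toLinearMap
  holder : ∀ h : Forest A, ∃ C : ℝ, ∀ s ∈ Icc 0 T, ∀ t ∈ Icc 0 T,
    |char s t (ofForest h)| ≤ C * |t - s| ^ (α * h.deg)

namespace RoughPath

variable {α T : ℝ}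

/-- The component `X^h_{s,t}`. -/
def comp (X : RoughPath A α T) (h : Forest A) (s t : ℝ) : ℝ := X.char s t (ofForest h)

/-- The homogeneous norm `max ‖X^h‖_{|h|α}` over the forests with `1 ≤ |h| ≤ N = ⌊1/α⌋`. -/
def norm (X : RoughPath A α T) : ℝ≥0∞ :=
  ⨆ (h : Forest A) (_ : 1 ≤ h.deg ∧ h.deg ≤ ⌊α⁻¹⌋₊), holderNorm T (h.deg * α) (X.comp h)

/-- The distance `ρ_α(X, Y) = max ‖X^h - Y^h‖_{|h|α}` over the forests with
`1 ≤ |h| ≤ N = ⌊1/α⌋`. -/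
def rho (X Y : RoughPath A α T) : ℝ≥0∞ :=
  ⨆ (h : Forest A) (_ : 1 ≤ h.deg ∧ h.deg ≤ ⌊α⁻¹⌋₊),
    holderNorm T (h.deg * α) fun s t => X.comp h s t - Y.comp h s t

/-- The remainder `R^h_{s,t} = ⟨h, Z_t⟩ - ⟨X_{s,t} ⋆ h, Z_s⟩`. -/
def remainder (X : RoughPath A α T) (Z : ℝ → CK A) (h : Forest A) (s t : ℝ) : ℝ :=
  coef h (Z t) - conv (X.char s t).toLinearMap (coef h) (Z s)

/-- `Z` is a path controlled by `X`: on `[0,T]` it takes values in the span of the forests with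
less than `N = ⌊1/α⌋` vertices, and `‖R^h‖_{(N - |h|)α} < ∞` for all these forests. -/
structure IsControlled (X : RoughPath A α T) (Z : ℝ → CK A) : Prop where
  mem : ∀ t ∈ Icc 0 T, ∀ h : Forest A, ⌊α⁻¹⌋₊ ≤ h.deg → coef h (Z t) = 0
  holder : ∀ h : Forest A, h.deg < ⌊α⁻¹⌋₊ → ∃ C : ℝ, ∀ s ∈ Icc 0 T, ∀ t ∈ Icc 0 T,
    |X.remainder Z h s t| ≤ C * |t - s| ^ (((⌊α⁻¹⌋₊ : ℝ) - h.deg) * α)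

/-- The distance `‖Z; Z'‖_α` of a path `Z` controlled by `X` and a path `Z'` controlled by `X'`. -/
def ctrlDist (X X' : RoughPath A α T) (Z Z' : ℝ → CK A) : ℝ≥0∞ :=
  ∑' h : {h : Forest A // h.deg < ⌊α⁻¹⌋₊},
    (ENNReal.ofReal |coef h.1 (Z 0) - coef h.1 (Z' 0)| +
      holderNorm T (((⌊α⁻¹⌋₊ : ℝ) - h.1.deg) * α) fun s t =>
        X.remainder Z h.1 s t - X'.remainder Z' h.1 s t)

end RoughPath

/-! ## Integrals as limits of Riemann sums -/

/-- The Riemann sums `∑ Ξ_{u,v}` over the partitions of `[s,t]` converge to `I` as the mesh tends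
to `0`. -/
def HasSewing (Ξ : ℝ → ℝ → ℝ) (s t I : ℝ) : Prop :=
  ∀ η > 0, ∃ δ > 0, ∀ (n : ℕ) (x : ℕ → ℝ), Monotone x → x 0 = s → x n = t →
    (∀ k < n, x (k + 1) - x k ≤ δ) →
      |(∑ k ∈ Finset.range n, Ξ (x k) (x (k + 1))) - I| ≤ η

/-- The limit of the Riemann sums over partitions of `[s,t]`. -/
def sewing (Ξ : ℝ → ℝ → ℝ) (s t : ℝ) : ℝ := Classical.epsilon (HasSewing Ξ s t)

/-! ## The map `Γ` -/

/-- The space `S_N`, with `N = ⌊1/α⌋`: families of paths in the closure of the smooth functions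
under the `(1-ε)`-Hölder norm, indexed by the forests with at most `N - 1` vertices. -/
def IsSmoothData (α ε T : ℝ) (f : Forest A → ℝ → ℝ) : Prop :=
  ∀ h : Forest A, h.deg < ⌊α⁻¹⌋₊ → IsLittleHolder T (1 - ε) (f h)

/-- `|f| = max ‖f^h‖_{1-ε}` over the forests with at most `N - 1` vertices, where
`‖f^h‖_{1-ε} = sup_{s ≠ t} |f^h_t - f^h_s| / |t - s|^{1-ε}`. -/
def dataNorm (α ε T : ℝ) (f : Forest A → ℝ → ℝ) : ℝ≥0∞ :=
  ⨆ (h : Forest A) (_ : h.deg < ⌊α⁻¹⌋₊), holderNorm T (1 - ε) (incr (f h))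

section Gamma

variable [Finite A] {ι : Type*} (P : PrimBasis A ι) {α T : ℝ} (X : RoughPath A α T)

/-- The germ of the rough integral `∫ Z^{p* ⋆ h} dX^p` for `p = p_i`:
`Ξ_{s,t} = ∑_ρ Z^{ρ* ⋆ p* ⋆ h}_s X^{ρ ⊤ p}_{s,t}`, the sum being over the `ρ` of the form
`⊤(p_{i₁}, …, p_{i_k})`, `k ≥ 0`, with `|ρ| < N - |h| - |p|`. Here `Z^φ = ⟨φ, Z⟩`. -/
def germ (Z : ℝ → CK A) (h : Forest A) (i : ι) (s t : ℝ) : ℝ :=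
  ∑ w ∈ (P.finite_wordDeg_lt (⌊α⁻¹⌋₊ - h.deg - P.deg i)).toFinset,
    conv (P.dual w) (conv (P.dual [i]) (coef h)) (Z s) *
      X.char s t (growth (P.word w) (P.elt i))

/-- The construction of `Γ_X(f)` by descending recursion on the degree: `gammaAux P X f k` consists
of the components `Γ_X(f)^h` with `N - k ≤ |h| ≤ N - 1`, and those with `|h| = N - 1 - k` are
`Γ_X(f)^h_t = ∑_{|p| < N - |h|} ∫_0^t Γ_X(f)^{p* ⋆ h}_r dX^p_r + f^h_t`.
For `|h| = N - 1` the sum over `p` is empty, since primitive elements have positive degree. -/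
def gammaAux (f : Forest A → ℝ → ℝ) : ℕ → ℝ → CK A
  | 0 => fun _ => 0
  | k + 1 => fun t => gammaAux f k t +
      ∑ h ∈ (Forest.upTo A ⌊α⁻¹⌋₊).filter (fun h => h.deg + k + 1 = ⌊α⁻¹⌋₊),
        ((∑ i ∈ (P.finite_deg_lt (⌊α⁻¹⌋₊ - h.deg)).toFinset,
            sewing (germ P X (gammaAux f k) h i) 0 t) + f h t) • ofForest h

/-- The path `Γ_X(f)`. -/
def Gamma (f : Forest A → ℝ → ℝ) : ℝ → CK A := gammaAux P X f ⌊α⁻¹⌋₊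

end Gamma

end BranchedRP

end

/-!
Iterated natural growths of primitive elements ("words") turn the Hopf algebra into a tensor
coalgebra. For a homogeneous primitive element `p` the coproduct of `x ⊤ p` is
`(x ⊤ p) ⊗ 1 + ∑ x₁ ⊗ (x₂ ⊤ p)` (`conv_growth`, from the computation of admissible cuts of a grafting
in `coproduct_graft`). Hence the coproduct deconcatenates words, words are linearly independent
(`linearIndependent_word`) and they span (`span_word`), so that the dual functionals of the words
are what their name says (`dual_word`).

Consequently the germ of the rough integral is a convolution product, namely
`⟨χ_{s,t} ⋆ p* ⋆ h, Z_s⟩` with `χ_{s,t} = ⟨X_{s,t}, · ⊤ p⟩` (`germ_eq_conv`). Two consequences carry the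
proof. The remainder of `Z` is its increment minus the sum of the germs (`remainder_eq`), so for
`Γ_X(f)` it is the increment of `f` plus the errors of the integrals against their germs
(`remainder_Gamma`). By Chen's relation the defect of additivity of the germ of level `h` is a bilinear
expression in `X_{u,t}` and the remainders `R^g_{s,u}` with `|g| > |h|` (`germ_delta`).

The estimates go by descending recursion on `|h|`. The exponents `(N - |h|) α` of a general
controlled path are not enough for sewing, because `N α < 1`; but the remainders of `Γ_X(f)` are even
`(1 - ε)`-Hölder: at the top level they are the increments of `f`, and `α + (1 - ε) > 1` allows sewing
at each further level (`exists_holderBound_remainder`). In the difference of two solutions with the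
same data the increments of `f` cancel, and the bilinear expressions give the Lipschitz estimate
(`exists_holderBound_remainder_sub`).

The sewing lemma (`exists_hasSewing`) rests on a bound for all Riemann sums, proved by halving the
interval (`abs_riemannSum_sub_le`).
-/

namespace BranchedRP

variable {A : Type*}

/-! ### Linear maps on the Hopf algebra -/

theorem extend_ofForest {V : Type*} [AddCommMonoid V] [Module ℝ V] (g : Forest A → V)
    (h : Forest A) : extend g (ofForest h) = g h := by
  simp [extend, ofForest]

theorem linearMap_ext_forest {V : Type*} [AddCommMonoid V] [Module ℝ V] {F G : CK A →ₗ[ℝ] V}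
    (H : ∀ h, F (ofForest h) = G (ofForest h)) : F = G := by
  refine LinearMap.ext fun x => ?_
  induction x using MonoidAlgebra.induction_linear with
  | zero => simp
  | add x y hx hy => simp only [map_add, hx, hy]
  | single h r =>
    have : (MonoidAlgebra.single h r : CK A) = r • ofForest h := by simp [ofForest]
    rw [this, map_smul, map_smul, H]

theorem ofForest_one : ofForest (1 : Forest A) = 1 := rfl

open Classical in
theorem coef_ofForest (g h : Forest A) : coef g (ofForest h) = if h = g then 1 else 0 := by
  simp [coef, ofForest, Finsupp.single_apply]

theorem coef_ofForest_self (h : Forest A) : coef h (ofForest h) = 1 := by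
  simp [coef_ofForest]

theorem coef_ofForest_ne {g h : Forest A} (H : h ≠ g) : coef g (ofForest h) = 0 := by
  simp [coef_ofForest, H]

theorem eq_of_coef_eq {x y : CK A} (H : ∀ h, coef h x = coef h y) : x = y := by
  apply (MonoidAlgebra.coeffLinearEquiv ℝ).injective
  ext h
  exact H h

/-- A vector supported on a finite set of forests, as a combination of these forests. -/
theorem eq_sum_coef (S : Finset (Forest A)) {x : CK A} (hx : ∀ h, h ∉ S → coef h x = 0) :
    x = ∑ h ∈ S, coef h x • ofForest h := by
  classical
  apply eq_of_coef_eq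
  intro g
  simp only [map_sum, map_smul, coef_ofForest, smul_eq_mul, mul_ite, mul_one, mul_zero,
    Finset.sum_ite_eq']
  split_ifs with hg
  · rfl
  · exact hx g hg

theorem forest_induction {motive : Forest A → Prop} (one : motive 1)
    (tree_mul : ∀ a c r, motive c → motive r → motive (Forest.tree a c * r)) (h : Forest A) :
    motive h := by
  obtain ⟨f⟩ := h
  induction f with
  | nil => exact one
  | cons a c r hc hr => exact tree_mul a _ _ hc hr

theorem deg_one : (1 : Forest A).deg = 0 := rfl

theorem deg_mul (f g : Forest A) : (f * g).deg = f.deg + g.deg := by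
  obtain ⟨f⟩ := f
  obtain ⟨g⟩ := g
  change (f.append g).deg = f.deg + g.deg
  induction f with
  | nil => simp [PlanarForest.append, PlanarForest.deg]
  | cons a c r _ ih => simp only [PlanarForest.append, PlanarForest.deg, ih]; omega

theorem deg_tree (a : A) (c : Forest A) : (Forest.tree a c).deg = c.deg + 1 := by
  obtain ⟨c⟩ := c
  rfl

theorem deg_eq_zero {h : Forest A} : h.deg = 0 ↔ h = 1 := by
  refine ⟨fun H => ?_, fun H => H ▸ deg_one⟩
  revert H
  refine forest_induction (motive := fun h => h.deg = 0 → h = 1) (fun _ => rfl) ?_ h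
  intro a c r _ _ H
  rw [deg_mul, deg_tree] at H
  omega

theorem coproduct_ofForest_mul (f g : Forest A) :
    coproduct (ofForest (f * g)) = coproduct (ofForest f) * coproduct (ofForest g) := by
  rw [ofForest_mul, map_mul]

/-! ### The grading of the coproduct -/

/-- The component of degree `n` of `CK A ⊗ CK A`. -/
noncomputable def tensorGrade (A : Type*) (n : ℕ) : Submodule ℝ (CK A ⊗[ℝ] CK A) :=
  Submodule.span ℝ {t | ∃ g g' : Forest A, g.deg + g'.deg = n ∧ t = ofForest g ⊗ₜ ofForest g'}

theorem tmul_mem_tensorGrade {n : ℕ} {g g' : Forest A} (h : g.deg + g'.deg = n) :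
    ofForest g ⊗ₜ ofForest g' ∈ tensorGrade A n :=
  Submodule.subset_span ⟨g, g', h, rfl⟩

theorem mul_mem_tensorGrade {m n : ℕ} {s t : CK A ⊗[ℝ] CK A} (hs : s ∈ tensorGrade A m)
    (ht : t ∈ tensorGrade A n) : s * t ∈ tensorGrade A (m + n) := by
  have h := Submodule.mul_mem_mul hs ht
  rw [tensorGrade, tensorGrade, Submodule.span_mul_span] at h
  refine Submodule.span_mono ?_ h
  rintro _ ⟨_, ⟨g, g', hg, rfl⟩, _, ⟨k, k', hk, rfl⟩, rfl⟩
  refine ⟨g * k, g' * k', ?_, ?_⟩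
  · rw [deg_mul, deg_mul]; omega
  · simp only [Algebra.TensorProduct.tmul_mul_tmul, ofForest_mul]

theorem map_graftRoot_mem_tensorGrade {n : ℕ} (a : A) {t : CK A ⊗[ℝ] CK A}
    (ht : t ∈ tensorGrade A n) :
    TensorProduct.map LinearMap.id (graftRoot a) t ∈ tensorGrade A (n + 1) := by
  have h := Submodule.mem_map_of_mem (f := TensorProduct.map LinearMap.id (graftRoot a)) ht
  rw [tensorGrade, Submodule.map_span] at h
  refine Submodule.span_mono ?_ h
  rintro _ ⟨_, ⟨g, g', hg, rfl⟩, rfl⟩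
  refine ⟨g, Forest.tree a g', ?_, ?_⟩
  · rw [deg_tree]; omega
  · rw [TensorProduct.map_tmul, graftRoot_ofForest, LinearMap.id_apply]

theorem coproduct_mem_tensorGrade (h : Forest A) :
    coproduct (ofForest h) ∈ tensorGrade A h.deg := by
  refine forest_induction (motive := fun h => coproduct (ofForest h) ∈ tensorGrade A h.deg)
    ?_ ?_ h
  · rw [ofForest_one, map_one, Algebra.TensorProduct.one_def]
    exact tmul_mem_tensorGrade rfl
  · intro a c r hc hr
    rw [coproduct_ofForest_mul, deg_mul]
    refine mul_mem_tensorGrade ?_ hr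
    rw [← graftRoot_ofForest, coproduct_graftRoot, deg_tree]
    refine Submodule.add_mem _ (map_graftRoot_mem_tensorGrade a hc) ?_
    rw [graftRoot_ofForest]
    exact tmul_mem_tensorGrade (by rw [deg_tree, deg_one])

/-- Linear maps on `CK A ⊗ CK A` may be compared on the coproduct of a forest `h` by comparing
them on the pairs of forests with `|h|` vertices in total. -/
theorem eq_on_coproduct {V : Type*} [AddCommMonoid V] [Module ℝ V]
    {F G : CK A ⊗[ℝ] CK A →ₗ[ℝ] V} (h : Forest A)
    (H : ∀ g g' : Forest A, g.deg + g'.deg = h.deg →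
      F (ofForest g ⊗ₜ ofForest g') = G (ofForest g ⊗ₜ ofForest g')) :
    F (coproduct (ofForest h)) = G (coproduct (ofForest h)) := by
  refine LinearMap.eqOn_span ?_ (coproduct_mem_tensorGrade h)
  rintro _ ⟨g, g', hg, rfl⟩
  exact H g g' hg

theorem conv_apply (φ ψ : CK A →ₗ[ℝ] ℝ) (x : CK A) :
    conv φ ψ x = LinearMap.mul' ℝ ℝ (TensorProduct.map φ ψ (coproduct x)) := rfl

theorem conv_congr {φ ψ φ' ψ' : CK A →ₗ[ℝ] ℝ} (h : Forest A)
    (H : ∀ g g' : Forest A, g.deg + g'.deg = h.deg →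
      φ (ofForest g) * ψ (ofForest g') = φ' (ofForest g) * ψ' (ofForest g')) :
    conv φ ψ (ofForest h) = conv φ' ψ' (ofForest h) := by
  refine eq_on_coproduct (F := LinearMap.mul' ℝ ℝ ∘ₗ TensorProduct.map φ ψ)
    (G := LinearMap.mul' ℝ ℝ ∘ₗ TensorProduct.map φ' ψ') h ?_
  intro g g' hg
  simpa using H g g' hg

theorem conv_eq_zero {φ ψ : CK A →ₗ[ℝ] ℝ} (h : Forest A)
    (H : ∀ g g' : Forest A, g.deg + g'.deg = h.deg →
      φ (ofForest g) * ψ (ofForest g') = 0) :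
    conv φ ψ (ofForest h) = 0 := by
  have := conv_congr (φ := φ) (ψ := ψ) (φ' := 0) (ψ' := 0) h (by simpa using H)
  rw [this]
  simp [conv_apply]

theorem conv_one (φ ψ : CK A →ₗ[ℝ] ℝ) : conv φ ψ 1 = φ 1 * ψ 1 := by
  simp [conv_apply, Algebra.TensorProduct.one_def]

theorem conv_add_left (φ φ' ψ : CK A →ₗ[ℝ] ℝ) : conv (φ + φ') ψ = conv φ ψ + conv φ' ψ := by
  ext x; simp [conv_apply, TensorProduct.map_add_left]

theorem conv_add_right (φ ψ ψ' : CK A →ₗ[ℝ] ℝ) : conv φ (ψ + ψ') = conv φ ψ + conv φ ψ' := by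
  ext x; simp [conv_apply, TensorProduct.map_add_right]

theorem conv_smul_left (c : ℝ) (φ ψ : CK A →ₗ[ℝ] ℝ) : conv (c • φ) ψ = c • conv φ ψ := by
  ext x; simp [conv_apply, TensorProduct.map_smul_left]

theorem conv_smul_right (c : ℝ) (φ ψ : CK A →ₗ[ℝ] ℝ) : conv φ (c • ψ) = c • conv φ ψ := by
  ext x; simp [conv_apply, TensorProduct.map_smul_right]

theorem conv_sub_right (φ ψ ψ' : CK A →ₗ[ℝ] ℝ) : conv φ (ψ - ψ') = conv φ ψ - conv φ ψ' :=
  eq_sub_of_add_eq (by rw [← conv_add_right, sub_add_cancel])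

theorem conv_sum_left {κ : Type*} (S : Finset κ) (φ : κ → CK A →ₗ[ℝ] ℝ) (ψ : CK A →ₗ[ℝ] ℝ) :
    conv (∑ k ∈ S, φ k) ψ = ∑ k ∈ S, conv (φ k) ψ := by
  classical
  induction S using Finset.induction_on with
  | empty => ext x; simp [conv_apply]
  | insert k S hk ih => rw [Finset.sum_insert hk, Finset.sum_insert hk, conv_add_left, ih]

theorem conv_sum_right {κ : Type*} (S : Finset κ) (φ : CK A →ₗ[ℝ] ℝ) (ψ : κ → CK A →ₗ[ℝ] ℝ) :
    conv φ (∑ k ∈ S, ψ k) = ∑ k ∈ S, conv φ (ψ k) := by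
  classical
  induction S using Finset.induction_on with
  | empty => ext x; simp [conv_apply]
  | insert k S hk ih => rw [Finset.sum_insert hk, Finset.sum_insert hk, conv_add_right, ih]

theorem coef_one_one : coef (1 : Forest A) (1 : CK A) = 1 := by
  rw [← ofForest_one, coef_ofForest_self]

/-- The functional reading off the coefficient of the empty forest is multiplicative. -/
theorem coef_one_mul (x y : CK A) :
    coef (1 : Forest A) (x * y) = coef (1 : Forest A) x * coef (1 : Forest A) y := by
  classical
  suffices H : LinearMap.compr₂ (LinearMap.mul ℝ (CK A)) (coef (1 : Forest A)) =
      (LinearMap.mul ℝ ℝ).compl₁₂ (coef (1 : Forest A)) (coef (1 : Forest A)) from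
    LinearMap.congr_fun₂ H x y
  refine linearMap_ext_forest fun f => linearMap_ext_forest fun g => ?_
  simp only [LinearMap.compr₂_apply, LinearMap.mul_apply', LinearMap.compl₁₂_apply]
  rw [← ofForest_mul]
  simp only [coef_ofForest, ← deg_eq_zero, deg_mul]
  by_cases h1 : f.deg = 0 <;> by_cases h2 : g.deg = 0 <;> simp [h1, h2]

theorem coef_one_graftRoot (a : A) (x : CK A) : coef (1 : Forest A) (graftRoot a x) = 0 := by
  suffices H : coef (1 : Forest A) ∘ₗ graftRoot a = 0 from LinearMap.congr_fun H x
  refine linearMap_ext_forest fun h => ?_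
  rw [LinearMap.comp_apply, graftRoot_ofForest, coef_ofForest_ne, LinearMap.zero_apply]
  rw [Ne, ← deg_eq_zero, deg_tree]
  omega

theorem lid_map_mul (s t : CK A ⊗[ℝ] CK A) :
    TensorProduct.lid ℝ (CK A) (TensorProduct.map (coef 1) LinearMap.id (s * t)) =
      TensorProduct.lid ℝ (CK A) (TensorProduct.map (coef 1) LinearMap.id s) *
        TensorProduct.lid ℝ (CK A) (TensorProduct.map (coef 1) LinearMap.id t) := by
  induction s with
  | zero => simp
  | add x y hx hy => simp only [add_mul, map_add, hx, hy]
  | tmul a b =>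
    induction t with
    | zero => simp
    | add x y hx hy => simp only [mul_add, map_add, hx, hy]
    | tmul c d => simp [coef_one_mul, mul_smul_mul_comm]

theorem rid_map_mul (s t : CK A ⊗[ℝ] CK A) :
    TensorProduct.rid ℝ (CK A) (TensorProduct.map LinearMap.id (coef 1) (s * t)) =
      TensorProduct.rid ℝ (CK A) (TensorProduct.map LinearMap.id (coef 1) s) *
        TensorProduct.rid ℝ (CK A) (TensorProduct.map LinearMap.id (coef 1) t) := by
  induction s with
  | zero => simp
  | add x y hx hy => simp only [add_mul, map_add, hx, hy]
  | tmul a b =>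
    induction t with
    | zero => simp
    | add x y hx hy => simp only [mul_add, map_add, hx, hy]
    | tmul c d => simp [coef_one_mul, mul_smul_mul_comm]

/-- The functional reading off the coefficient of the empty forest is a left counit. -/
theorem lid_coproduct (h : Forest A) :
    TensorProduct.lid ℝ (CK A) (TensorProduct.map (coef 1) LinearMap.id
      (coproduct (ofForest h))) = ofForest h := by
  refine forest_induction (motive := fun h => TensorProduct.lid ℝ (CK A) (TensorProduct.map
    (coef 1) LinearMap.id (coproduct (ofForest h))) = ofForest h) ?_ ?_ h
  · simp [ofForest_one, Algebra.TensorProduct.one_def, coef_one_one]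
  · intro a c r hc hr
    rw [coproduct_ofForest_mul, lid_map_mul, hr, ofForest_mul]
    congr 1
    rw [← graftRoot_ofForest, coproduct_graftRoot]
    conv_rhs => rw [← hc]
    have H : ∀ t : CK A ⊗[ℝ] CK A, TensorProduct.lid ℝ (CK A) (TensorProduct.map (coef 1)
        LinearMap.id (TensorProduct.map LinearMap.id (graftRoot a) t)) =
        graftRoot a (TensorProduct.lid ℝ (CK A) (TensorProduct.map (coef 1) LinearMap.id t)) := by
      intro t
      induction t with
      | zero => simp
      | add x y hx hy => simp only [map_add, hx, hy]
      | tmul x y => simp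
    rw [map_add, map_add, H]
    simp [coef_one_graftRoot]

/-- The functional reading off the coefficient of the empty forest is a right counit. -/
theorem rid_coproduct (h : Forest A) :
    TensorProduct.rid ℝ (CK A) (TensorProduct.map LinearMap.id (coef 1)
      (coproduct (ofForest h))) = ofForest h := by
  refine forest_induction (motive := fun h => TensorProduct.rid ℝ (CK A) (TensorProduct.map
    LinearMap.id (coef 1) (coproduct (ofForest h))) = ofForest h) ?_ ?_ h
  · simp [ofForest_one, Algebra.TensorProduct.one_def, coef_one_one]
  · intro a c r hc hr
    rw [coproduct_ofForest_mul, rid_map_mul, hr, ofForest_mul]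
    congr 1
    rw [← graftRoot_ofForest, coproduct_graftRoot]
    have H : ∀ t : CK A ⊗[ℝ] CK A, TensorProduct.rid ℝ (CK A) (TensorProduct.map
        LinearMap.id (coef 1) (TensorProduct.map LinearMap.id (graftRoot a) t)) = 0 := by
      intro t
      induction t with
      | zero => simp
      | add x y hx hy => simp only [map_add, hx, hy, add_zero]
      | tmul x y => simp [coef_one_graftRoot]
    rw [map_add, map_add, H]
    simp [coef_one_one]

theorem coef_one_conv (φ : CK A →ₗ[ℝ] ℝ) : conv (coef 1) φ = φ := by
  refine linearMap_ext_forest fun h => ?_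
  conv_rhs => rw [← lid_coproduct h]
  rw [conv_apply]
  induction coproduct (ofForest h) with
  | zero => simp
  | add x y hx hy => simp only [map_add, hx, hy]
  | tmul x y => simp

theorem conv_coef_one (φ : CK A →ₗ[ℝ] ℝ) : conv φ (coef 1) = φ := by
  refine linearMap_ext_forest fun h => ?_
  conv_rhs => rw [← rid_coproduct h]
  rw [conv_apply]
  induction coproduct (ofForest h) with
  | zero => simp
  | add x y hx hy => simp only [map_add, hx, hy]
  | tmul x y => simp [mul_comm]

/-! ### Coassociativity -/

theorem coproduct_coassoc (h : Forest A) :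
    Algebra.TensorProduct.assoc ℝ ℝ ℝ (CK A) (CK A) (CK A)
      (Algebra.TensorProduct.map coproduct (AlgHom.id ℝ (CK A)) (coproduct (ofForest h))) =
    Algebra.TensorProduct.map (AlgHom.id ℝ (CK A)) coproduct (coproduct (ofForest h)) := by
  refine forest_induction (motive := fun h => Algebra.TensorProduct.assoc ℝ ℝ ℝ (CK A) (CK A) (CK A)
      (Algebra.TensorProduct.map coproduct (AlgHom.id ℝ (CK A)) (coproduct (ofForest h))) =
    Algebra.TensorProduct.map (AlgHom.id ℝ (CK A)) coproduct (coproduct (ofForest h))) ?_ ?_ h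
  · simp [ofForest_one]
  · intro a c r hc hr
    rw [coproduct_ofForest_mul, map_mul, map_mul, map_mul, hr]
    congr 1
    rw [← graftRoot_ofForest, coproduct_graftRoot]
    generalize hY : graftRoot a (ofForest c) = Y
    have hΔY : coproduct Y = TensorProduct.map LinearMap.id (graftRoot a) (coproduct (ofForest c))
        + Y ⊗ₜ 1 := by rw [← hY, coproduct_graftRoot]
    -- commuting `[·]_a` in the last leg with `Δ ⊗ id`, with `id ⊗ Δ` and with the associator
    have H1 : ∀ t : (CK A ⊗[ℝ] CK A) ⊗[ℝ] CK A, Algebra.TensorProduct.assoc ℝ ℝ ℝ (CK A) (CK A) (CK A)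
        (TensorProduct.map LinearMap.id (graftRoot a) t) =
        TensorProduct.map LinearMap.id (TensorProduct.map LinearMap.id (graftRoot a))
          (Algebra.TensorProduct.assoc ℝ ℝ ℝ (CK A) (CK A) (CK A) t) := by
      intro t
      induction t with
      | zero => simp
      | add x y hx hy => simp only [map_add, hx, hy]
      | tmul x z =>
        induction x with
        | zero => simp
        | add x y hx hy => simp only [TensorProduct.add_tmul, map_add, hx, hy]
        | tmul x y => simp
    have H2 : ∀ t : CK A ⊗[ℝ] CK A, Algebra.TensorProduct.map coproduct (AlgHom.id ℝ (CK A))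
        (TensorProduct.map LinearMap.id (graftRoot a) t) =
        TensorProduct.map LinearMap.id (graftRoot a)
          (Algebra.TensorProduct.map coproduct (AlgHom.id ℝ (CK A)) t) := by
      intro t
      induction t with
      | zero => simp
      | add x y hx hy => simp only [map_add, hx, hy]
      | tmul x y => simp
    have H3 : ∀ t : CK A ⊗[ℝ] CK A, Algebra.TensorProduct.map (AlgHom.id ℝ (CK A)) coproduct
        (TensorProduct.map LinearMap.id (graftRoot a) t) =
        TensorProduct.map LinearMap.id (TensorProduct.map LinearMap.id (graftRoot a))
          (Algebra.TensorProduct.map (AlgHom.id ℝ (CK A)) coproduct t) +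
        Algebra.TensorProduct.assoc ℝ ℝ ℝ (CK A) (CK A) (CK A)
          (TensorProduct.map LinearMap.id (graftRoot a) t ⊗ₜ 1) := by
      intro t
      induction t with
      | zero => simp
      | add x y hx hy => simp only [map_add, TensorProduct.add_tmul, hx, hy]; abel
      | tmul x y => simp [coproduct_graftRoot, TensorProduct.tmul_add]
    rw [map_add, map_add, map_add, H2, H1, H3, hc]
    simp only [Algebra.TensorProduct.map_tmul, AlgHom.coe_id, id_eq, hΔY, map_one,
      TensorProduct.add_tmul, map_add, Algebra.TensorProduct.assoc_tmul,
      Algebra.TensorProduct.one_def]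
    abel

theorem conv_assoc (φ ψ χ : CK A →ₗ[ℝ] ℝ) : conv (conv φ ψ) χ = conv φ (conv ψ χ) := by
  refine linearMap_ext_forest fun h => ?_
  let m : CK A ⊗[ℝ] (CK A ⊗[ℝ] CK A) →ₗ[ℝ] ℝ := LinearMap.mul' ℝ ℝ ∘ₗ
    TensorProduct.map φ (LinearMap.mul' ℝ ℝ ∘ₗ TensorProduct.map ψ χ)
  have hL : ∀ t : CK A ⊗[ℝ] CK A, LinearMap.mul' ℝ ℝ (TensorProduct.map (conv φ ψ) χ t) =
      m (Algebra.TensorProduct.assoc ℝ ℝ ℝ (CK A) (CK A) (CK A)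
        (Algebra.TensorProduct.map coproduct (AlgHom.id ℝ (CK A)) t)) := by
    intro t
    induction t with
    | zero => simp
    | add x y hx hy => simp only [map_add, hx, hy]
    | tmul x z =>
      simp only [TensorProduct.map_tmul, LinearMap.mul'_apply, conv_apply,
        Algebra.TensorProduct.map_tmul, AlgHom.coe_id, id_eq]
      induction coproduct x with
      | zero => simp
      | add x y hx hy => simp only [map_add, TensorProduct.add_tmul, add_mul, hx, hy]
      | tmul x y => simp [m, mul_assoc]
  have hR : ∀ t : CK A ⊗[ℝ] CK A, LinearMap.mul' ℝ ℝ (TensorProduct.map φ (conv ψ χ) t) =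
      m (Algebra.TensorProduct.map (AlgHom.id ℝ (CK A)) coproduct t) := by
    intro t
    induction t with
    | zero => simp
    | add x y hx hy => simp only [map_add, hx, hy]
    | tmul x z => simp [m, conv_apply]
  rw [conv_apply, conv_apply, hL, hR, coproduct_coassoc]

/-! ### The coproduct of a natural growth -/

/-- The natural growth without normalisation: on forests, the sum of all graftings of `h` to a
vertex of `h'`. -/
noncomputable def graft : CK A →ₗ[ℝ] CK A →ₗ[ℝ] CK A := extend fun h => extend (forestGrowth h)

theorem graft_ofForest (h h' : Forest A) : graft (ofForest h) (ofForest h') = forestGrowth h h' := by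
  rw [graft, extend_ofForest, extend_ofForest]

theorem forestGrowth_tree_mul (h : Forest A) (a : A) (c r : Forest A) :
    forestGrowth h (Forest.tree a c * r) =
      ofForest (Forest.tree a (h * c)) * ofForest r
        + graftRoot a (forestGrowth h c) * ofForest r
        + ofForest (Forest.tree a c) * forestGrowth h r := by
  obtain ⟨c⟩ := c
  obtain ⟨r⟩ := r
  rfl

theorem forestGrowth_one (h : Forest A) : forestGrowth h 1 = 0 := rfl

theorem forestGrowth_mul (h f g : Forest A) :
    forestGrowth h (f * g) = forestGrowth h f * ofForest g + ofForest f * forestGrowth h g := by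
  refine forest_induction (motive := fun f => forestGrowth h (f * g) =
    forestGrowth h f * ofForest g + ofForest f * forestGrowth h g) ?_ ?_ f
  · rw [one_mul, forestGrowth_one, ofForest_one, zero_mul, one_mul, zero_add]
  · intro a c r _ ih
    rw [mul_assoc, forestGrowth_tree_mul, ih, forestGrowth_tree_mul, ofForest_mul, ofForest_mul]
    ring

theorem graft_one_right (x : CK A) : graft x 1 = 0 := by
  suffices H : graft.flip (1 : CK A) = 0 from LinearMap.congr_fun H x
  refine linearMap_ext_forest fun h => ?_
  rw [LinearMap.flip_apply, ← ofForest_one, graft_ofForest, forestGrowth_one, LinearMap.zero_apply]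

/-- Grafting `x` is a derivation. -/
theorem graft_mul (x y z : CK A) : graft x (y * z) = graft x y * z + y * graft x z := by
  have H : ∀ h f g : Forest A, graft (ofForest h) (ofForest f * ofForest g) =
      graft (ofForest h) (ofForest f) * ofForest g +
        ofForest f * graft (ofForest h) (ofForest g) := by
    intro h f g
    rw [← ofForest_mul, graft_ofForest, graft_ofForest, graft_ofForest, forestGrowth_mul]
  have H1 : ∀ h f : Forest A, ∀ z : CK A, graft (ofForest h) (ofForest f * z) =
      graft (ofForest h) (ofForest f) * z + ofForest f * graft (ofForest h) z := by
    intro h f z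
    refine LinearMap.congr_fun (f := graft (ofForest h) ∘ₗ LinearMap.mulLeft ℝ (ofForest f))
      (g := LinearMap.mulLeft ℝ (graft (ofForest h) (ofForest f)) +
        LinearMap.mulLeft ℝ (ofForest f) ∘ₗ graft (ofForest h)) ?_ z
    exact linearMap_ext_forest (H h f)
  have H2 : ∀ h : Forest A, ∀ y z : CK A, graft (ofForest h) (y * z) =
      graft (ofForest h) y * z + y * graft (ofForest h) z := by
    intro h y z
    refine LinearMap.congr_fun (f := graft (ofForest h) ∘ₗ LinearMap.mulRight ℝ z)
      (g := LinearMap.mulRight ℝ z ∘ₗ graft (ofForest h) +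
        LinearMap.mulRight ℝ (graft (ofForest h) z)) ?_ y
    exact linearMap_ext_forest fun f => H1 h f z
  refine LinearMap.congr_fun (f := graft.flip (y * z))
    (g := LinearMap.mulRight ℝ z ∘ₗ graft.flip y + LinearMap.mulLeft ℝ y ∘ₗ graft.flip z) ?_ x
  exact linearMap_ext_forest fun h => H2 h y z

theorem graft_graftRoot (x : CK A) (a : A) (y : CK A) :
    graft x (graftRoot a y) = graftRoot a (x * y + graft x y) := by
  have H : ∀ h c : Forest A, graft (ofForest h) (graftRoot a (ofForest c)) =
      graftRoot a (ofForest h * ofForest c + graft (ofForest h) (ofForest c)) := by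
    intro h c
    have := forestGrowth_tree_mul h a c 1
    rw [mul_one, ofForest_one, mul_one, mul_one, forestGrowth_one, mul_zero, add_zero] at this
    rw [graftRoot_ofForest, graft_ofForest, graft_ofForest, this, map_add, ← ofForest_mul,
      graftRoot_ofForest]
  have H1 : ∀ h : Forest A, ∀ y : CK A, graft (ofForest h) (graftRoot a y) =
      graftRoot a (ofForest h * y + graft (ofForest h) y) := by
    intro h y
    refine LinearMap.congr_fun (f := graft (ofForest h) ∘ₗ graftRoot a)
      (g := graftRoot a ∘ₗ (LinearMap.mulLeft ℝ (ofForest h) + graft (ofForest h))) ?_ y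
    exact linearMap_ext_forest (H h)
  refine LinearMap.congr_fun (f := graft.flip (graftRoot a y))
    (g := graftRoot a ∘ₗ (LinearMap.mulRight ℝ y + graft.flip y)) ?_ x
  exact linearMap_ext_forest fun h => H1 h y

/-- The operation `(x₁ ⊗ x₂) · (u ⊗ v) = x₁ u ⊗ graft x₂ v` on `CK A ⊗ CK A`. -/
noncomputable def tensorGraft :
    CK A ⊗[ℝ] CK A →ₗ[ℝ] CK A ⊗[ℝ] CK A →ₗ[ℝ] CK A ⊗[ℝ] CK A :=
  TensorProduct.map₂ (LinearMap.mul ℝ (CK A)) graft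

theorem tensorGraft_tmul (x₁ x₂ u v : CK A) :
    tensorGraft (x₁ ⊗ₜ x₂) (u ⊗ₜ v) = (x₁ * u) ⊗ₜ graft x₂ v := rfl

theorem tensorGraft_mul (s t u : CK A ⊗[ℝ] CK A) :
    tensorGraft s (t * u) = tensorGraft s t * u + t * tensorGraft s u := by
  induction s with
  | zero => simp
  | add x y hx hy => simp only [map_add, LinearMap.add_apply, hx, hy, add_mul, mul_add]; abel
  | tmul x₁ x₂ =>
    induction t with
    | zero => simp
    | add x y hx hy => simp only [map_add, hx, hy, add_mul]; abel
    | tmul t₁ t₂ =>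
      induction u with
      | zero => simp
      | add x y hx hy => simp only [map_add, hx, hy, mul_add]; abel
      | tmul u₁ u₂ =>
        simp only [Algebra.TensorProduct.tmul_mul_tmul, tensorGraft_tmul, graft_mul,
          TensorProduct.tmul_add]
        rw [mul_assoc, mul_left_comm]

theorem map_graft_mul (x : CK A) (t u : CK A ⊗[ℝ] CK A) :
    TensorProduct.map (graft x) LinearMap.id (t * u) =
      TensorProduct.map (graft x) LinearMap.id t * u +
        t * TensorProduct.map (graft x) LinearMap.id u := by
  induction t with
  | zero => simp
  | add x y hx hy => simp only [map_add, hx, hy, add_mul]; abel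
  | tmul t₁ t₂ =>
    induction u with
    | zero => simp
    | add x y hx hy => simp only [map_add, hx, hy, mul_add]; abel
    | tmul u₁ u₂ => simp [graft_mul, TensorProduct.add_tmul]

theorem tensorGraft_map_graftRoot (a : A) (s t : CK A ⊗[ℝ] CK A) :
    tensorGraft s (TensorProduct.map LinearMap.id (graftRoot a) t) =
      TensorProduct.map LinearMap.id (graftRoot a) (s * t + tensorGraft s t) := by
  induction s with
  | zero => simp
  | add x y hx hy => simp only [map_add, LinearMap.add_apply, hx, hy, add_mul]; abel
  | tmul x₁ x₂ =>
    induction t with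
    | zero => simp
    | add x y hx hy => simp only [map_add, hx, hy, mul_add]; abel
    | tmul t₁ t₂ =>
      simp only [TensorProduct.map_tmul, LinearMap.id_apply, tensorGraft_tmul, graft_graftRoot,
        Algebra.TensorProduct.tmul_mul_tmul, map_add, TensorProduct.tmul_add]

theorem tensorGraft_tmul_one (s : CK A ⊗[ℝ] CK A) (y : CK A) : tensorGraft s (y ⊗ₜ 1) = 0 := by
  induction s with
  | zero => simp
  | add x y hx hy => simp only [map_add, LinearMap.add_apply, hx, hy, add_zero]
  | tmul x₁ x₂ => rw [tensorGraft_tmul, graft_one_right, TensorProduct.tmul_zero]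

/-- An admissible cut of a grafting of `x` to a vertex `v` of `h` either leaves `v` in the trunk,
and then it cuts `x` as well, or it prunes `v` together with all of `x`. Both sides are derivations
in `h`, so that it suffices to compare them on trees. -/
theorem coproduct_graft (x : CK A) (h : Forest A) :
    coproduct (graft x (ofForest h)) = tensorGraft (coproduct x) (coproduct (ofForest h)) +
      TensorProduct.map (graft x) LinearMap.id (coproduct (ofForest h)) := by
  refine forest_induction (motive := fun h => coproduct (graft x (ofForest h)) =
    tensorGraft (coproduct x) (coproduct (ofForest h)) +
      TensorProduct.map (graft x) LinearMap.id (coproduct (ofForest h))) ?_ ?_ h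
  · rw [ofForest_one, graft_one_right, map_zero, map_one, Algebra.TensorProduct.one_def,
      tensorGraft_tmul_one, TensorProduct.map_tmul, graft_one_right, TensorProduct.zero_tmul,
      add_zero]
  · intro a c r hc hr
    have htree : coproduct (graft x (graftRoot a (ofForest c))) =
        tensorGraft (coproduct x) (coproduct (graftRoot a (ofForest c))) +
          TensorProduct.map (graft x) LinearMap.id (coproduct (graftRoot a (ofForest c))) := by
      have hcomm : ∀ t : CK A ⊗[ℝ] CK A, TensorProduct.map (graft x) LinearMap.id
          (TensorProduct.map LinearMap.id (graftRoot a) t) =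
          TensorProduct.map LinearMap.id (graftRoot a)
            (TensorProduct.map (graft x) LinearMap.id t) := by
        intro t
        induction t with
        | zero => simp
        | add x y hx hy => simp only [map_add, hx, hy]
        | tmul x y => simp
      simp only [graft_graftRoot, coproduct_graftRoot, map_add, tensorGraft_tmul_one,
        tensorGraft_map_graftRoot, hcomm, TensorProduct.map_tmul, hc, map_mul, LinearMap.id_apply,
        TensorProduct.add_tmul]
      abel
    rw [ofForest_mul, graft_mul, map_add, map_mul, map_mul, hr, map_mul, tensorGraft_mul,
      map_graft_mul, ← graftRoot_ofForest, htree]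
    ring

theorem growth_eq_graft {n : ℕ} (x : CK A) {p : CK A} (hp : p ∈ homogeneous A n) :
    growth x p = (n : ℝ)⁻¹ • graft x p := by
  refine LinearMap.eqOn_span (f := growth x) (g := (n : ℝ)⁻¹ • graft x) ?_ hp
  rintro _ ⟨h, hh, rfl⟩
  rw [LinearMap.smul_apply]
  refine LinearMap.congr_fun (f := growth.flip (ofForest h))
    (g := (n : ℝ)⁻¹ • graft.flip (ofForest h)) ?_ x
  refine linearMap_ext_forest fun g => ?_
  rw [LinearMap.flip_apply, LinearMap.smul_apply, LinearMap.flip_apply, graft_ofForest, growth,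
    extend_ofForest, extend_ofForest, show h.deg = n from hh]

/-- For a homogeneous primitive element `p`, the coproduct of `x ⊤ p` is
`(x ⊤ p) ⊗ 1 + ∑ x₁ ⊗ (x₂ ⊤ p)`; here in terms of convolution products. -/
theorem conv_growth {n : ℕ} {p : CK A} (hp : p ∈ homogeneous A n) (hp' : p ∈ Prim A)
    (φ ψ : CK A →ₗ[ℝ] ℝ) (x : CK A) :
    conv φ ψ (growth x p) = φ (growth x p) * ψ 1 + conv φ (ψ ∘ₗ growth.flip p) x := by
  have h1 : coproduct (graft x p) = tensorGraft (coproduct x) (coproduct p) +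
      TensorProduct.map (graft x) LinearMap.id (coproduct p) := by
    refine LinearMap.congr_fun (f := coproduct.toLinearMap ∘ₗ graft x)
      (g := tensorGraft (coproduct x) ∘ₗ coproduct.toLinearMap +
        TensorProduct.map (graft x) LinearMap.id ∘ₗ coproduct.toLinearMap) ?_ p
    exact linearMap_ext_forest (coproduct_graft x)
  have h2 : coproduct p = p ⊗ₜ[ℝ] 1 + 1 ⊗ₜ[ℝ] p := hp'
  have h3 : coproduct (graft x p) = tensorGraft (coproduct x) (1 ⊗ₜ p) + graft x p ⊗ₜ 1 := by
    rw [h1, h2, map_add, map_add, tensorGraft_tmul_one, TensorProduct.map_tmul,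
      TensorProduct.map_tmul, graft_one_right, TensorProduct.zero_tmul, zero_add, add_zero]
    rfl
  have h4 : ∀ t : CK A ⊗[ℝ] CK A, (n : ℝ)⁻¹ * LinearMap.mul' ℝ ℝ (TensorProduct.map φ ψ
      (tensorGraft t (1 ⊗ₜ p))) =
      LinearMap.mul' ℝ ℝ (TensorProduct.map φ (ψ ∘ₗ growth.flip p) t) := by
    intro t
    induction t with
    | zero => simp
    | add x y hx hy => simp only [map_add, LinearMap.add_apply, mul_add, hx, hy]
    | tmul x y =>
      rw [tensorGraft_tmul, mul_one, TensorProduct.map_tmul, TensorProduct.map_tmul,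
        LinearMap.mul'_apply, LinearMap.mul'_apply, LinearMap.comp_apply, LinearMap.flip_apply,
        growth_eq_graft y hp, map_smul, smul_eq_mul]
      ring
  rw [conv_apply, conv_apply, ← h4, growth_eq_graft x hp, map_smul, map_smul, map_smul, h3,
    map_add, map_add, TensorProduct.map_tmul, LinearMap.mul'_apply, smul_eq_mul, map_smul,
    smul_eq_mul]
  ring

/-! ### Homogeneity of the natural growth -/

theorem ofForest_mem_homogeneous (h : Forest A) : ofForest h ∈ homogeneous A h.deg :=
  Submodule.subset_span ⟨h, rfl, rfl⟩

theorem mul_mem_homogeneous {m n : ℕ} {x y : CK A} (hx : x ∈ homogeneous A m)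
    (hy : y ∈ homogeneous A n) : x * y ∈ homogeneous A (m + n) := by
  have h := Submodule.mul_mem_mul hx hy
  rw [homogeneous, homogeneous, Submodule.span_mul_span] at h
  refine Submodule.span_mono ?_ h
  rintro _ ⟨_, ⟨g, hg, rfl⟩, _, ⟨k, hk, rfl⟩, rfl⟩
  refine ⟨g * k, ?_, ofForest_mul _ _⟩
  change (g * k).deg = m + n
  rw [deg_mul, show g.deg = m from hg, show k.deg = n from hk]

theorem graftRoot_mem_homogeneous (a : A) {n : ℕ} {x : CK A} (hx : x ∈ homogeneous A n) :
    graftRoot a x ∈ homogeneous A (n + 1) := by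
  have h := Submodule.mem_map_of_mem (f := graftRoot a) hx
  rw [homogeneous, Submodule.map_span] at h
  refine Submodule.span_mono ?_ h
  rintro _ ⟨_, ⟨g, hg, rfl⟩, rfl⟩
  refine ⟨Forest.tree a g, ?_, (graftRoot_ofForest a g).symm⟩
  change (Forest.tree a g).deg = n + 1
  rw [deg_tree, show g.deg = n from hg]

theorem forestGrowth_mem_homogeneous (g h : Forest A) :
    forestGrowth g h ∈ homogeneous A (g.deg + h.deg) := by
  refine forest_induction (motive := fun h => forestGrowth g h ∈ homogeneous A (g.deg + h.deg))
    ?_ ?_ h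
  · rw [forestGrowth_one]
    exact Submodule.zero_mem _
  · intro a c r hc hr
    rw [forestGrowth_tree_mul, deg_mul, deg_tree]
    refine Submodule.add_mem _ (Submodule.add_mem _ ?_ ?_) ?_
    · convert mul_mem_homogeneous (ofForest_mem_homogeneous (Forest.tree a (g * c)))
        (ofForest_mem_homogeneous r) using 2
      rw [deg_tree, deg_mul]; omega
    · convert mul_mem_homogeneous (graftRoot_mem_homogeneous a hc)
        (ofForest_mem_homogeneous r) using 2
      omega
    · convert mul_mem_homogeneous (ofForest_mem_homogeneous (Forest.tree a c)) hr using 2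
      rw [deg_tree]; omega

theorem growth_mem_homogeneous {m n : ℕ} {x y : CK A} (hx : x ∈ homogeneous A m)
    (hy : y ∈ homogeneous A n) : growth x y ∈ homogeneous A (m + n) := by
  have h := Submodule.apply_mem_map₂ growth hx hy
  rw [homogeneous, homogeneous, Submodule.map₂_span_span] at h
  refine Submodule.span_le.2 ?_ h
  rintro _ ⟨_, ⟨g, hg, rfl⟩, _, ⟨k, hk, rfl⟩, rfl⟩
  have hg : g.deg = m := hg
  have hk : k.deg = n := hk
  subst hg hk
  change growth (ofForest g) (ofForest k) ∈ homogeneous A _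
  rw [growth, extend_ofForest, extend_ofForest]
  exact Submodule.smul_mem _ _ (forestGrowth_mem_homogeneous g k)

theorem forestGrowth_one_left (h : Forest A) : forestGrowth 1 h = (h.deg : ℝ) • ofForest h := by
  refine forest_induction (motive := fun h => forestGrowth 1 h = (h.deg : ℝ) • ofForest h) ?_ ?_ h
  · simp [forestGrowth_one, deg_one]
  · intro a c r hc hr
    rw [forestGrowth_tree_mul, hc, hr, one_mul, map_smul, graftRoot_ofForest, deg_mul, deg_tree,
      ofForest_mul, smul_mul_assoc, mul_smul_comm]
    push_cast
    module

theorem growth_one_left {n : ℕ} (hn : n ≠ 0) {p : CK A} (hp : p ∈ homogeneous A n) :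
    growth 1 p = p := by
  refine LinearMap.eqOn_span (f := growth 1) (g := LinearMap.id) ?_ hp
  rintro _ ⟨h, hh, rfl⟩
  have hh : h.deg = n := hh
  rw [← ofForest_one, growth, extend_ofForest, extend_ofForest, forestGrowth_one_left, hh,
    smul_smul, inv_mul_cancel₀ (Nat.cast_ne_zero.2 hn), one_smul, LinearMap.id_apply]

theorem coef_eq_zero_of_mem_homogeneous {n : ℕ} {x : CK A} (hx : x ∈ homogeneous A n)
    {h : Forest A} (hh : h.deg ≠ n) : coef h x = 0 := by
  refine LinearMap.eqOn_span (f := coef h) (g := 0) ?_ hx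
  rintro _ ⟨g, hg, rfl⟩
  have hg : g.deg = n := hg
  rw [coef_ofForest_ne, LinearMap.zero_apply]
  rintro rfl
  exact hh hg

/-- The projection of `CK A` onto its component of degree `n`. -/
noncomputable def proj (A : Type*) (n : ℕ) : CK A →ₗ[ℝ] CK A :=
  extend fun h => if h.deg = n then ofForest h else 0

theorem proj_of_mem {n : ℕ} {x : CK A} (hx : x ∈ homogeneous A n) : proj A n x = x := by
  refine LinearMap.eqOn_span (f := proj A n) (g := LinearMap.id) ?_ hx
  rintro _ ⟨g, hg, rfl⟩
  have hg : g.deg = n := hg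
  rw [proj, extend_ofForest, if_pos hg, LinearMap.id_apply]

theorem proj_of_mem_ne {m n : ℕ} (hmn : m ≠ n) {x : CK A} (hx : x ∈ homogeneous A m) :
    proj A n x = 0 := by
  refine LinearMap.eqOn_span (f := proj A n) (g := 0) ?_ hx
  rintro _ ⟨g, hg, rfl⟩
  have hg : g.deg = m := hg
  rw [proj, extend_ofForest, if_neg (hg ▸ hmn), LinearMap.zero_apply]

/-! ### Tensors and functionals -/

/-- The contraction `(id ⊗ ψ) Δ x` of the second leg of the coproduct. -/
noncomputable def contract (ψ : CK A →ₗ[ℝ] ℝ) : CK A →ₗ[ℝ] CK A :=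
  (TensorProduct.rid ℝ (CK A)).toLinearMap ∘ₗ TensorProduct.map LinearMap.id ψ ∘ₗ
    coproduct.toLinearMap

theorem apply_contract (φ ψ : CK A →ₗ[ℝ] ℝ) (x : CK A) : φ (contract ψ x) = conv φ ψ x := by
  rw [conv_apply]
  change φ (TensorProduct.rid ℝ (CK A) (TensorProduct.map LinearMap.id ψ (coproduct x))) = _
  induction coproduct x with
  | zero => simp
  | add x y hx hy => simp only [map_add, hx, hy]
  | tmul x y => simp [mul_comm]

theorem contract_mem {ψ : CK A →ₗ[ℝ] ℝ} (hψ : ψ 1 = 0) (h : Forest A)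
    {W : Submodule ℝ (CK A)} (hW : ∀ g : Forest A, g.deg < h.deg → ofForest g ∈ W) :
    contract ψ (ofForest h) ∈ W := by
  have hle : tensorGrade A h.deg ≤ W.comap ((TensorProduct.rid ℝ (CK A)).toLinearMap ∘ₗ
      TensorProduct.map LinearMap.id ψ) := by
    refine Submodule.span_le.2 ?_
    rintro _ ⟨g, g', hg, rfl⟩
    change (TensorProduct.rid ℝ (CK A)) (TensorProduct.map LinearMap.id ψ
      (ofForest g ⊗ₜ ofForest g')) ∈ W
    rw [TensorProduct.map_tmul, TensorProduct.rid_tmul]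
    rcases Nat.eq_zero_or_pos g'.deg with h0 | h0
    · rw [deg_eq_zero.1 h0, ofForest_one, hψ, zero_smul]
      exact W.zero_mem
    · exact W.smul_mem _ (hW g (by omega))
  exact hle (coproduct_mem_tensorGrade h)

theorem tensor_eq_of_functionals {s t : CK A ⊗[ℝ] CK A}
    (H : ∀ φ ψ : CK A →ₗ[ℝ] ℝ, LinearMap.mul' ℝ ℝ (TensorProduct.map φ ψ s) =
      LinearMap.mul' ℝ ℝ (TensorProduct.map φ ψ t)) : s = t := by
  let e : Module.Basis (Forest A) ℝ (CK A) := ⟨MonoidAlgebra.coeffLinearEquiv ℝ⟩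
  refine (e.tensorProduct e).ext_elem fun ⟨g, g'⟩ => ?_
  have hrepr : ∀ u : CK A ⊗[ℝ] CK A, (e.tensorProduct e).repr u (g, g') =
      LinearMap.mul' ℝ ℝ (TensorProduct.map (e.coord g) (e.coord g') u) := by
    intro u
    induction u with
    | zero => simp
    | add x y hx hy => simp only [map_add, Finsupp.add_apply, hx, hy]
    | tmul x y => simp [Module.Basis.tensorProduct_repr_tmul_apply, mul_comm]
  rw [hrepr, hrepr, H]

theorem mem_prim_of_conv {x : CK A}
    (H : ∀ φ ψ : CK A →ₗ[ℝ] ℝ, conv φ ψ x = φ x * ψ 1 + φ 1 * ψ x) : x ∈ Prim A := by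
  refine tensor_eq_of_functionals fun φ ψ => ?_
  have := H φ ψ
  rw [conv_apply] at this
  simpa using this

/-- If a functional `J` vanishes on the nonempty forests with fewer vertices than `h`, then only the
trivial cuts of `h` contribute to `φ ⋆ J`. -/
theorem conv_of_vanish {J : CK A →ₗ[ℝ] ℝ} {h : Forest A} (hh : 0 < h.deg)
    (hJ : ∀ g : Forest A, 0 < g.deg → g.deg < h.deg → J (ofForest g) = 0) (φ : CK A →ₗ[ℝ] ℝ) :
    conv φ J (ofForest h) = φ (ofForest h) * J 1 + φ 1 * J (ofForest h) := by
  have h1 : h ≠ 1 := fun h1 => by rw [h1, deg_one] at hh; exact lt_irrefl _ hh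
  have hJ0 : (J - J 1 • coef (1 : Forest A)) (ofForest h) = J (ofForest h) := by
    simp [coef_ofForest_ne h1]
  have key : conv φ (J - J 1 • coef 1) (ofForest h) =
      conv (φ 1 • coef 1) (J - J 1 • coef 1) (ofForest h) := by
    refine conv_congr h fun g g' hg => ?_
    rcases Nat.eq_zero_or_pos g'.deg with h0 | h0
    · rw [deg_eq_zero.1 h0, ofForest_one]
      simp [coef_one_one]
    · rcases Nat.eq_zero_or_pos g.deg with h2 | h2
      · rw [deg_eq_zero.1 h2, ofForest_one]
        simp [coef_one_one]
      · have h3 : g' ≠ 1 := fun h1 => by rw [h1, deg_one] at h0; exact lt_irrefl _ h0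
        simp [hJ g' h0 (by omega), coef_ofForest_ne h3]
  rw [conv_sub_right, conv_smul_right, conv_coef_one, conv_smul_left, coef_one_conv] at key
  simp only [LinearMap.sub_apply, LinearMap.smul_apply, smul_eq_mul, coef_ofForest_ne h1] at key
  linarith

/-! ### The basis of iterated natural growths -/

namespace PrimBasis

variable {ι : Type*} (P : PrimBasis A ι)

theorem elt_mem_prim (i : ι) : P.elt i ∈ Prim A := (P.basis i).2

theorem elt_mem_homogeneous (i : ι) : P.elt i ∈ homogeneous A (P.deg i) := P.mem_homogeneous i

theorem word_nil : P.word [] = 1 := rfl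

theorem growth_one_elt (i : ι) : growth 1 (P.elt i) = P.elt i :=
  growth_one_left (P.deg_pos i).ne' (P.elt_mem_homogeneous i)

theorem word_append_singleton (w : List ι) (i : ι) :
    P.word (w ++ [i]) = growth (P.word w) (P.elt i) := by
  cases w with
  | nil => rw [word_nil, growth_one_elt]; rfl
  | cons j w => simp [word, iterGrowth, List.foldl_append]

theorem wordDeg_nil : P.wordDeg [] = 0 := rfl

theorem wordDeg_singleton (i : ι) : P.wordDeg [i] = P.deg i := by simp [wordDeg]

theorem wordDeg_append_singleton (w : List ι) (i : ι) :
    P.wordDeg (w ++ [i]) = P.wordDeg w + P.deg i := by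
  simp [wordDeg]

theorem word_mem_homogeneous (w : List ι) : P.word w ∈ homogeneous A (P.wordDeg w) := by
  induction w using List.reverseRecOn with
  | nil => exact ofForest_mem_homogeneous (1 : Forest A)
  | append_singleton w i ih =>
    rw [word_append_singleton, wordDeg_append_singleton]
    exact growth_mem_homogeneous ih (P.elt_mem_homogeneous i)

theorem conv_word_append_singleton (φ ψ : CK A →ₗ[ℝ] ℝ) (w : List ι) (i : ι) :
    conv φ ψ (P.word (w ++ [i])) =
      φ (P.word (w ++ [i])) * ψ 1 + conv φ (ψ ∘ₗ growth.flip (P.elt i)) (P.word w) := by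
  rw [word_append_singleton, conv_growth (P.elt_mem_homogeneous i) (P.elt_mem_prim i)]

theorem coef_one_elt (i : ι) : coef (1 : Forest A) (P.elt i) = 0 := by
  refine coef_eq_zero_of_mem_homogeneous (P.elt_mem_homogeneous i) ?_
  rw [deg_one]
  exact (P.deg_pos i).ne

open Classical in
theorem exists_primDual (i : ι) : ∃ ψ : CK A →ₗ[ℝ] ℝ, ψ 1 = 0 ∧
    ∀ j, ψ (P.elt j) = if j = i then 1 else 0 := by
  obtain ⟨g, hg⟩ := LinearMap.exists_extend (p := Prim A) (P.basis.coord i)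
  have hgj : ∀ j, g (P.elt j) = if j = i then 1 else 0 := by
    intro j
    have : g (P.elt j) = P.basis.coord i (P.basis j) := by rw [← hg]; rfl
    rw [this, P.basis.coord_apply, P.basis.repr_self, Finsupp.single_apply]
  refine ⟨g - g 1 • coef 1, ?_, fun j => ?_⟩
  · simp [coef_one_one]
  · simp [coef_one_elt, hgj]

/-- A functional that vanishes on `1` and takes the value `1` on `p_i` and `0` on the other basis
elements of the space of primitive elements. -/
noncomputable def primDual (i : ι) : CK A →ₗ[ℝ] ℝ := (P.exists_primDual i).choose

theorem primDual_one (i : ι) : P.primDual i 1 = 0 := (P.exists_primDual i).choose_spec.1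

open Classical in
theorem primDual_elt (i j : ι) : P.primDual i (P.elt j) = if j = i then 1 else 0 :=
  (P.exists_primDual i).choose_spec.2 j

/-- The convolution product of the functionals `primDual` of the letters of a word. It is a
triangular approximation of the dual functional of the *reversed* list: the head of the list is the
last letter of the word. -/
noncomputable def triDual : List ι → CK A →ₗ[ℝ] ℝ
  | [] => coef 1
  | i :: w => conv (triDual w) (P.primDual i)

theorem coef_one_word {w : List ι} (hw : w ≠ []) : coef (1 : Forest A) (P.word w) = 0 := by
  refine coef_eq_zero_of_mem_homogeneous (P.word_mem_homogeneous w) ?_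
  rw [deg_one]
  rcases w.eq_nil_or_concat with h | ⟨v, i, rfl⟩
  · exact absurd h hw
  · rw [List.concat_eq_append, wordDeg_append_singleton]
    have := P.deg_pos i
    omega

open Classical in
/-- The functionals `triDual` are triangular with respect to the length of words. -/
theorem triDual_word (w : List ι) : ∀ v : List ι, v.length ≤ w.length →
    P.triDual w (P.word v) = if v = w.reverse then 1 else 0 := by
  induction w with
  | nil =>
    intro v hv
    have : v = [] := by simpa using hv
    subst this
    simp [triDual, word_nil, coef_one_one]
  | cons i w ih =>
    -- `triDual w` vanishes on words shorter than `w`, so a word of at most this length cannot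
    -- leave a letter to the second factor
    have hG : ∀ (χ : CK A →ₗ[ℝ] ℝ) (v : List ι), v.length ≤ w.length →
        conv (P.triDual w) χ (P.word v) = P.triDual w (P.word v) * χ 1 := by
      intro χ v
      induction v using List.reverseRecOn generalizing χ with
      | nil => intro _; rw [word_nil, conv_one]
      | append_singleton v j ihv =>
        intro hv
        rw [List.length_append, List.length_singleton] at hv
        rw [conv_word_append_singleton, ihv _ (by omega), ih v (by omega), if_neg, zero_mul,
          add_zero]
        rintro rfl
        rw [List.length_reverse] at hv
        omega
    intro v hv
    rcases v.eq_nil_or_concat with rfl | ⟨v, j, rfl⟩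
    · rw [word_nil, triDual, conv_one, primDual_one, mul_zero, if_neg]
      simp
    · rw [List.concat_eq_append] at hv ⊢
      rw [List.length_append, List.length_singleton, List.length_cons] at hv
      rw [triDual, conv_word_append_singleton, primDual_one, mul_zero, zero_add,
        hG _ v (by omega), ih v (by omega), LinearMap.comp_apply, LinearMap.flip_apply,
        growth_one_elt, primDual_elt, List.reverse_cons]
      have hiff : v ++ [j] = w.reverse ++ [i] ↔ v = w.reverse ∧ j = i :=
        ⟨fun h => by simpa using List.append_inj' h rfl, fun h => by rw [h.1, h.2]⟩
      by_cases h1 : v = w.reverse <;> by_cases h2 : j = i <;> simp [h1, h2, hiff]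

theorem linearIndependent_word : LinearIndependent ℝ P.word := by
  classical
  rw [linearIndependent_iff']
  intro S c hS
  by_contra! hc
  obtain ⟨w₀, hw₀, hcw₀⟩ := hc
  -- a longest word in the relation is detected by its triangular functional
  obtain ⟨w, hw, hmax⟩ := (S.filter fun w => c w ≠ 0).exists_max_image List.length
    ⟨w₀, Finset.mem_filter.2 ⟨hw₀, hcw₀⟩⟩
  obtain ⟨hwS, hcw⟩ := Finset.mem_filter.1 hw
  have h := congrArg (P.triDual w.reverse) hS
  rw [map_sum, map_zero, Finset.sum_eq_single w] at h
  · rw [map_smul, triDual_word _ _ _ (by simp)] at h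
    simp [hcw] at h
  · intro v hv hvw
    by_cases hcv : c v = 0
    · rw [hcv, zero_smul, map_zero]
    · rw [map_smul, triDual_word _ _ _ (by
        rw [List.length_reverse]; exact hmax v (Finset.mem_filter.2 ⟨hv, hcv⟩)),
        List.reverse_reverse, if_neg hvw, smul_zero]
  · exact fun hn => absurd hwS hn

open Classical in
theorem dual_word (w v : List ι) : P.dual w (P.word v) = if v = w then 1 else 0 := by
  have hex : ∃ φ : CK A →ₗ[ℝ] ℝ, ∀ v : List ι, φ (P.word v) = if v = w then 1 else 0 := by
    let b := Module.Basis.span P.linearIndependent_word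
    obtain ⟨g, hg⟩ := LinearMap.exists_extend (b.coord w)
    refine ⟨g, fun v => ?_⟩
    have h1 : g (P.word v) = b.coord w (b v) := by
      rw [← hg, LinearMap.comp_apply, Submodule.subtype_apply, Module.Basis.span_apply]
    rw [h1, b.coord_apply, b.repr_self, Finsupp.single_apply]
  exact Classical.epsilon_spec hex v

theorem dual_singleton_one (i : ι) : P.dual [i] 1 = 0 := by
  rw [← P.word_nil, dual_word, if_neg (by simp)]

/-- The words span a subcoalgebra: a convolution product on words is determined by the values of
its right factor on words. -/
theorem conv_word_congr (χ : CK A →ₗ[ℝ] ℝ) {ψ ψ' : CK A →ₗ[ℝ] ℝ}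
    (H : ∀ v, ψ (P.word v) = ψ' (P.word v)) (w : List ι) :
    conv χ ψ (P.word w) = conv χ ψ' (P.word w) := by
  induction w using List.reverseRecOn generalizing ψ ψ' with
  | nil => rw [word_nil, conv_one, conv_one, ← P.word_nil, H]
  | append_singleton w i ih =>
    rw [conv_word_append_singleton, conv_word_append_singleton, ← P.word_nil, H]
    congr 1
    refine ih fun v => ?_
    rw [LinearMap.comp_apply, LinearMap.comp_apply, LinearMap.flip_apply,
      ← word_append_singleton, H]

open Classical in
/-- The dual functional of a single letter splits off the last letter of a word. -/
theorem conv_dual_singleton_word (χ : CK A →ₗ[ℝ] ℝ) (i j : ι) (w : List ι) :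
    conv χ (P.dual [i]) (P.word (w ++ [j])) = if j = i then χ (P.word w) else 0 := by
  have hflip : ∀ v : List ι, (P.dual [i] ∘ₗ growth.flip (P.elt j)) (P.word v) =
      ((if j = i then (1 : ℝ) else 0) • coef (1 : Forest A)) (P.word v) := by
    intro v
    rw [LinearMap.comp_apply, LinearMap.flip_apply, ← word_append_singleton, dual_word,
      LinearMap.smul_apply]
    by_cases hv : v = []
    · subst hv
      rw [word_nil, coef_one_one]
      by_cases h : j = i <;> simp [h]
    · rw [coef_one_word P hv, smul_zero, if_neg]
      intro h
      have := congrArg List.length h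
      simp [hv] at this
  rw [conv_word_append_singleton, dual_singleton_one, mul_zero, zero_add,
    conv_word_congr P χ hflip, conv_smul_right, conv_coef_one, LinearMap.smul_apply, smul_eq_mul,
    ite_mul, one_mul, zero_mul]

theorem conv_dual_singleton_one (χ : CK A →ₗ[ℝ] ℝ) (i : ι) : conv χ (P.dual [i]) 1 = 0 := by
  rw [conv_one, dual_singleton_one, mul_zero]

theorem linearMap_ext_word_of_mem {V : Type*} [AddCommGroup V] [Module ℝ V] {F G : CK A →ₗ[ℝ] V}
    {x : CK A} (hx : x ∈ Submodule.span ℝ (range P.word))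
    (H : ∀ w, F (P.word w) = G (P.word w)) : F x = G x := by
  refine LinearMap.eqOn_span (f := F) (g := G) ?_ hx
  rintro _ ⟨w, rfl⟩
  exact H w

/-- A functional vanishing on the words of degree `n` vanishes on the forests with `n` vertices
that are combinations of words. -/
theorem apply_eq_zero_of_word {F : CK A →ₗ[ℝ] ℝ} {h : Forest A}
    (hx : ofForest h ∈ Submodule.span ℝ (range P.word))
    (H : ∀ w, P.wordDeg w = h.deg → F (P.word w) = 0) : F (ofForest h) = 0 := by
  have h1 : (F ∘ₗ proj A h.deg) (ofForest h) = (0 : CK A →ₗ[ℝ] ℝ) (ofForest h) := by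
    refine P.linearMap_ext_word_of_mem hx fun w => ?_
    rw [LinearMap.comp_apply, LinearMap.zero_apply]
    by_cases hw : P.wordDeg w = h.deg
    · rw [← hw, proj_of_mem (P.word_mem_homogeneous w), H w hw]
    · rw [proj_of_mem_ne hw (P.word_mem_homogeneous w), map_zero]
  rwa [LinearMap.comp_apply, proj_of_mem (ofForest_mem_homogeneous h)] at h1

theorem prim_le_span_word : Prim A ≤ Submodule.span ℝ (range P.word) := by
  intro x hx
  have h := Submodule.mem_map_of_mem (f := (Prim A).subtype) (P.basis.mem_span ⟨x, hx⟩)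
  rw [Submodule.map_span] at h
  refine Submodule.span_mono ?_ h
  rintro _ ⟨_, ⟨i, rfl⟩, rfl⟩
  exact ⟨[i], rfl⟩

theorem growth_elt_mem_span_word {x : CK A} (hx : x ∈ Submodule.span ℝ (range P.word)) (i : ι) :
    growth x (P.elt i) ∈ Submodule.span ℝ (range P.word) := by
  have h := Submodule.mem_map_of_mem (f := growth.flip (P.elt i)) hx
  rw [Submodule.map_span] at h
  refine Submodule.span_mono ?_ h
  rintro _ ⟨_, ⟨w, rfl⟩, rfl⟩
  exact ⟨w ++ [i], P.word_append_singleton w i⟩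

/-- Every forest is a combination of words. With `K h = ∑ i, (id ⊗ dual [i]) (Δ h) ⊤ p_i`, which is
a combination of words by induction on the number of vertices, the difference `h - K h` is
primitive, since `K` fixes the nonempty words. -/
theorem ofForest_mem_span_word [Finite A] (h : Forest A) :
    ofForest h ∈ Submodule.span ℝ (range P.word) := by
  classical
  induction hn : h.deg using Nat.strong_induction_on generalizing h with
  | _ n ih =>
  have ih : ∀ g : Forest A, g.deg < h.deg → ofForest g ∈ Submodule.span ℝ (range P.word) :=
    fun g hg => ih g.deg (hn ▸ hg) g rfl
  rcases Nat.eq_zero_or_pos h.deg with h0 | h0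
  · rw [deg_eq_zero.1 h0]
    exact Submodule.subset_span ⟨[], rfl⟩
  let S : Finset ι := (P.finite_deg_le h.deg).toFinset
  have hS : ∀ i, i ∈ S ↔ P.deg i ≤ h.deg := fun i => by simp [S]
  let K : CK A →ₗ[ℝ] CK A := ∑ i ∈ S, growth.flip (P.elt i) ∘ₗ contract (P.dual [i])
  have hK : ∀ ψ : CK A →ₗ[ℝ] ℝ,
      ψ ∘ₗ K = ∑ i ∈ S, conv (ψ ∘ₗ growth.flip (P.elt i)) (P.dual [i]) := by
    intro ψ
    refine LinearMap.ext fun x => ?_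
    simp only [K, LinearMap.comp_apply, LinearMap.sum_apply, map_sum, ← apply_contract]
  have hKmem : K (ofForest h) ∈ Submodule.span ℝ (range P.word) := by
    simp only [K, LinearMap.sum_apply, LinearMap.comp_apply, LinearMap.flip_apply]
    exact Submodule.sum_mem _ fun i _ =>
      P.growth_elt_mem_span_word (contract_mem (P.dual_singleton_one i) h ih) i
  suffices hprim : ofForest h - K (ofForest h) ∈ Prim A by
    simpa using Submodule.add_mem _ (P.prim_le_span_word hprim) hKmem
  refine mem_prim_of_conv fun φ ψ => ?_
  have hone : ∀ ψ : CK A →ₗ[ℝ] ℝ, (ψ ∘ₗ K) 1 = 0 := by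
    intro ψ
    rw [hK, LinearMap.sum_apply]
    exact Finset.sum_eq_zero fun i _ => P.conv_dual_singleton_one _ i
  -- the coproduct of `K h` is `K h ⊗ 1 + (id ⊗ K) Δ h`
  have hconvK : conv φ ψ (K (ofForest h)) =
      φ (K (ofForest h)) * ψ 1 + conv φ (ψ ∘ₗ K) (ofForest h) := by
    rw [hK, conv_sum_right]
    simp only [K, LinearMap.sum_apply, LinearMap.comp_apply, LinearMap.flip_apply, map_sum,
      Finset.sum_mul]
    rw [← Finset.sum_add_distrib]
    refine Finset.sum_congr rfl fun i _ => ?_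
    rw [conv_growth (P.elt_mem_homogeneous i) (P.elt_mem_prim i), apply_contract, conv_assoc]
  have hJ : ∀ g : Forest A, 0 < g.deg → g.deg < h.deg → (ψ - ψ ∘ₗ K) (ofForest g) = 0 := by
    intro g hg hgh
    refine P.apply_eq_zero_of_word (ih g hgh) fun w hw => ?_
    rcases w.eq_nil_or_concat with rfl | ⟨v, j, rfl⟩
    · rw [wordDeg_nil] at hw
      omega
    · rw [List.concat_eq_append] at hw ⊢
      rw [LinearMap.sub_apply, hK, LinearMap.sum_apply, Finset.sum_eq_single j]
      · rw [conv_dual_singleton_word, if_pos rfl, LinearMap.comp_apply, LinearMap.flip_apply,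
          ← word_append_singleton, sub_self]
      · intro i _ hij
        rw [conv_dual_singleton_word, if_neg hij.symm]
      · intro hj
        refine absurd ((hS j).2 ?_) hj
        rw [wordDeg_append_singleton] at hw
        omega
  have key := conv_of_vanish h0 hJ φ
  rw [conv_sub_right, LinearMap.sub_apply, LinearMap.sub_apply, LinearMap.sub_apply, hone] at key
  rw [map_sub, map_sub, map_sub, hconvK]
  rw [LinearMap.comp_apply] at key
  linarith

/-- Foissy's theorem: the iterated natural growths of primitive elements span the Hopf algebra. -/
theorem span_word [Finite A] : Submodule.span ℝ (range P.word) = ⊤ := by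
  refine eq_top_iff.2 fun x _ => ?_
  induction x using MonoidAlgebra.induction_linear with
  | zero => exact Submodule.zero_mem _
  | add x y hx hy => exact Submodule.add_mem _ (hx trivial) (hy trivial)
  | single h r =>
    have : (MonoidAlgebra.single h r : CK A) = r • ofForest h := by simp [ofForest]
    rw [this]
    exact Submodule.smul_mem _ _ (P.ofForest_mem_span_word h)

theorem dual_ofForest_eq_zero [Finite A] {w : List ι} {h : Forest A} (hw : h.deg ≠ P.wordDeg w) :
    P.dual w (ofForest h) = 0 := by
  refine P.apply_eq_zero_of_word (P.ofForest_mem_span_word h) fun v hv => ?_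
  rw [dual_word, if_neg]
  rintro rfl
  exact hw hv.symm

end PrimBasis

/-! ### Expansions in the dual basis -/

section Finite

variable [Finite A]

/-- The finite set of forests `h` with `m ≤ |h| < n`. -/
noncomputable def degIco (A : Type*) [Finite A] (m n : ℕ) : Finset (Forest A) :=
  (Forest.upTo A n).filter fun h => m ≤ h.deg ∧ h.deg < n

theorem mem_degIco {m n : ℕ} {h : Forest A} : h ∈ degIco A m n ↔ m ≤ h.deg ∧ h.deg < n := by
  simp only [degIco, Forest.upTo, Finset.mem_filter, Set.Finite.mem_toFinset, Set.mem_ofPred_eq]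
  omega

theorem apply_eq_of_forall_deg_lt {N : ℕ} {y : CK A} (hy : ∀ h : Forest A, N ≤ h.deg → coef h y = 0)
    {F G : CK A →ₗ[ℝ] ℝ} (H : ∀ g : Forest A, g.deg < N → F (ofForest g) = G (ofForest g)) :
    F y = G y := by
  rw [eq_sum_coef (degIco A 0 N) (x := y) fun h hh => hy h (by simpa [mem_degIco] using hh),
    map_sum, map_sum]
  refine Finset.sum_congr rfl fun g hg => ?_
  rw [map_smul, map_smul, H g (mem_degIco.1 hg).2]

theorem sum_coef_apply {m n : ℕ} (θ : CK A →ₗ[ℝ] ℝ) {g : Forest A} (hm : m ≤ g.deg)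
    (hn : g.deg < n) : (∑ k ∈ degIco A m n, θ (ofForest k) • coef k) (ofForest g) =
      θ (ofForest g) := by
  rw [LinearMap.sum_apply, Finset.sum_eq_single g]
  · rw [LinearMap.smul_apply, coef_ofForest_self, smul_eq_mul, mul_one]
  · intro k _ hk
    rw [LinearMap.smul_apply, coef_ofForest_ne hk.symm, smul_zero]
  · intro hg
    exact absurd (mem_degIco.2 ⟨hm, hn⟩) hg

end Finite

theorem conv_homogeneous {φ ψ : CK A →ₗ[ℝ] ℝ} {m n : ℕ}
    (hφ : ∀ g : Forest A, g.deg ≠ m → φ (ofForest g) = 0)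
    (hψ : ∀ g : Forest A, g.deg ≠ n → ψ (ofForest g) = 0) {g : Forest A} (hg : g.deg ≠ m + n) :
    conv φ ψ (ofForest g) = 0 := by
  refine conv_eq_zero g fun g₁ g₂ h => ?_
  by_cases h1 : g₁.deg = m
  · rw [hψ g₂ (by omega), mul_zero]
  · rw [hφ g₁ h1, zero_mul]

namespace PrimBasis

variable [Finite A] {ι : Type*} (P : PrimBasis A ι)

/-- Expansion of the left factor of a convolution product in the dual basis. On vectors supported on
forests with less than `N` vertices only the words of degree less than `N - d` contribute. -/
theorem conv_eq_sum_dual {N d : ℕ} {ψ : CK A →ₗ[ℝ] ℝ}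
    (hψ : ∀ g : Forest A, g.deg ≠ d → ψ (ofForest g) = 0) {y : CK A}
    (hy : ∀ h : Forest A, N ≤ h.deg → coef h y = 0) (φ : CK A →ₗ[ℝ] ℝ) :
    conv φ ψ y = ∑ w ∈ (P.finite_wordDeg_lt (N - d)).toFinset,
      conv (P.dual w) ψ y * φ (P.word w) := by
  classical
  have h1 : conv φ ψ y = conv (∑ w ∈ (P.finite_wordDeg_lt (N - d)).toFinset,
      φ (P.word w) • P.dual w) ψ y := by
    refine apply_eq_of_forall_deg_lt hy fun g hg => conv_congr g fun g₁ g₂ h => ?_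
    by_cases h2 : g₂.deg = d
    · congr 1
      rw [← sub_eq_zero, ← LinearMap.sub_apply]
      refine P.apply_eq_zero_of_word (P.ofForest_mem_span_word g₁) fun w hw => ?_
      rw [LinearMap.sub_apply, LinearMap.sum_apply, Finset.sum_eq_single w]
      · rw [LinearMap.smul_apply, dual_word, if_pos rfl, smul_eq_mul, mul_one, sub_self]
      · intro v _ hv
        rw [LinearMap.smul_apply, dual_word, if_neg hv.symm, smul_zero]
      · intro hn
        refine absurd ?_ hn
        rw [Set.Finite.mem_toFinset]
        change P.wordDeg w < N - d
        omega
    · rw [hψ g₂ h2, mul_zero, mul_zero]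
  rw [h1, conv_sum_left, LinearMap.sum_apply]
  refine Finset.sum_congr rfl fun w _ => ?_
  rw [conv_smul_left, LinearMap.smul_apply, smul_eq_mul, mul_comm]

theorem conv_dual_coef_homogeneous (i : ι) (h : Forest A) {g : Forest A}
    (hg : g.deg ≠ P.deg i + h.deg) : conv (P.dual [i]) (coef h) (ofForest g) = 0 := by
  refine conv_homogeneous (fun k hk => P.dual_ofForest_eq_zero (by rwa [wordDeg_singleton])) ?_ hg
  intro k hk
  refine coef_ofForest_ne ?_
  rintro rfl
  exact hk rfl

end PrimBasis

/-! ### The germ of the rough integral and the remainders -/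

section Germ

variable [Finite A] {ι : Type*} (P : PrimBasis A ι) {α T : ℝ} (X : RoughPath A α T)

theorem germ_eq_conv {Z : ℝ → CK A} {s : ℝ}
    (hZ : ∀ h : Forest A, ⌊α⁻¹⌋₊ ≤ h.deg → coef h (Z s) = 0) (h : Forest A) (i : ι) (t : ℝ) :
    germ P X Z h i s t = conv ((X.char s t).toLinearMap ∘ₗ growth.flip (P.elt i))
      (conv (P.dual [i]) (coef h)) (Z s) := by
  rw [P.conv_eq_sum_dual (fun g hg => P.conv_dual_coef_homogeneous i h hg) hZ, germ]
  refine Finset.sum_congr ?_ fun _ _ => rfl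
  ext w
  rw [Set.Finite.mem_toFinset, Set.Finite.mem_toFinset]
  change P.wordDeg w < _ ↔ P.wordDeg w < _
  omega

/-- The germ depends only on the components of the integrand with more than `|h|` vertices. -/
theorem germ_congr {Z Z' : ℝ → CK A} {h : Forest A} {s : ℝ}
    (hZ : ∀ g : Forest A, h.deg < g.deg → coef g (Z s) = coef g (Z' s)) (i : ι) (t : ℝ) :
    germ P X Z h i s t = germ P X Z' h i s t := by
  refine Finset.sum_congr rfl fun w _ => ?_
  congr 1
  rw [← sub_eq_zero, ← map_sub]
  have hfin : ∃ n : ℕ, ∀ g : Forest A, n ≤ g.deg → coef g (Z s - Z' s) = 0 := by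
    let S := ((MonoidAlgebra.coeffLinearEquiv ℝ) (Z s - Z' s)).support
    refine ⟨S.sup Forest.deg + 1, fun g hg => ?_⟩
    by_contra hne
    have : g ∈ S := Finsupp.mem_support_iff.2 hne
    have := Finset.le_sup (f := Forest.deg) this
    omega
  obtain ⟨n, hn⟩ := hfin
  rw [eq_sum_coef (degIco A 0 n) (x := Z s - Z' s) fun g hg => hn g (by
    simpa [mem_degIco] using hg), map_sum]
  refine Finset.sum_eq_zero fun g _ => ?_
  rw [map_smul]
  by_cases hg : h.deg < g.deg
  · rw [map_sub, hZ g hg, sub_self, zero_smul]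
  · rw [conv_homogeneous (m := P.wordDeg w) (n := P.deg i + h.deg)
      (fun k hk => P.dual_ofForest_eq_zero hk)
      (fun k hk => P.conv_dual_coef_homogeneous i h hk), smul_zero]
    have := P.deg_pos i
    omega

/-- The remainder of `Z` is the increment of `Z` minus the germs of the rough integrals. -/
theorem remainder_eq {Z : ℝ → CK A} {s : ℝ}
    (hZ : ∀ h : Forest A, ⌊α⁻¹⌋₊ ≤ h.deg → coef h (Z s) = 0) (h : Forest A) (t : ℝ) :
    X.remainder Z h s t = coef h (Z t) - coef h (Z s) -
      ∑ i ∈ (P.finite_deg_lt (⌊α⁻¹⌋₊ - h.deg)).toFinset, germ P X Z h i s t := by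
  classical
  let χ : ι → CK A →ₗ[ℝ] ℝ := fun i => (X.char s t).toLinearMap ∘ₗ growth.flip (P.elt i)
  have hcoef : ∀ g : Forest A, g.deg ≠ h.deg → coef h (ofForest g) = 0 := by
    intro g hg
    refine coef_ofForest_ne ?_
    rintro rfl
    exact hg rfl
  -- `X_{s,t} = 1* + ∑ i, X_{s,t}(· ⊤ p_i) ⋆ p_i*`, because both sides agree on words
  have key : conv (X.char s t).toLinearMap (coef h) (Z s) =
      conv (coef 1 + ∑ i ∈ (P.finite_deg_lt (⌊α⁻¹⌋₊ - h.deg)).toFinset,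
        conv (χ i) (P.dual [i])) (coef h) (Z s) := by
    refine apply_eq_of_forall_deg_lt hZ fun g hg => conv_congr g fun g₁ g₂ hg₁₂ => ?_
    by_cases h2 : g₂.deg = h.deg
    · congr 1
      rw [← sub_eq_zero, ← LinearMap.sub_apply]
      refine P.apply_eq_zero_of_word (P.ofForest_mem_span_word g₁) fun w hw => ?_
      rw [LinearMap.sub_apply, LinearMap.add_apply, LinearMap.sum_apply]
      rcases w.eq_nil_or_concat with rfl | ⟨v, j, rfl⟩
      · rw [P.word_nil, coef_one_one, Finset.sum_eq_zero fun i _ => P.conv_dual_singleton_one _ i]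
        simp
      · rw [List.concat_eq_append] at hw ⊢
        rw [P.coef_one_word (by simp), Finset.sum_eq_single j]
        · rw [P.conv_dual_singleton_word, if_pos rfl, P.word_append_singleton]
          simp [χ]
        · intro i _ hij
          rw [P.conv_dual_singleton_word, if_neg hij.symm]
        · intro hn
          refine absurd ?_ hn
          rw [Set.Finite.mem_toFinset]
          change P.deg j < ⌊α⁻¹⌋₊ - h.deg
          rw [P.wordDeg_append_singleton] at hw
          omega
    · rw [hcoef g₂ h2, mul_zero, mul_zero]
  rw [RoughPath.remainder, key, conv_add_left, coef_one_conv, conv_sum_left, LinearMap.add_apply,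
    LinearMap.sum_apply, sub_add_eq_sub_sub]
  congr 1
  refine Finset.sum_congr rfl fun i _ => ?_
  rw [germ_eq_conv P X hZ, conv_assoc]

/-- The coefficients in the expansion of the defect of additivity of the germ. -/
noncomputable def germCoef (h : Forest A) (i : ι) (g' g : Forest A) : ℝ :=
  conv (coef g' ∘ₗ growth.flip (P.elt i)) (conv (P.dual [i]) (coef h)) (ofForest g)

/-- Chen's relation expresses the defect of additivity of the germ by the remainders of components
with more vertices. -/
theorem germ_delta {Z : ℝ → CK A} {s u t : ℝ} (hs : s ∈ Icc 0 T) (hu : u ∈ Icc 0 T)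
    (ht : t ∈ Icc 0 T)
    (hZ : ∀ r, ∀ h : Forest A, ⌊α⁻¹⌋₊ ≤ h.deg → coef h (Z r) = 0) (h : Forest A) (i : ι) :
    germ P X Z h i s t - germ P X Z h i s u - germ P X Z h i u t =
      -∑ g ∈ degIco A (h.deg + 1) ⌊α⁻¹⌋₊, ∑ g' ∈ degIco A 1 (⌊α⁻¹⌋₊ + 1),
        germCoef P h i g' g * (X.comp g' u t * X.remainder Z g s u) := by
  classical
  set N := ⌊α⁻¹⌋₊
  let χ : ℝ → ℝ → CK A →ₗ[ℝ] ℝ := fun s t => (X.char s t).toLinearMap ∘ₗ growth.flip (P.elt i)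
  let ψ : CK A →ₗ[ℝ] ℝ := conv (P.dual [i]) (coef h)
  have hψ : ∀ g : Forest A, g.deg ≠ P.deg i + h.deg → ψ (ofForest g) = 0 :=
    fun g hg => P.conv_dual_coef_homogeneous i h hg
  have hi := P.deg_pos i
  let θ : CK A →ₗ[ℝ] ℝ := conv (χ u t) ψ
  -- Chen's relation and the coproduct of `x ⊤ p`
  have hχ : χ s t = χ s u + conv (X.char s u).toLinearMap (χ u t) := by
    refine LinearMap.ext fun x => ?_
    change X.char s t (growth x (P.elt i)) = X.char s u (growth x (P.elt i)) + _
    have h1 := LinearMap.congr_fun (X.chen s hs u hu t ht) (growth x (P.elt i))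
    rw [conv_growth (P.elt_mem_homogeneous i) (P.elt_mem_prim i)] at h1
    simp only [AlgHom.toLinearMap_apply, map_one, mul_one] at h1
    exact h1.symm
  have h1 : germ P X Z h i s t - germ P X Z h i s u - germ P X Z h i u t =
      conv (X.char s u).toLinearMap θ (Z s) - θ (Z u) := by
    rw [germ_eq_conv P X (hZ s), germ_eq_conv P X (hZ s), germ_eq_conv P X (hZ u)]
    change conv (χ s t) ψ (Z s) - conv (χ s u) ψ (Z s) - θ (Z u) = _
    rw [hχ, conv_add_left, LinearMap.add_apply, conv_assoc]
    ring
  -- `θ` is supported on forests with more than `|h|` vertices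
  have hθ : ∀ g : Forest A, g.deg < N → θ (ofForest g) =
      (∑ k ∈ degIco A (h.deg + 1) N, θ (ofForest k) • coef k) (ofForest g) := by
    intro g hg
    by_cases hgh : h.deg + 1 ≤ g.deg
    · rw [sum_coef_apply θ hgh hg]
    · have h2 : θ (ofForest g) = 0 := by
        refine conv_eq_zero g fun g₁ g₂ h12 => ?_
        rw [hψ g₂ (by omega), mul_zero]
      rw [h2, LinearMap.sum_apply]
      refine (Finset.sum_eq_zero fun k hk => ?_).symm
      rw [LinearMap.smul_apply, coef_ofForest_ne, smul_zero]
      rintro rfl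
      exact hgh (mem_degIco.1 hk).1
  have h2 : conv (X.char s u).toLinearMap θ (Z s) - θ (Z u) =
      -∑ g ∈ degIco A (h.deg + 1) N, θ (ofForest g) * X.remainder Z g s u := by
    have h3 : θ (Z u) = (∑ k ∈ degIco A (h.deg + 1) N, θ (ofForest k) • coef k) (Z u) :=
      apply_eq_of_forall_deg_lt (hZ u) hθ
    have h4 : conv (X.char s u).toLinearMap θ (Z s) = conv (X.char s u).toLinearMap
        (∑ k ∈ degIco A (h.deg + 1) N, θ (ofForest k) • coef k) (Z s) := by
      refine apply_eq_of_forall_deg_lt (hZ s) fun g hg => conv_congr g fun g₁ g₂ h12 => ?_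
      rw [hθ g₂ (by omega)]
    rw [h3, h4, conv_sum_right, LinearMap.sum_apply, LinearMap.sum_apply, ← Finset.sum_sub_distrib,
      ← Finset.sum_neg_distrib]
    refine Finset.sum_congr rfl fun g _ => ?_
    rw [conv_smul_right, LinearMap.smul_apply, LinearMap.smul_apply, RoughPath.remainder,
      smul_eq_mul, smul_eq_mul]
    ring
  rw [h1, h2]
  congr 1
  refine Finset.sum_congr rfl fun g hg => ?_
  have hg := mem_degIco.1 hg
  -- expansion of `X_{u,t}(· ⊤ p)` in the components of `X_{u,t}`
  have h3 : θ (ofForest g) = conv (∑ g' ∈ degIco A 1 (N + 1),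
      X.comp g' u t • (coef g' ∘ₗ growth.flip (P.elt i))) ψ (ofForest g) := by
    refine conv_congr g fun g₁ g₂ h12 => ?_
    by_cases h2 : g₂.deg = P.deg i + h.deg
    · congr 1
      have hmem := growth_mem_homogeneous (ofForest_mem_homogeneous g₁) (P.elt_mem_homogeneous i)
      change X.char u t (growth (ofForest g₁) (P.elt i)) = _
      conv_lhs => rw [eq_sum_coef (degIco A 1 (N + 1)) (x := growth (ofForest g₁) (P.elt i))
        fun k hk => coef_eq_zero_of_mem_homogeneous hmem (by
          intro hk'
          refine hk (mem_degIco.2 ?_)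
          omega)]
      rw [map_sum, LinearMap.sum_apply]
      refine Finset.sum_congr rfl fun k _ => ?_
      rw [map_smul, LinearMap.smul_apply, smul_eq_mul, smul_eq_mul, mul_comm]
      rfl
    · rw [hψ g₂ h2, mul_zero, mul_zero]
  rw [h3, conv_sum_left, LinearMap.sum_apply, Finset.sum_mul]
  refine Finset.sum_congr rfl fun g' _ => ?_
  rw [conv_smul_left, LinearMap.smul_apply, smul_eq_mul, germCoef]
  ring

end Germ


/-! ### The sewing lemma -/

theorem HasSewing.sub {Ξ Ξ' : ℝ → ℝ → ℝ} {s t I I' : ℝ} (h : HasSewing Ξ s t I)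
    (h' : HasSewing Ξ' s t I') :
    HasSewing (fun u v => Ξ u v - Ξ' u v) s t (I - I') := by
  intro η hη
  obtain ⟨δ, hδ, H⟩ := h (η / 2) (half_pos hη)
  obtain ⟨δ', hδ', H'⟩ := h' (η / 2) (half_pos hη)
  refine ⟨min δ δ', lt_min hδ hδ', fun n x hx h0 hn hmesh => ?_⟩
  have h1 := H n x hx h0 hn fun k hk => (hmesh k hk).trans (min_le_left _ _)
  have h2 := H' n x hx h0 hn fun k hk => (hmesh k hk).trans (min_le_right _ _)
  rw [Finset.sum_sub_distrib]
  rw [abs_le] at *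
  constructor <;> linarith

theorem HasSewing.unique {Ξ : ℝ → ℝ → ℝ} {s t I I' : ℝ} (hst : s ≤ t) (h : HasSewing Ξ s t I)
    (h' : HasSewing Ξ s t I') : I = I' := by
  refine eq_of_forall_dist_le fun η hη => ?_
  obtain ⟨δ, hδ, H⟩ := h (η / 2) (half_pos hη)
  obtain ⟨δ', hδ', H'⟩ := h' (η / 2) (half_pos hη)
  obtain ⟨n, hn⟩ := exists_nat_gt ((t - s) / min δ δ')
  have hmin : 0 < min δ δ' := lt_min hδ hδ'
  have hn0 : (0 : ℝ) < n := lt_of_le_of_lt (div_nonneg (sub_nonneg.2 hst) hmin.le) hn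
  have hstep : 0 ≤ (t - s) / n := div_nonneg (sub_nonneg.2 hst) hn0.le
  have hx : Monotone fun k : ℕ => s + k * ((t - s) / n) := by
    intro k l hkl
    have : (k : ℝ) ≤ l := by exact_mod_cast hkl
    simpa using mul_le_mul_of_nonneg_right this hstep
  have hmesh : ∀ k < n, (s + (k + 1 : ℕ) * ((t - s) / n)) - (s + k * ((t - s) / n)) ≤
      min δ δ' := by
    intro k _
    push_cast
    rw [div_lt_iff₀ hmin] at hn
    have : (t - s) / n ≤ min δ δ' := (div_le_iff₀ hn0).2 (by linarith)
    linarith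
  have hxn : s + (n : ℝ) * ((t - s) / n) = t := by field_simp; ring
  have h1 := H n _ hx (by simp) hxn fun k hk => (hmesh k hk).trans (min_le_left _ _)
  have h2 := H' n _ hx (by simp) hxn fun k hk => (hmesh k hk).trans (min_le_right _ _)
  rw [Real.dist_eq]
  rw [abs_le] at *
  constructor <;> linarith

/-- The constant of the sewing lemma with exponent `θ`, the solution of `C = 2 ^ (1 - θ) C + 2`. -/
noncomputable def sewConst (θ : ℝ) : ℝ := 2 / (1 - 2 ^ (1 - θ))

theorem two_rpow_lt_one {θ : ℝ} (hθ : 1 < θ) : (2 : ℝ) ^ (1 - θ) < 1 :=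
  Real.rpow_lt_one_of_one_lt_of_neg (by norm_num) (by linarith)

theorem sewConst_nonneg {θ : ℝ} (hθ : 1 < θ) : 0 ≤ sewConst θ :=
  div_nonneg (by norm_num) (sub_nonneg.2 (two_rpow_lt_one hθ).le)

section Sewing

variable {T K θ : ℝ} {Ξ : ℝ → ℝ → ℝ}

theorem germ_self_eq_zero (hθ : 1 < θ)
    (hΞ : ∀ s u t, 0 ≤ s → s ≤ u → u ≤ t → t ≤ T → |Ξ s t - Ξ s u - Ξ u t| ≤ K * (t - s) ^ θ)
    {s : ℝ} (hs : 0 ≤ s) (hsT : s ≤ T) : Ξ s s = 0 := by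
  have h := hΞ s s s hs le_rfl le_rfl hsT
  rw [sub_self, sub_self, Real.zero_rpow (by linarith), mul_zero, zero_sub, abs_neg] at h
  exact abs_eq_zero.1 (le_antisymm h (abs_nonneg _))

/-- Riemann sums differ from the germ of the whole interval by a multiple of `(t - s) ^ θ`, for all
partitions. The partition is cut at the last point of the left half of the interval; the two
remaining partitions live on intervals of at most half the length. -/
theorem abs_riemannSum_sub_le (hθ : 1 < θ) (hK : 0 ≤ K)
    (hΞ : ∀ s u t, 0 ≤ s → s ≤ u → u ≤ t → t ≤ T → |Ξ s t - Ξ s u - Ξ u t| ≤ K * (t - s) ^ θ)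
    (n : ℕ) (x : ℕ → ℝ) (hx : Monotone x) (h0 : 0 ≤ x 0) (hn : x n ≤ T) :
    |(∑ k ∈ Finset.range n, Ξ (x k) (x (k + 1))) - Ξ (x 0) (x n)| ≤
      sewConst θ * K * (x n - x 0) ^ θ := by
  induction n using Nat.strong_induction_on generalizing x with
  | _ n ih =>
  rcases Nat.eq_zero_or_pos n with rfl | hpos
  · rw [Finset.sum_range_zero, germ_self_eq_zero hθ hΞ h0 hn]
    simp only [sub_self, abs_zero, Real.zero_rpow (by linarith : θ ≠ 0), mul_zero, le_refl]
  set L := x n - x 0 with hL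
  have hL0 : 0 ≤ L := sub_nonneg.2 (hx (Nat.zero_le n))
  -- `x m` is the last point of the partition in the left half of the interval
  set m := Nat.findGreatest (fun m => x m - x 0 ≤ L / 2) (n - 1) with hm
  have hm_le : m ≤ n - 1 := Nat.findGreatest_le _
  have hm1 : x m - x 0 ≤ L / 2 :=
    Nat.findGreatest_spec (P := fun m => x m - x 0 ≤ L / 2) (Nat.zero_le (n - 1))
      (by rw [sub_self]; linarith)
  have hm2 : x n - x (m + 1) ≤ L / 2 := by
    by_cases hmn : m + 1 ≤ n - 1
    · have := Nat.findGreatest_is_greatest (P := fun m => x m - x 0 ≤ L / 2)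
        (Nat.lt_succ_self m) hmn
      rw [not_le] at this
      have h2 : x (m + 1) - x 0 > L / 2 := this
      linarith
    · have : m + 1 = n := by omega
      rw [this, sub_self]
      linarith
  obtain ⟨l, hl⟩ : ∃ l, n = m + 1 + l := ⟨n - (m + 1), by omega⟩
  have hmT : x m ≤ T := (hx (by omega)).trans hn
  have hm0 : 0 ≤ x m := h0.trans (hx (Nat.zero_le m))
  have hmm : x m ≤ x (m + 1) := hx (Nat.le_succ m)
  have hmn : x (m + 1) ≤ x n := hx (by omega)
  have h0m : x 0 ≤ x m := hx (Nat.zero_le m)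
  have e1 := ih m (by omega) x hx h0 hmT
  have e2 := ih l (by omega) (fun k => x (m + 1 + k)) (fun i j hij => hx (by omega))
    (h0.trans (hx (Nat.zero_le _))) (by rw [← hl]; exact hn)
  simp only [add_zero, ← hl] at e2
  have e3 := hΞ (x 0) (x m) (x n) h0 h0m (hmm.trans hmn) hn
  have e4 := hΞ (x m) (x (m + 1)) (x n) hm0 hmm hmn hn
  have hpow : ∀ y, 0 ≤ y → y ≤ L / 2 → y ^ θ ≤ (2 : ℝ) ^ (1 - θ) / 2 * L ^ θ := by
    intro y hy hyL
    refine (Real.rpow_le_rpow hy hyL (by linarith)).trans (le_of_eq ?_)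
    rw [Real.div_rpow hL0 (by norm_num), Real.rpow_sub (by norm_num), Real.rpow_one]
    field_simp
  have p1 := hpow (x m - x 0) (by linarith) hm1
  have p2 := hpow (x n - x (m + 1)) (by linarith) hm2
  have p4 : (x n - x m) ^ θ ≤ L ^ θ :=
    Real.rpow_le_rpow (by linarith) (by linarith) (by linarith)
  have hC : sewConst θ * K * ((2 : ℝ) ^ (1 - θ) / 2 * L ^ θ) * 2 + K * L ^ θ * 2 =
      sewConst θ * K * L ^ θ := by
    have h2 : 1 - (2 : ℝ) ^ (1 - θ) ≠ 0 := (sub_pos.2 (two_rpow_lt_one hθ)).ne'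
    have h3 : sewConst θ * (1 - (2 : ℝ) ^ (1 - θ)) = 2 := div_mul_cancel₀ _ h2
    linear_combination (-K * L ^ θ) * h3
  have hCK : 0 ≤ sewConst θ * K := mul_nonneg (sewConst_nonneg hθ) hK
  have q1 := e1.trans (mul_le_mul_of_nonneg_left p1 hCK)
  have q2 := e2.trans (mul_le_mul_of_nonneg_left p2 hCK)
  have q4 := e4.trans (mul_le_mul_of_nonneg_left p4 hK)
  have hsum : ∑ k ∈ Finset.range n, Ξ (x k) (x (k + 1)) =
      ∑ k ∈ Finset.range m, Ξ (x k) (x (k + 1)) + Ξ (x m) (x (m + 1)) +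
        ∑ k ∈ Finset.range l, Ξ (x (m + 1 + k)) (x (m + 1 + (k + 1))) := by
    rw [hl, Finset.sum_range_add, Finset.sum_range_succ]
    rfl
  rw [hsum]
  rw [abs_le] at *
  constructor <;> linarith

/-- The Riemann sum of `Ξ` over the partition of `[s, t]` by the multiples of `T / (n + 1)`. -/
noncomputable def uniformSum (T : ℝ) (Ξ : ℝ → ℝ → ℝ) (n : ℕ) (s t : ℝ) : ℝ :=
  ∑ k ∈ Finset.range (n + 1), Ξ (max s (min (k * (T / (n + 1))) t))
    (max s (min ((k + 1 : ℕ) * (T / (n + 1))) t))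

theorem abs_uniformSum_sub_le (hθ : 1 < θ) (hK : 0 ≤ K)
    (hΞ : ∀ s u t, 0 ≤ s → s ≤ u → u ≤ t → t ≤ T → |Ξ s t - Ξ s u - Ξ u t| ≤ K * (t - s) ^ θ)
    (n : ℕ) {s t : ℝ} (hs : 0 ≤ s) (hst : s ≤ t) (ht : t ≤ T) :
    |uniformSum T Ξ n s t - Ξ s t| ≤ sewConst θ * K * (t - s) ^ θ := by
  have hT : 0 ≤ T := hs.trans (hst.trans ht)
  have hn : (0 : ℝ) < n + 1 := by positivity
  have hx : Monotone fun k : ℕ => max s (min ((k : ℝ) * (T / (n + 1))) t) := by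
    intro k l hkl
    have : (k : ℝ) ≤ l := by exact_mod_cast hkl
    have h2 : (k : ℝ) * (T / (n + 1)) ≤ l * (T / (n + 1)) :=
      mul_le_mul_of_nonneg_right this (div_nonneg hT hn.le)
    exact max_le_max le_rfl (min_le_min h2 le_rfl)
  have h0 : max s (min (((0 : ℕ) : ℝ) * (T / (n + 1))) t) = s := by
    rw [Nat.cast_zero, zero_mul, min_eq_left (hs.trans hst), max_eq_left hs]
  have h1 : max s (min (((n + 1 : ℕ) : ℝ) * (T / (n + 1))) t) = t := by
    rw [Nat.cast_add, Nat.cast_one, mul_div_cancel₀ _ hn.ne', min_eq_right ht, max_eq_right hst]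
  have h := abs_riemannSum_sub_le hθ hK hΞ (n + 1) _ hx (by rw [h0]; exact hs)
    (by rw [h1]; exact ht)
  rw [h0, h1] at h
  exact h

theorem abs_uniformSum_delta_le (hθ : 1 < θ) (hK : 0 ≤ K)
    (hΞ : ∀ s u t, 0 ≤ s → s ≤ u → u ≤ t → t ≤ T → |Ξ s t - Ξ s u - Ξ u t| ≤ K * (t - s) ^ θ)
    (n : ℕ) {s t : ℝ} (hs : 0 ≤ s) (hst : s ≤ t) (ht : t ≤ T) :
    |uniformSum T Ξ n 0 t - uniformSum T Ξ n 0 s - uniformSum T Ξ n s t| ≤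
      (n + 1) * (K * (T / (n + 1)) ^ θ) := by
  have hT : 0 ≤ T := hs.trans (hst.trans ht)
  have hn : (0 : ℝ) < n + 1 := by positivity
  have hstep : 0 ≤ T / (n + 1) := div_nonneg hT hn.le
  have hself : Ξ s s = 0 := germ_self_eq_zero hθ hΞ hs (hst.trans ht)
  rw [uniformSum, uniformSum, uniformSum, ← Finset.sum_sub_distrib, ← Finset.sum_sub_distrib]
  refine (Finset.abs_sum_le_sum_abs _ _).trans ?_
  refine (Finset.sum_le_card_nsmul _ _ (K * (T / (n + 1)) ^ θ) fun k _ => ?_).trans (le_of_eq ?_)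
  · have hx : 0 ≤ (k : ℝ) * (T / (n + 1)) := mul_nonneg (Nat.cast_nonneg k) hstep
    have hy : ((k + 1 : ℕ) : ℝ) * (T / (n + 1)) = k * (T / (n + 1)) + T / (n + 1) := by
      push_cast; ring
    rw [hy]
    generalize (k : ℝ) * (T / (n + 1)) = x at hx
    generalize T / ((n : ℝ) + 1) = e at hstep
    have hnn : 0 ≤ K * e ^ θ := mul_nonneg hK (Real.rpow_nonneg hstep _)
    have hm0 : ∀ y r : ℝ, 0 ≤ y → 0 ≤ r → max 0 (min y r) = min y r :=
      fun y r hy hr => max_eq_right (le_min hy hr)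
    rw [hm0 x t hx (hs.trans hst), hm0 x s hx hs, hm0 _ t (by linarith) (hs.trans hst),
      hm0 _ s (by linarith) hs]
    -- only the interval of the partition that contains `s` contributes
    rcases le_total (x + e) s with h1 | h1
    · rw [min_eq_left (by linarith : x ≤ t), min_eq_left (by linarith : x + e ≤ t),
        min_eq_left (by linarith : x ≤ s), min_eq_left h1, max_eq_left (by linarith),
        max_eq_left h1, hself]
      simpa using hnn
    · rcases le_total s x with h2 | h2
      · rw [min_eq_right h2, min_eq_right h1, max_eq_right (le_min h2 hst),
          max_eq_right (le_min h1 hst), hself]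
        simpa using hnn
      · rw [min_eq_left (h2.trans hst), min_eq_left h2, min_eq_right h1, max_eq_left h2,
          max_eq_right (le_min h1 hst)]
        refine (hΞ x s _ hx h2 (le_min h1 hst) ((min_le_right _ _).trans ht)).trans ?_
        refine mul_le_mul_of_nonneg_left (Real.rpow_le_rpow ?_ ?_ (by linarith)) hK
        · exact sub_nonneg.2 (h2.trans (le_min h1 hst))
        · have := min_le_left (x + e) t
          linarith
  · simp

/-- The sewing lemma. The integral is the limit of the sums over uniform partitions along an
ultrafilter, which exists since these sums are bounded; the estimate of all Riemann sums shows that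
it is additive up to the right error, and hence the limit along all partitions. -/
theorem exists_hasSewing (hT : 0 ≤ T) (hθ : 1 < θ) (hK : 0 ≤ K)
    (hΞ : ∀ s u t, 0 ≤ s → s ≤ u → u ≤ t → t ≤ T →
      |Ξ s t - Ξ s u - Ξ u t| ≤ K * (t - s) ^ θ) :
    ∃ I : ℝ → ℝ, (∀ t ∈ Icc 0 T, HasSewing Ξ 0 t (I t)) ∧
      ∀ s t, 0 ≤ s → s ≤ t → t ≤ T → |I t - I s - Ξ s t| ≤ sewConst θ * K * (t - s) ^ θ := by
  have hlim : ∀ t : ℝ, ∃ y : ℝ, 0 ≤ t → t ≤ T → Filter.Tendsto (fun n => uniformSum T Ξ n 0 t)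
      (Filter.hyperfilter ℕ) (nhds y) := by
    intro t
    by_cases h : 0 ≤ t ∧ t ≤ T
    · have hb : ∀ n, uniformSum T Ξ n 0 t ∈
          Metric.closedBall (Ξ 0 t) (sewConst θ * K * (t - 0) ^ θ) := fun n => by
        rw [Metric.mem_closedBall, Real.dist_eq]
        exact abs_uniformSum_sub_le hθ hK hΞ n le_rfl h.1 h.2
      obtain ⟨y, _, hy⟩ := (isCompact_closedBall (Ξ 0 t) (sewConst θ * K * (t - 0) ^ θ)
        ).ultrafilter_le_nhds ((Filter.hyperfilter ℕ).map fun n => uniformSum T Ξ n 0 t)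
        (Filter.le_principal_iff.2 (Filter.mem_map.2 (Filter.Eventually.of_forall hb)))
      exact ⟨y, fun _ _ => hy⟩
    · exact ⟨0, fun h1 h2 => absurd ⟨h1, h2⟩ h⟩
  choose I hI using hlim
  have herr : Filter.Tendsto (fun n : ℕ => ((n : ℝ) + 1) * (K * (T / (n + 1)) ^ θ))
      (Filter.hyperfilter ℕ) (nhds 0) := by
    refine Filter.Tendsto.mono_left ?_ Nat.hyperfilter_le_atTop
    have h1 : Filter.Tendsto (fun n : ℕ => K * T ^ θ * ((n : ℝ) + 1) ^ (-(θ - 1)))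
        Filter.atTop (nhds (K * T ^ θ * 0)) :=
      ((tendsto_rpow_neg_atTop (by linarith)).comp
        (Filter.tendsto_atTop_add_const_right _ 1 tendsto_natCast_atTop_atTop)).const_mul _
    rw [mul_zero] at h1
    refine h1.congr fun n => ?_
    have hn : (0 : ℝ) < n + 1 := by positivity
    rw [Real.div_rpow hT hn.le, Real.rpow_neg hn.le, Real.rpow_sub hn, Real.rpow_one]
    have : ((n : ℝ) + 1) ^ θ ≠ 0 := (Real.rpow_pos_of_pos hn _).ne'
    field_simp
  have hbound : ∀ s t, 0 ≤ s → s ≤ t → t ≤ T →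
      |I t - I s - Ξ s t| ≤ sewConst θ * K * (t - s) ^ θ := by
    intro s t hs hst ht
    have h1 := (((hI t (hs.trans hst) ht).sub (hI s hs (hst.trans ht))).sub_const (Ξ s t)).abs
    have h2 := herr.const_add (sewConst θ * K * (t - s) ^ θ)
    rw [add_zero] at h2
    refine le_of_tendsto_of_tendsto' h1 h2 fun n => ?_
    have e1 := abs_uniformSum_sub_le hθ hK hΞ n hs hst ht
    have e2 := abs_uniformSum_delta_le hθ hK hΞ n hs hst ht
    rw [abs_le] at *
    constructor <;> linarith
  refine ⟨fun t => I t - I 0, fun t ht => ?_, fun s t hs hst ht => by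
    simpa using hbound s t hs hst ht⟩
  intro η hη
  have hC : 0 ≤ sewConst θ * K := mul_nonneg (sewConst_nonneg hθ) hK
  have hB : 0 < sewConst θ * K * T + 1 := by positivity
  -- a mesh `δ` with `sewConst θ * K * T * δ ^ (θ - 1) ≤ η`; the summand `1` avoids division by zero
  refine ⟨(η / (sewConst θ * K * T + 1)) ^ (θ - 1)⁻¹, Real.rpow_pos_of_pos (div_pos hη hB) _,
    fun n x hx h0 hn hmesh => ?_⟩
  have htel : I t - I 0 = ∑ k ∈ Finset.range n, (I (x (k + 1)) - I (x k)) := by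
    rw [Finset.sum_range_sub (fun k => I (x k)), hn, h0]
  have hlen : t = ∑ k ∈ Finset.range n, (x (k + 1) - x k) := by
    rw [Finset.sum_range_sub x, hn, h0, sub_zero]
  beta_reduce
  rw [htel, ← Finset.sum_sub_distrib]
  calc |∑ k ∈ Finset.range n, (Ξ (x k) (x (k + 1)) - (I (x (k + 1)) - I (x k)))|
      ≤ ∑ k ∈ Finset.range n, |Ξ (x k) (x (k + 1)) - (I (x (k + 1)) - I (x k))| :=
        Finset.abs_sum_le_sum_abs _ _
    _ ≤ ∑ k ∈ Finset.range n, sewConst θ * K * (η / (sewConst θ * K * T + 1)) *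
          (x (k + 1) - x k) := by
        refine Finset.sum_le_sum fun k hk => ?_
        have hk := Finset.mem_range.1 hk
        have hxk : 0 ≤ x k := h0 ▸ hx (Nat.zero_le k)
        have hxk1 : x k ≤ x (k + 1) := hx (Nat.le_succ k)
        have hxT : x (k + 1) ≤ T := (hx hk).trans (hn ▸ ht.2)
        rw [abs_sub_comm]
        refine (hbound _ _ hxk hxk1 hxT).trans ?_
        rw [mul_assoc _ (η / _)]
        refine mul_le_mul_of_nonneg_left ?_ hC
        have hd : 0 ≤ x (k + 1) - x k := sub_nonneg.2 hxk1
        have h1 : (x (k + 1) - x k) ^ (θ - 1) ≤ η / (sewConst θ * K * T + 1) := by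
          refine (Real.rpow_le_rpow hd (hmesh k hk) (by linarith)).trans (le_of_eq ?_)
          rw [← Real.rpow_mul (div_pos hη hB).le, inv_mul_cancel₀ (by linarith), Real.rpow_one]
        calc (x (k + 1) - x k) ^ θ = (x (k + 1) - x k) ^ (θ - 1) * (x (k + 1) - x k) := by
              conv_lhs => rw [show θ = (θ - 1) + 1 by ring]
              rw [Real.rpow_add_one' hd (by linarith)]
          _ ≤ _ := mul_le_mul_of_nonneg_right h1 hd
    _ = sewConst θ * K * (η / (sewConst θ * K * T + 1)) * t := by
        rw [← Finset.mul_sum, ← hlen]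
    _ ≤ η := by
        rw [mul_div_assoc', div_mul_eq_mul_div, div_le_iff₀ hB]
        have := mul_le_mul_of_nonneg_left ht.2 (mul_nonneg hC hη.le)
        nlinarith

end Sewing

/-- The sewing lemma for germs whose defect of additivity is controlled for points in any order. -/
theorem exists_hasSewing_of_two_sided {T K a b : ℝ} {Ξ : ℝ → ℝ → ℝ} (hT : 0 ≤ T) (ha : 0 ≤ a)
    (hb : 0 ≤ b) (hab : 1 < a + b) (hK : 0 ≤ K)
    (hΞ : ∀ s ∈ Icc 0 T, ∀ u ∈ Icc 0 T, ∀ t ∈ Icc 0 T,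
      |Ξ s t - Ξ s u - Ξ u t| ≤ K * (|t - u| ^ a * |u - s| ^ b)) :
    ∃ I : ℝ → ℝ, (∀ t ∈ Icc 0 T, HasSewing Ξ 0 t (I t)) ∧
      ∀ s ∈ Icc 0 T, ∀ t ∈ Icc 0 T,
        |I t - I s - Ξ s t| ≤ (sewConst (a + b) + 1) * K * |t - s| ^ (a + b) := by
  have hΞ' : ∀ s u t, 0 ≤ s → s ≤ u → u ≤ t → t ≤ T →
      |Ξ s t - Ξ s u - Ξ u t| ≤ K * (t - s) ^ (a + b) := by
    intro s u t hs hsu hut ht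
    refine (hΞ s ⟨hs, by linarith⟩ u ⟨by linarith, by linarith⟩ t ⟨by linarith, ht⟩).trans
      (mul_le_mul_of_nonneg_left ?_ hK)
    rw [Real.rpow_add' (by linarith) (by linarith), abs_of_nonneg (sub_nonneg.2 hut),
      abs_of_nonneg (sub_nonneg.2 hsu)]
    refine mul_le_mul (Real.rpow_le_rpow (by linarith) (by linarith) ha)
      (Real.rpow_le_rpow (by linarith) (by linarith) hb) (Real.rpow_nonneg (by linarith) _)
      (Real.rpow_nonneg (by linarith) _)
  obtain ⟨I, hI, hbound⟩ := exists_hasSewing hT hab hK hΞ'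
  refine ⟨I, hI, fun s hs t ht => ?_⟩
  rcases le_total s t with hst | hst
  · refine (hbound s t hs.1 hst ht.2).trans ?_
    rw [abs_of_nonneg (sub_nonneg.2 hst)]
    have : 0 ≤ K * (t - s) ^ (a + b) := mul_nonneg hK (Real.rpow_nonneg (by linarith) _)
    nlinarith
  -- for `t ≤ s`, the germs of `[s, t]` and `[t, s]` cancel up to the defect at `s, t, s`
  · have h1 := hbound t s ht.1 hst hs.2
    have h2 := hΞ s hs t ht s hs
    have h3 : Ξ s s = 0 := germ_self_eq_zero hab hΞ' hs.1 hs.2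
    rw [h3, abs_sub_comm s t, ← Real.rpow_add' (abs_nonneg _) (by linarith)] at h2
    rw [← abs_of_nonneg (sub_nonneg.2 hst), abs_sub_comm s t] at h1
    rw [abs_le] at *
    constructor <;> linarith

/-- The difference of the rough integral and its germ. -/
theorem HasSewing.abs_sub_le {T K a b : ℝ} {Ξ : ℝ → ℝ → ℝ} {I : ℝ → ℝ} (hT : 0 ≤ T) (ha : 0 ≤ a)
    (hb : 0 ≤ b) (hab : 1 < a + b) (hK : 0 ≤ K)
    (hΞ : ∀ s ∈ Icc 0 T, ∀ u ∈ Icc 0 T, ∀ t ∈ Icc 0 T,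
      |Ξ s t - Ξ s u - Ξ u t| ≤ K * (|t - u| ^ a * |u - s| ^ b))
    (hI : ∀ t ∈ Icc 0 T, HasSewing Ξ 0 t (I t)) {s t : ℝ} (hs : s ∈ Icc 0 T) (ht : t ∈ Icc 0 T) :
    |I t - I s - Ξ s t| ≤ (sewConst (a + b) + 1) * K * |t - s| ^ (a + b) := by
  obtain ⟨J, hJ, hbound⟩ := exists_hasSewing_of_two_sided hT ha hb hab hK hΞ
  rw [(hI t ht).unique ht.1 (hJ t ht), (hI s hs).unique hs.1 (hJ s hs)]
  exact hbound s hs t ht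

end BranchedRP

namespace BranchedRP

variable {A : Type*} [Finite A] {ι : Type*} (P : PrimBasis A ι) {α T : ℝ} (X X' : RoughPath A α T)

/-! ### The recursion for `Γ` -/

theorem coef_gammaAux_succ (f : Forest A → ℝ → ℝ) (k : ℕ) (t : ℝ) (h : Forest A) :
    coef h (gammaAux P X f (k + 1) t) = coef h (gammaAux P X f k t) +
      if h.deg + k + 1 = ⌊α⁻¹⌋₊ then
        (∑ i ∈ (P.finite_deg_lt (⌊α⁻¹⌋₊ - h.deg)).toFinset,
            sewing (germ P X (gammaAux P X f k) h i) 0 t) + f h t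
      else 0 := by
  classical
  rw [gammaAux, map_add, map_sum]
  congr 1
  split_ifs with hk
  · rw [Finset.sum_eq_single h]
    · rw [map_smul, coef_ofForest_self, smul_eq_mul, mul_one]
    · intro g _ hg
      rw [map_smul, coef_ofForest_ne hg, smul_zero]
    · intro hh
      refine absurd ?_ hh
      rw [Finset.mem_filter, Forest.upTo, Set.Finite.mem_toFinset]
      refine ⟨?_, hk⟩
      change h.deg ≤ _
      omega
  · refine Finset.sum_eq_zero fun g hg => ?_
    rw [map_smul, coef_ofForest_ne, smul_zero]
    rintro rfl
    exact hk (Finset.mem_filter.1 hg).2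

theorem coef_gammaAux_of_le (f : Forest A → ℝ → ℝ) (k : ℕ) (t : ℝ) {h : Forest A}
    (hh : ⌊α⁻¹⌋₊ ≤ h.deg) : coef h (gammaAux P X f k t) = 0 := by
  induction k with
  | zero => exact map_zero _
  | succ k ih => rw [coef_gammaAux_succ, ih, if_neg (by omega), add_zero]

theorem coef_gammaAux_of_lt (f : Forest A → ℝ → ℝ) (k : ℕ) (t : ℝ) {h : Forest A}
    (hh : h.deg + k < ⌊α⁻¹⌋₊) : coef h (gammaAux P X f k t) = 0 := by
  induction k with
  | zero => exact map_zero _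
  | succ k ih => rw [coef_gammaAux_succ, ih (by omega), if_neg (by omega), add_zero]

theorem coef_gammaAux_add (f : Forest A → ℝ → ℝ) (k l : ℕ) (t : ℝ) {h : Forest A}
    (hh : ⌊α⁻¹⌋₊ ≤ h.deg + k) :
    coef h (gammaAux P X f (k + l) t) = coef h (gammaAux P X f k t) := by
  induction l with
  | zero => rfl
  | succ l ih => rw [← add_assoc, coef_gammaAux_succ, ih, if_neg (by omega), add_zero]

theorem coef_Gamma_of_le (f : Forest A → ℝ → ℝ) (t : ℝ) {h : Forest A}
    (hh : ⌊α⁻¹⌋₊ ≤ h.deg) : coef h (Gamma P X f t) = 0 :=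
  coef_gammaAux_of_le P X f _ t hh

theorem coef_Gamma (f : Forest A → ℝ → ℝ) (t : ℝ) {h : Forest A} (hh : h.deg < ⌊α⁻¹⌋₊) :
    coef h (Gamma P X f t) = (∑ i ∈ (P.finite_deg_lt (⌊α⁻¹⌋₊ - h.deg)).toFinset,
      sewing (germ P X (Gamma P X f) h i) 0 t) + f h t := by
  obtain ⟨k, hk⟩ : ∃ k, h.deg + k + 1 = ⌊α⁻¹⌋₊ := ⟨⌊α⁻¹⌋₊ - h.deg - 1, by omega⟩
  have hgerm : ∀ i, germ P X (gammaAux P X f k) h i = germ P X (Gamma P X f) h i := by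
    intro i
    funext s u
    refine germ_congr P X (fun g hg => ?_) i u
    rw [Gamma, show ⌊α⁻¹⌋₊ = k + (h.deg + 1) by omega, coef_gammaAux_add P X f k _ s (by omega)]
  have hstep : coef h (Gamma P X f t) = coef h (gammaAux P X f (k + 1) t) := by
    rw [Gamma, show ⌊α⁻¹⌋₊ = (k + 1) + h.deg by omega,
      coef_gammaAux_add P X f (k + 1) _ t (by omega)]
  rw [hstep, coef_gammaAux_succ, if_pos hk, coef_gammaAux_of_lt P X f k t (by omega), zero_add]
  simp only [hgerm]

theorem remainder_Gamma (f : Forest A → ℝ → ℝ) {h : Forest A} (hh : h.deg < ⌊α⁻¹⌋₊) (s t : ℝ) :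
    X.remainder (Gamma P X f) h s t = (f h t - f h s) +
      ∑ i ∈ (P.finite_deg_lt (⌊α⁻¹⌋₊ - h.deg)).toFinset,
        (sewing (germ P X (Gamma P X f) h i) 0 t - sewing (germ P X (Gamma P X f) h i) 0 s -
          germ P X (Gamma P X f) h i s t) := by
  rw [remainder_eq P X (fun h hh => coef_Gamma_of_le P X f s hh), coef_Gamma P X f t hh,
    coef_Gamma P X f s hh, Finset.sum_sub_distrib, Finset.sum_sub_distrib]
  ring

/-! ### Estimates of the remainders -/

/-- The total size of the coefficients in `germ_delta`. -/
noncomputable def germBound (N : ℕ) (h : Forest A) (i : ι) : ℝ :=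
  ∑ g ∈ degIco A (h.deg + 1) N, ∑ g' ∈ degIco A 1 (N + 1), |germCoef P h i g' g|

theorem germBound_nonneg (N : ℕ) (h : Forest A) (i : ι) : 0 ≤ germBound P N h i :=
  Finset.sum_nonneg fun _ _ => Finset.sum_nonneg fun _ _ => abs_nonneg _

theorem abs_sum_germCoef_le (N : ℕ) (h : Forest A) (i : ι) {Y : Forest A → Forest A → ℝ} {B : ℝ}
    (hY : ∀ g ∈ degIco A (h.deg + 1) N, ∀ g' ∈ degIco A 1 (N + 1), |Y g' g| ≤ B) :
    |∑ g ∈ degIco A (h.deg + 1) N, ∑ g' ∈ degIco A 1 (N + 1), germCoef P h i g' g * Y g' g| ≤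
      germBound P N h i * B := by
  rw [germBound, Finset.sum_mul]
  refine (Finset.abs_sum_le_sum_abs _ _).trans (Finset.sum_le_sum fun g hg => ?_)
  rw [Finset.sum_mul]
  refine (Finset.abs_sum_le_sum_abs _ _).trans (Finset.sum_le_sum fun g' hg' => ?_)
  rw [abs_mul]
  exact mul_le_mul_of_nonneg_left (hY g hg g' hg') (abs_nonneg _)

/-- A bound `|y_{s,t}| ≤ C |t - s| ^ γ` for `s, t ∈ [0, T]`. -/
def HolderBound (T γ C : ℝ) (y : ℝ → ℝ → ℝ) : Prop :=
  ∀ s ∈ Icc 0 T, ∀ t ∈ Icc 0 T, |y s t| ≤ C * |t - s| ^ γ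

theorem HolderBound.mono {T γ C C' : ℝ} {y : ℝ → ℝ → ℝ} (h : HolderBound T γ C y) (hC : C ≤ C') :
    HolderBound T γ C' y := fun s hs t ht =>
  (h s hs t ht).trans (mul_le_mul_of_nonneg_right hC (Real.rpow_nonneg (abs_nonneg _) _))

variable {X X'}

theorem abs_germ_delta_le {β M K : ℝ} (hM : 0 ≤ M)
    (hX : ∀ g ∈ degIco A 1 (⌊α⁻¹⌋₊ + 1), HolderBound T α M (X.comp g)) {f : Forest A → ℝ → ℝ}
    {h : Forest A} (hR : ∀ g ∈ degIco A (h.deg + 1) ⌊α⁻¹⌋₊,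
      HolderBound T β K (X.remainder (Gamma P X f) g)) (i : ι) :
    ∀ s ∈ Icc 0 T, ∀ u ∈ Icc 0 T, ∀ t ∈ Icc 0 T,
      |germ P X (Gamma P X f) h i s t - germ P X (Gamma P X f) h i s u -
        germ P X (Gamma P X f) h i u t| ≤
      germBound P ⌊α⁻¹⌋₊ h i * (M * K) * (|t - u| ^ α * |u - s| ^ β) := by
  intro s hs u hu t ht
  rw [germ_delta P X hs hu ht (fun r h hh => coef_Gamma_of_le P X f r hh), abs_neg, mul_assoc]
  refine abs_sum_germCoef_le P _ h i fun g hg g' hg' => ?_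
  rw [abs_mul, mul_mul_mul_comm]
  exact mul_le_mul (hX g' hg' u hu t ht) (hR g hg s hs u hu) (abs_nonneg _)
    (mul_nonneg hM (Real.rpow_nonneg (abs_nonneg _) _))

theorem abs_germ_sub_delta_le {β M r K K' : ℝ} (hM : 0 ≤ M) (hr : 0 ≤ r)
    (hX' : ∀ g ∈ degIco A 1 (⌊α⁻¹⌋₊ + 1), HolderBound T α M (X'.comp g))
    (hXX' : ∀ g ∈ degIco A 1 (⌊α⁻¹⌋₊ + 1),
      HolderBound T α r fun s t => X.comp g s t - X'.comp g s t)
    {f : Forest A → ℝ → ℝ} {h : Forest A}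
    (hR : ∀ g ∈ degIco A (h.deg + 1) ⌊α⁻¹⌋₊,
      HolderBound T β K (X.remainder (Gamma P X f) g))
    (hRR' : ∀ g ∈ degIco A (h.deg + 1) ⌊α⁻¹⌋₊,
      HolderBound T β K' fun s t =>
        X.remainder (Gamma P X f) g s t - X'.remainder (Gamma P X' f) g s t) (i : ι) :
    ∀ s ∈ Icc 0 T, ∀ u ∈ Icc 0 T, ∀ t ∈ Icc 0 T,
      |(germ P X (Gamma P X f) h i s t - germ P X' (Gamma P X' f) h i s t) -
        (germ P X (Gamma P X f) h i s u - germ P X' (Gamma P X' f) h i s u) -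
        (germ P X (Gamma P X f) h i u t - germ P X' (Gamma P X' f) h i u t)| ≤
      germBound P ⌊α⁻¹⌋₊ h i * (r * K + M * K') * (|t - u| ^ α * |u - s| ^ β) := by
  intro s hs u hu t ht
  have h1 := germ_delta P X hs hu ht (fun r h hh => coef_Gamma_of_le P X f r hh) h i
  have h2 := germ_delta P X' hs hu ht (fun r h hh => coef_Gamma_of_le P X' f r hh) h i
  have h3 : (germ P X (Gamma P X f) h i s t - germ P X' (Gamma P X' f) h i s t) -
        (germ P X (Gamma P X f) h i s u - germ P X' (Gamma P X' f) h i s u) -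
        (germ P X (Gamma P X f) h i u t - germ P X' (Gamma P X' f) h i u t) =
      -∑ g ∈ degIco A (h.deg + 1) ⌊α⁻¹⌋₊, ∑ g' ∈ degIco A 1 (⌊α⁻¹⌋₊ + 1), germCoef P h i g' g *
        ((X.comp g' u t - X'.comp g' u t) * X.remainder (Gamma P X f) g s u +
          X'.comp g' u t *
            (X.remainder (Gamma P X f) g s u - X'.remainder (Gamma P X' f) g s u)) := by
    rw [show ∀ a a' b b' c c' : ℝ, (a - a') - (b - b') - (c - c') =
      (a - b - c) - (a' - b' - c') from fun a a' b b' c c' => by ring, h1, h2, ← neg_sub_neg,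
      neg_neg, neg_neg, ← neg_sub, neg_inj]
    rw [← Finset.sum_sub_distrib]
    refine Finset.sum_congr rfl fun g _ => ?_
    rw [← Finset.sum_sub_distrib]
    refine Finset.sum_congr rfl fun g' _ => ?_
    ring
  rw [h3, abs_neg, mul_assoc]
  refine abs_sum_germCoef_le P _ h i fun g hg g' hg' => ?_
  refine (abs_add_le _ _).trans ?_
  rw [abs_mul, abs_mul, add_mul, mul_mul_mul_comm, mul_mul_mul_comm M]
  refine add_le_add (mul_le_mul (hXX' g' hg' u hu t ht) (hR g hg s hs u hu) (abs_nonneg _)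
    (mul_nonneg hr (Real.rpow_nonneg (abs_nonneg _) _)))
    (mul_le_mul (hX' g' hg' u hu t ht) (hRR' g hg s hs u hu) (abs_nonneg _)
    (mul_nonneg hM (Real.rpow_nonneg (abs_nonneg _) _)))

section Induction

variable {β : ℝ}

theorem hasSewing_germ (hT : 0 ≤ T) (hα : 0 < α) (hβ : 0 < β) (hαβ : 1 < α + β) {M K : ℝ}
    (hM : 0 ≤ M) (hK : 0 ≤ K)
    (hX : ∀ g ∈ degIco A 1 (⌊α⁻¹⌋₊ + 1), HolderBound T α M (X.comp g)) {f : Forest A → ℝ → ℝ}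
    {h : Forest A} (hR : ∀ g ∈ degIco A (h.deg + 1) ⌊α⁻¹⌋₊,
      HolderBound T β K (X.remainder (Gamma P X f) g)) (i : ι) {t : ℝ} (ht : t ∈ Icc 0 T) :
    HasSewing (germ P X (Gamma P X f) h i) 0 t (sewing (germ P X (Gamma P X f) h i) 0 t) := by
  obtain ⟨I, hI, _⟩ := exists_hasSewing_of_two_sided hT hα.le hβ.le hαβ
    (mul_nonneg (germBound_nonneg P _ h i) (mul_nonneg hM hK)) (abs_germ_delta_le P hM hX hR i)
  exact Classical.epsilon_spec ⟨I t, hI t ht⟩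

/-- The constant by which one integration step multiplies the bounds of the remainders. -/
noncomputable def stepConst (α β T : ℝ) : ℝ :=
  (sewConst (α + β) + 1) * T ^ α * ∑ h ∈ degIco A 0 ⌊α⁻¹⌋₊,
    ∑ i ∈ (P.finite_deg_lt (⌊α⁻¹⌋₊ - h.deg)).toFinset, germBound P ⌊α⁻¹⌋₊ h i

theorem stepConst_nonneg (hT : 0 ≤ T) (hαβ : 1 < α + β) : 0 ≤ stepConst P α β T :=
  mul_nonneg (mul_nonneg (add_nonneg (sewConst_nonneg hαβ) zero_le_one) (Real.rpow_nonneg hT _))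
    (Finset.sum_nonneg fun _ _ => Finset.sum_nonneg fun _ _ => germBound_nonneg P _ _ _)

/-- One step of the recursion: sewing bounds the errors of the integrals against their germs. The
factor `|t - s| ^ α` that sewing gains is absorbed into the constant. -/
theorem abs_sum_integral_sub_germ_le (hT : 0 ≤ T) (hα : 0 < α) (hβ : 0 < β) (hαβ : 1 < α + β)
    {B : ℝ} (hB : 0 ≤ B) {h : Forest A} (hh : h.deg < ⌊α⁻¹⌋₊) {Ξ : ι → ℝ → ℝ → ℝ} {I : ι → ℝ → ℝ}
    (hΞ : ∀ i, ∀ s ∈ Icc 0 T, ∀ u ∈ Icc 0 T, ∀ t ∈ Icc 0 T,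
      |Ξ i s t - Ξ i s u - Ξ i u t| ≤ germBound P ⌊α⁻¹⌋₊ h i * B * (|t - u| ^ α * |u - s| ^ β))
    (hI : ∀ i, ∀ t ∈ Icc 0 T, HasSewing (Ξ i) 0 t (I i t)) :
    HolderBound T β (stepConst P α β T * B) fun s t =>
      ∑ i ∈ (P.finite_deg_lt (⌊α⁻¹⌋₊ - h.deg)).toFinset, (I i t - I i s - Ξ i s t) := by
  intro s hs t ht
  have hc : 0 ≤ sewConst (α + β) + 1 := add_nonneg (sewConst_nonneg hαβ) zero_le_one
  have hpow : |t - s| ^ (α + β) ≤ T ^ α * |t - s| ^ β := by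
    rw [Real.rpow_add' (abs_nonneg _) (by linarith)]
    refine mul_le_mul_of_nonneg_right (Real.rpow_le_rpow (abs_nonneg _) ?_ hα.le)
      (Real.rpow_nonneg (abs_nonneg _) _)
    rw [abs_le]
    constructor <;> linarith [hs.1, hs.2, ht.1, ht.2]
  have hTβ : 0 ≤ T ^ α * |t - s| ^ β :=
    mul_nonneg (Real.rpow_nonneg hT _) (Real.rpow_nonneg (abs_nonneg _) _)
  have h1 : ∀ i, |I i t - I i s - Ξ i s t| ≤
      germBound P ⌊α⁻¹⌋₊ h i * ((sewConst (α + β) + 1) * B * (T ^ α * |t - s| ^ β)) := by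
    intro i
    have hgB : 0 ≤ germBound P ⌊α⁻¹⌋₊ h i * B := mul_nonneg (germBound_nonneg P _ h i) hB
    refine (HasSewing.abs_sub_le hT hα.le hβ.le hαβ hgB (hΞ i) (hI i) hs ht).trans ?_
    refine (mul_le_mul_of_nonneg_left hpow (mul_nonneg hc hgB)).trans (le_of_eq ?_)
    ring
  refine (Finset.abs_sum_le_sum_abs _ _).trans ((Finset.sum_le_sum fun i _ => h1 i).trans ?_)
  rw [← Finset.sum_mul]
  have h2 : ∑ i ∈ (P.finite_deg_lt (⌊α⁻¹⌋₊ - h.deg)).toFinset, germBound P ⌊α⁻¹⌋₊ h i ≤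
      ∑ h ∈ degIco A 0 ⌊α⁻¹⌋₊, ∑ i ∈ (P.finite_deg_lt (⌊α⁻¹⌋₊ - h.deg)).toFinset,
        germBound P ⌊α⁻¹⌋₊ h i :=
    Finset.single_le_sum (f := fun h => ∑ i ∈ (P.finite_deg_lt (⌊α⁻¹⌋₊ - h.deg)).toFinset,
        germBound P ⌊α⁻¹⌋₊ h i)
      (fun h _ => Finset.sum_nonneg fun i _ => germBound_nonneg P _ h i)
      (mem_degIco.2 ⟨Nat.zero_le _, hh⟩)
  refine (mul_le_mul_of_nonneg_right h2 (mul_nonneg (mul_nonneg hc hB) hTβ)).trans (le_of_eq ?_)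
  rw [stepConst]
  ring

/-- The remainders of `Γ_X(f)` are `β`-Hölder, with a bound proportional to that of `f`. The
constant is found by descending recursion on the number of vertices. -/
theorem exists_holderBound_remainder (hT : 0 ≤ T) (hα : 0 < α) (hβ : 0 < β) (hαβ : 1 < α + β)
    {M : ℝ} (hM : 0 ≤ M) : ∃ C : ℝ, 0 ≤ C ∧ ∀ X : RoughPath A α T,
      (∀ g ∈ degIco A 1 (⌊α⁻¹⌋₊ + 1), HolderBound T α M (X.comp g)) →
      ∀ (f : Forest A → ℝ → ℝ) (F : ℝ), 0 ≤ F →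
        (∀ h ∈ degIco A 0 ⌊α⁻¹⌋₊, HolderBound T β F (incr (f h))) →
        ∀ h ∈ degIco A 0 ⌊α⁻¹⌋₊,
          HolderBound T β (C * F) (X.remainder (Gamma P X f) h) := by
  suffices H : ∀ j : ℕ, ∃ C : ℝ, 0 ≤ C ∧ ∀ X : RoughPath A α T,
      (∀ g ∈ degIco A 1 (⌊α⁻¹⌋₊ + 1), HolderBound T α M (X.comp g)) →
      ∀ (f : Forest A → ℝ → ℝ) (F : ℝ), 0 ≤ F →
        (∀ h ∈ degIco A 0 ⌊α⁻¹⌋₊, HolderBound T β F (incr (f h))) →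
        ∀ h ∈ degIco A 0 ⌊α⁻¹⌋₊, ⌊α⁻¹⌋₊ ≤ h.deg + j →
          HolderBound T β (C * F) (X.remainder (Gamma P X f) h) by
    obtain ⟨C, hC, H⟩ := H ⌊α⁻¹⌋₊
    exact ⟨C, hC, fun X hX f F hF hf h hh => H X hX f F hF hf h hh (Nat.le_add_left _ _)⟩
  intro j
  induction j with
  | zero =>
    refine ⟨0, le_rfl, fun X _ f F _ _ h hh hj => ?_⟩
    have := mem_degIco.1 hh
    omega
  | succ j ih =>
    obtain ⟨C, hC, ih⟩ := ih
    have hD := stepConst_nonneg P (α := α) (β := β) hT hαβ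
    refine ⟨C + (1 + stepConst P α β T * (M * C)), by positivity,
      fun X hX f F hF hf h hh hj => ?_⟩
    by_cases hj' : ⌊α⁻¹⌋₊ ≤ h.deg + j
    · refine (ih X hX f F hF hf h hh hj').mono (mul_le_mul_of_nonneg_right ?_ hF)
      have : 0 ≤ stepConst P α β T * (M * C) := by positivity
      linarith
    · have hR : ∀ g ∈ degIco A (h.deg + 1) ⌊α⁻¹⌋₊,
          HolderBound T β (C * F) (X.remainder (Gamma P X f) g) := by
        intro g hg
        have := mem_degIco.1 hg
        exact ih X hX f F hF hf g (mem_degIco.2 ⟨Nat.zero_le _, this.2⟩) (by omega)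
      have hh' := (mem_degIco.1 hh).2
      have hCF : 0 ≤ C * F := mul_nonneg hC hF
      have key := abs_sum_integral_sub_germ_le P hT hα hβ hαβ (mul_nonneg hM hCF) hh'
        (fun i => abs_germ_delta_le P hM hX hR i)
        (fun i t ht => hasSewing_germ P hT hα hβ hαβ hM hCF hX hR i ht)
      intro s hs t ht
      rw [remainder_Gamma P X f hh']
      refine (abs_add_le _ _).trans ((add_le_add (hf h hh s hs t ht) (key s hs t ht)).trans ?_)
      have : 0 ≤ C * F * |t - s| ^ β := mul_nonneg hCF (Real.rpow_nonneg (abs_nonneg _) _)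
      linarith

/-- The remainders of `Γ_X(f)` depend on `X` in a Lipschitz continuous way. The data `f` cancel in
the difference, and the remaining terms are bilinear in `X` and the remainders. -/
theorem exists_holderBound_remainder_sub (hT : 0 ≤ T) (hα : 0 < α) (hβ : 0 < β)
    (hαβ : 1 < α + β) {M : ℝ} (hM : 0 ≤ M) : ∃ C : ℝ, 0 ≤ C ∧ ∀ X X' : RoughPath A α T,
      (∀ g ∈ degIco A 1 (⌊α⁻¹⌋₊ + 1), HolderBound T α M (X.comp g)) →
      (∀ g ∈ degIco A 1 (⌊α⁻¹⌋₊ + 1), HolderBound T α M (X'.comp g)) →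
      ∀ r : ℝ, 0 ≤ r →
      (∀ g ∈ degIco A 1 (⌊α⁻¹⌋₊ + 1),
        HolderBound T α r fun s t => X.comp g s t - X'.comp g s t) →
      ∀ (f : Forest A → ℝ → ℝ) (F : ℝ), 0 ≤ F →
        (∀ h ∈ degIco A 0 ⌊α⁻¹⌋₊, HolderBound T β F (incr (f h))) →
        ∀ h ∈ degIco A 0 ⌊α⁻¹⌋₊, HolderBound T β (C * F * r) fun s t =>
          X.remainder (Gamma P X f) h s t - X'.remainder (Gamma P X' f) h s t := by
  obtain ⟨C₀, hC₀, H₀⟩ := exists_holderBound_remainder P hT hα hβ hαβ hM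
  suffices H : ∀ j : ℕ, ∃ C : ℝ, 0 ≤ C ∧ ∀ X X' : RoughPath A α T,
      (∀ g ∈ degIco A 1 (⌊α⁻¹⌋₊ + 1), HolderBound T α M (X.comp g)) →
      (∀ g ∈ degIco A 1 (⌊α⁻¹⌋₊ + 1), HolderBound T α M (X'.comp g)) →
      ∀ r : ℝ, 0 ≤ r →
      (∀ g ∈ degIco A 1 (⌊α⁻¹⌋₊ + 1),
        HolderBound T α r fun s t => X.comp g s t - X'.comp g s t) →
      ∀ (f : Forest A → ℝ → ℝ) (F : ℝ), 0 ≤ F →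
        (∀ h ∈ degIco A 0 ⌊α⁻¹⌋₊, HolderBound T β F (incr (f h))) →
        ∀ h ∈ degIco A 0 ⌊α⁻¹⌋₊, ⌊α⁻¹⌋₊ ≤ h.deg + j → HolderBound T β (C * F * r) fun s t =>
          X.remainder (Gamma P X f) h s t - X'.remainder (Gamma P X' f) h s t by
    obtain ⟨C, hC, H⟩ := H ⌊α⁻¹⌋₊
    exact ⟨C, hC, fun X X' hX hX' r hr hXX' f F hF hf h hh =>
      H X X' hX hX' r hr hXX' f F hF hf h hh (Nat.le_add_left _ _)⟩
  intro j
  induction j with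
  | zero =>
    refine ⟨0, le_rfl, fun X X' _ _ r _ _ f F _ _ h hh hj => ?_⟩
    have := mem_degIco.1 hh
    omega
  | succ j ih =>
    obtain ⟨C, hC, ih⟩ := ih
    have hD := stepConst_nonneg P (α := α) (β := β) hT hαβ
    refine ⟨C + stepConst P α β T * (C₀ + M * C), by positivity,
      fun X X' hX hX' r hr hXX' f F hF hf h hh hj => ?_⟩
    by_cases hj' : ⌊α⁻¹⌋₊ ≤ h.deg + j
    · refine (ih X X' hX hX' r hr hXX' f F hF hf h hh hj').mono
        (mul_le_mul_of_nonneg_right (mul_le_mul_of_nonneg_right ?_ hF) hr)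
      have : 0 ≤ stepConst P α β T * (C₀ + M * C) := by positivity
      linarith
    · have hmem : ∀ g ∈ degIco A (h.deg + 1) ⌊α⁻¹⌋₊, g ∈ degIco A 0 ⌊α⁻¹⌋₊ := fun g hg =>
        mem_degIco.2 ⟨Nat.zero_le _, (mem_degIco.1 hg).2⟩
      have hR := fun g hg => H₀ X hX f F hF hf g (hmem g hg)
      have hR' := fun g hg => H₀ X' hX' f F hF hf g (hmem g hg)
      have hRR' := fun g hg => ih X X' hX hX' r hr hXX' f F hF hf g (hmem g hg) (by
        have := mem_degIco.1 hg
        omega)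
      have hh' := (mem_degIco.1 hh).2
      have hCF : 0 ≤ C₀ * F := mul_nonneg hC₀ hF
      have hB : 0 ≤ r * (C₀ * F) + M * (C * F * r) := by positivity
      have key := abs_sum_integral_sub_germ_le P hT hα hβ hαβ hB hh'
        (fun i => abs_germ_sub_delta_le P hM hr hX' hXX' hR hRR' i)
        (fun i t ht => (hasSewing_germ P hT hα hβ hαβ hM hCF hX hR i ht).sub
          (hasSewing_germ P hT hα hβ hαβ hM hCF hX' hR' i ht))
      intro s hs t ht
      have hdiff : X.remainder (Gamma P X f) h s t - X'.remainder (Gamma P X' f) h s t =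
          ∑ i ∈ (P.finite_deg_lt (⌊α⁻¹⌋₊ - h.deg)).toFinset,
            ((sewing (germ P X (Gamma P X f) h i) 0 t -
                sewing (germ P X' (Gamma P X' f) h i) 0 t) -
              (sewing (germ P X (Gamma P X f) h i) 0 s -
                sewing (germ P X' (Gamma P X' f) h i) 0 s) -
              (germ P X (Gamma P X f) h i s t - germ P X' (Gamma P X' f) h i s t)) := by
        rw [remainder_Gamma P X f hh', remainder_Gamma P X' f hh', add_sub_add_left_eq_sub,
          ← Finset.sum_sub_distrib]
        refine Finset.sum_congr rfl fun i _ => ?_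
        ring
      beta_reduce
      rw [hdiff]
      refine (key s hs t ht).trans ?_
      have : 0 ≤ C * F * r * |t - s| ^ β :=
        mul_nonneg (by positivity) (Real.rpow_nonneg (abs_nonneg _) _)
      linarith

end Induction


/-! ### Hölder norms and Hölder bounds -/

section Holder

variable {T γ C : ℝ} {y : ℝ → ℝ → ℝ}

theorem HolderBound.holderNorm_le (h : HolderBound T γ C y) :
    holderNorm T γ y ≤ ENNReal.ofReal C := by
  refine iSup₂_le fun s hs => iSup₂_le fun t ht => iSup_le fun hst => ?_
  refine ENNReal.ofReal_le_ofReal ?_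
  have hpos : 0 < |t - s| ^ γ := Real.rpow_pos_of_pos (abs_pos.2 (sub_ne_zero.2 hst.symm)) _
  exact (div_le_iff₀ hpos).2 (h s hs t ht)

theorem holderBound_of_holderNorm_le (hC : 0 ≤ C) (hy : ∀ s ∈ Icc 0 T, y s s = 0)
    (h : holderNorm T γ y ≤ ENNReal.ofReal C) : HolderBound T γ C y := by
  intro s hs t ht
  rcases eq_or_ne s t with rfl | hst
  · rw [hy s hs, abs_zero]
    exact mul_nonneg hC (Real.rpow_nonneg (abs_nonneg _) _)
  · have hpos : 0 < |t - s| ^ γ := Real.rpow_pos_of_pos (abs_pos.2 (sub_ne_zero.2 hst.symm)) _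
    have h1 : ENNReal.ofReal (|y s t| / |t - s| ^ γ) ≤ holderNorm T γ y :=
      le_iSup₂_of_le s hs (le_iSup₂_of_le t ht (le_iSup_of_le hst le_rfl))
    exact (div_le_iff₀ hpos).1 ((ENNReal.ofReal_le_ofReal_iff hC).1 (h1.trans h))

theorem HolderBound.of_exponent_le {γ' : ℝ} (h : HolderBound T γ C y) (hC : 0 ≤ C)
    (hγ' : 0 < γ') (hγ : γ' ≤ γ) : HolderBound T γ' (C * (1 + T) ^ (γ - γ')) y := by
  intro s hs t ht
  refine (h s hs t ht).trans ?_
  rw [mul_assoc]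
  refine mul_le_mul_of_nonneg_left ?_ hC
  have h1 : |t - s| ^ γ = |t - s| ^ (γ - γ') * |t - s| ^ γ' := by
    rw [← Real.rpow_add' (abs_nonneg _) (by linarith), sub_add_cancel]
  rw [h1]
  refine mul_le_mul_of_nonneg_right (Real.rpow_le_rpow (abs_nonneg _) ?_ (sub_nonneg.2 hγ))
    (Real.rpow_nonneg (abs_nonneg _) _)
  rw [abs_le]
  constructor <;> linarith [hs.1, hs.2, ht.1, ht.2]

theorem iSup_holderNorm_ne_top {κ : Type*} {p : κ → Prop} (S : Finset κ) (hS : ∀ k, p k → k ∈ S)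
    {γ : κ → ℝ} {y : κ → ℝ → ℝ → ℝ} (H : ∀ k ∈ S, ∃ C, HolderBound T (γ k) C (y k)) :
    (⨆ (k : κ) (_ : p k), holderNorm T (γ k) (y k)) ≠ ⊤ := by
  choose! C hC using H
  refine ne_top_of_le_ne_top (b := ∑ k ∈ S, ENNReal.ofReal (C k))
    (ENNReal.sum_ne_top.2 fun k _ => ENNReal.ofReal_ne_top) ?_
  refine iSup₂_le fun k hk => (hC k (hS k hk)).holderNorm_le.trans ?_
  exact Finset.single_le_sum (f := fun k => ENNReal.ofReal (C k)) (fun _ _ => zero_le) (hS k hk)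

theorem IsLittleHolder.exists_holderBound (hγ : 0 < γ) (hγ1 : γ ≤ 1) {f : ℝ → ℝ}
    (hf : IsLittleHolder T γ f) : ∃ C, HolderBound T γ C (incr f) := by
  obtain ⟨g, hg, hfg⟩ := hf 1 one_pos
  have h1 : HolderBound T γ 1 (incr fun t => f t - g t) := by
    refine holderBound_of_holderNorm_le zero_le_one (fun s _ => sub_self _) ?_
    rw [ENNReal.ofReal_one]
    exact le_add_self.trans hfg
  obtain ⟨K, hK⟩ := hg.contDiffOn.exists_lipschitzOnWith (s := Icc 0 T) (by simp)
    (convex_Icc 0 T) isCompact_Icc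
  have h2 : HolderBound T 1 K (incr g) := by
    intro s hs t ht
    rw [Real.rpow_one]
    exact hK.dist_le_mul t ht s hs
  have h3 := h2.of_exponent_le K.2 hγ hγ1
  refine ⟨1 + K * (1 + T) ^ (1 - γ), fun s hs t ht => ?_⟩
  have e : incr f s t = incr (fun t => f t - g t) s t + incr g s t := by
    simp only [incr]; ring
  rw [e, add_mul]
  exact (abs_add_le _ _).trans (add_le_add (h1 s hs t ht) (h3 s hs t ht))

end Holder

theorem HasSewing.eq_zero {Ξ : ℝ → ℝ → ℝ} {s I : ℝ} (h : HasSewing Ξ s s I) : I = 0 := by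
  refine abs_nonpos_iff.1 (le_of_forall_pos_le_add fun η hη => ?_)
  obtain ⟨δ, _, H⟩ := h η hη
  have := H 0 (fun _ => s) monotone_const rfl rfl (by simp)
  simpa using this

/-! ### Bounds for rough paths and data -/

section Bounds

variable {A : Type*} {α T : ℝ} (X X' : RoughPath A α T)

theorem RoughPath.comp_self (hα : 0 < α) {g : Forest A} (hg : 1 ≤ g.deg) {s : ℝ}
    (hs : s ∈ Icc 0 T) : X.comp g s s = 0 := by
  obtain ⟨C, hC⟩ := X.holder g
  have hpos : α * g.deg ≠ 0 := (mul_pos hα (by exact_mod_cast hg)).ne'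
  have h := hC s hs s hs
  rw [sub_self, abs_zero, Real.zero_rpow hpos, mul_zero] at h
  exact abs_nonpos_iff.1 h

theorem RoughPath.exists_holderBound (g : Forest A) :
    ∃ C, HolderBound T (g.deg * α) C (X.comp g) := by
  obtain ⟨C, hC⟩ := X.holder g
  refine ⟨C, fun s hs t ht => ?_⟩
  rw [mul_comm (g.deg : ℝ)]
  exact hC s hs t ht

variable [Finite A]

theorem RoughPath.norm_ne_top : X.norm ≠ ⊤ :=
  iSup_holderNorm_ne_top (degIco A 1 (⌊α⁻¹⌋₊ + 1))
    (fun _ hg => mem_degIco.2 ⟨hg.1, Nat.lt_succ_of_le hg.2⟩) fun g _ => X.exists_holderBound g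

theorem RoughPath.rho_ne_top : X.rho X' ≠ ⊤ := by
  refine iSup_holderNorm_ne_top (degIco A 1 (⌊α⁻¹⌋₊ + 1))
    (fun _ hg => mem_degIco.2 ⟨hg.1, Nat.lt_succ_of_le hg.2⟩) fun g _ => ?_
  obtain ⟨C, hC⟩ := X.exists_holderBound g
  obtain ⟨C', hC'⟩ := X'.exists_holderBound g
  refine ⟨C + C', fun s hs t ht => ?_⟩
  rw [add_mul]
  exact (abs_sub _ _).trans (add_le_add (hC s hs t ht) (hC' s hs t ht))

/-- A homogeneous Hölder bound implies an `α`-Hölder bound. -/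
theorem HolderBound.of_homogeneous (hT : 0 ≤ T) (hα : 0 < α) {g : Forest A}
    (hg : g ∈ degIco A 1 (⌊α⁻¹⌋₊ + 1)) {C : ℝ} (hC : 0 ≤ C) {y : ℝ → ℝ → ℝ}
    (h : HolderBound T (g.deg * α) C y) :
    HolderBound T α (C * (1 + T) ^ (⌊α⁻¹⌋₊ * α)) y := by
  have hg := mem_degIco.1 hg
  have h1 : (1 : ℝ) ≤ g.deg := by exact_mod_cast hg.1
  have h2 : (g.deg : ℝ) ≤ ⌊α⁻¹⌋₊ := by exact_mod_cast Nat.le_of_lt_succ hg.2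
  refine (h.of_exponent_le hC hα (le_mul_of_one_le_left hα.le h1)).mono ?_
  refine mul_le_mul_of_nonneg_left ?_ hC
  refine Real.rpow_le_rpow_of_exponent_le (by linarith) ?_
  have := mul_le_mul_of_nonneg_right h2 hα.le
  linarith

theorem RoughPath.holderBound_comp (hT : 0 ≤ T) (hα : 0 < α) {M : ℝ≥0} (hM : X.norm ≤ M) :
    ∀ g ∈ degIco A 1 (⌊α⁻¹⌋₊ + 1),
      HolderBound T α (M * (1 + T) ^ (⌊α⁻¹⌋₊ * α)) (X.comp g) := by
  intro g hg
  have hg' := mem_degIco.1 hg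
  refine HolderBound.of_homogeneous hT hα hg M.2 (holderBound_of_holderNorm_le M.2
    (fun s hs => X.comp_self hα hg'.1 hs) ?_)
  rw [NNReal.val_eq_coe, ENNReal.ofReal_coe_nnreal]
  exact (le_iSup₂_of_le (f := fun (h : Forest A) (_ : 1 ≤ h.deg ∧ h.deg ≤ ⌊α⁻¹⌋₊) =>
    holderNorm T (h.deg * α) (X.comp h)) g ⟨hg'.1, Nat.le_of_lt_succ hg'.2⟩ le_rfl).trans hM

theorem RoughPath.holderBound_sub (hT : 0 ≤ T) (hα : 0 < α) :
    ∀ g ∈ degIco A 1 (⌊α⁻¹⌋₊ + 1),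
      HolderBound T α ((X.rho X').toReal * (1 + T) ^ (⌊α⁻¹⌋₊ * α))
        fun s t => X.comp g s t - X'.comp g s t := by
  intro g hg
  have hg' := mem_degIco.1 hg
  refine HolderBound.of_homogeneous hT hα hg ENNReal.toReal_nonneg (holderBound_of_holderNorm_le
    ENNReal.toReal_nonneg (fun s hs => by
      rw [X.comp_self hα hg'.1 hs, X'.comp_self hα hg'.1 hs, sub_self]) ?_)
  rw [ENNReal.ofReal_toReal (X.rho_ne_top X')]
  exact le_iSup₂_of_le (f := fun (h : Forest A) (_ : 1 ≤ h.deg ∧ h.deg ≤ ⌊α⁻¹⌋₊) =>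
    holderNorm T (h.deg * α) fun s t => X.comp h s t - X'.comp h s t) g
    ⟨hg'.1, Nat.le_of_lt_succ hg'.2⟩ le_rfl

variable {ε : ℝ} {f : Forest A → ℝ → ℝ}

theorem IsSmoothData.dataNorm_ne_top (hε : 0 ≤ ε) (hε1 : ε < 1)
    (hf : IsSmoothData α ε T f) : dataNorm α ε T f ≠ ⊤ := by
  refine iSup_holderNorm_ne_top (degIco A 0 ⌊α⁻¹⌋₊) (fun h hh => mem_degIco.2 ⟨Nat.zero_le _, hh⟩)
    (γ := fun _ => 1 - ε) (y := fun h => incr (f h)) fun h hh => ?_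
  exact (hf h (mem_degIco.1 hh).2).exists_holderBound (by linarith) (by linarith)

theorem IsSmoothData.holderBound (hε : 0 ≤ ε) (hε1 : ε < 1)
    (hf : IsSmoothData α ε T f) : ∀ h ∈ degIco A 0 ⌊α⁻¹⌋₊,
      HolderBound T (1 - ε) (dataNorm α ε T f).toReal (incr (f h)) := by
  intro h hh
  refine holderBound_of_holderNorm_le ENNReal.toReal_nonneg (fun s _ => sub_self _) ?_
  rw [ENNReal.ofReal_toReal (hf.dataNorm_ne_top hε hε1)]
  exact le_iSup₂_of_le (f := fun (h : Forest A) (_ : h.deg < ⌊α⁻¹⌋₊) =>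
    holderNorm T (1 - ε) (incr (f h))) h (mem_degIco.1 hh).2 le_rfl

end Bounds


/-! ### Continuity of the map `Γ` -/

section Main

variable {A : Type*} {α ε T : ℝ}

/-- The sum of the exponents of `X` and of the remainders exceeds `1`, since `(⌊1/α⌋ + 1) α > 1`.
This is what makes the sewing lemma applicable. -/
theorem one_lt_add_one_sub (hα : 0 < α) (hε : ε < 1 - ⌊α⁻¹⌋₊ * α) : 1 < α + (1 - ε) := by
  have h1 := Nat.lt_floor_add_one α⁻¹
  have h2 : 1 < (⌊α⁻¹⌋₊ + 1 : ℝ) * α := by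
    have := mul_lt_mul_of_pos_right h1 hα
    rwa [inv_mul_cancel₀ hα.ne'] at this
  linarith

theorem lt_one_of_lt_one_sub_floor_mul (hα : 0 < α) (hε : ε < 1 - ⌊α⁻¹⌋₊ * α) : ε < 1 :=
  hε.trans_le (sub_le_self _ (mul_nonneg (Nat.cast_nonneg _) hα.le))

theorem remainder_exponent (hα : 0 < α) (hε : ε < 1 - ⌊α⁻¹⌋₊ * α) {h : Forest A}
    (hh : h.deg < ⌊α⁻¹⌋₊) : 0 < ((⌊α⁻¹⌋₊ : ℝ) - h.deg) * α ∧
      ((⌊α⁻¹⌋₊ : ℝ) - h.deg) * α ≤ 1 - ε := by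
  have h1 : (h.deg : ℝ) < ⌊α⁻¹⌋₊ := by exact_mod_cast hh
  refine ⟨mul_pos (sub_pos.2 h1) hα, ?_⟩
  have h2 : (0 : ℝ) ≤ h.deg * α := mul_nonneg (Nat.cast_nonneg _) hα.le
  rw [sub_mul]
  linarith

variable [Finite A] {ι : Type*} (P : PrimBasis A ι)

theorem exists_remainder_bound_Gamma (hT : 0 ≤ T) (hα : 0 < α) (hε : 0 < ε)
    (hε' : ε < 1 - ⌊α⁻¹⌋₊ * α) (X : RoughPath A α T) {f : Forest A → ℝ → ℝ}
    (hf : IsSmoothData α ε T f) : ∃ K, 0 ≤ K ∧ ∀ h ∈ degIco A 0 ⌊α⁻¹⌋₊,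
      HolderBound T (1 - ε) K (X.remainder (Gamma P X f) h) := by
  have hε1 := lt_one_of_lt_one_sub_floor_mul hα hε'
  obtain ⟨C, hC, H⟩ := exists_holderBound_remainder P hT hα (sub_pos.2 hε1)
    (one_lt_add_one_sub hα hε') (M := X.norm.toNNReal * (1 + T) ^ (⌊α⁻¹⌋₊ * α)) (by positivity)
  exact ⟨_, mul_nonneg hC ENNReal.toReal_nonneg,
    H X (X.holderBound_comp hT hα (ENNReal.coe_toNNReal X.norm_ne_top).ge) f _
      ENNReal.toReal_nonneg (hf.holderBound hε.le hε1)⟩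

theorem hasSewing_germ_Gamma (hT : 0 ≤ T) (hα : 0 < α) (hε : 0 < ε)
    (hε' : ε < 1 - ⌊α⁻¹⌋₊ * α) (X : RoughPath A α T) {f : Forest A → ℝ → ℝ}
    (hf : IsSmoothData α ε T f) (h : Forest A) (i : ι) {t : ℝ} (ht : t ∈ Icc 0 T) :
    HasSewing (germ P X (Gamma P X f) h i) 0 t (sewing (germ P X (Gamma P X f) h i) 0 t) := by
  obtain ⟨K, hK, H⟩ := exists_remainder_bound_Gamma P hT hα hε hε' X hf
  exact hasSewing_germ P hT hα (sub_pos.2 (lt_one_of_lt_one_sub_floor_mul hα hε')) (one_lt_add_one_sub hα hε')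
    (M := X.norm.toNNReal * (1 + T) ^ (⌊α⁻¹⌋₊ * α)) (by positivity) hK
    (X.holderBound_comp hT hα (ENNReal.coe_toNNReal X.norm_ne_top).ge)
    (fun g hg => H g (mem_degIco.2 ⟨Nat.zero_le _, (mem_degIco.1 hg).2⟩)) i ht

theorem isControlled_Gamma (hT : 0 ≤ T) (hα : 0 < α) (hε : 0 < ε)
    (hε' : ε < 1 - ⌊α⁻¹⌋₊ * α) (X : RoughPath A α T) {f : Forest A → ℝ → ℝ}
    (hf : IsSmoothData α ε T f) : X.IsControlled (Gamma P X f) := by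
  refine ⟨fun t _ h hh => coef_Gamma_of_le P X f t hh, fun h hh => ?_⟩
  obtain ⟨K, hK, H⟩ := exists_remainder_bound_Gamma P hT hα hε hε' X hf
  obtain ⟨h1, h2⟩ := remainder_exponent hα hε' hh
  exact ⟨_, (H h (mem_degIco.2 ⟨Nat.zero_le _, hh⟩)).of_exponent_le hK h1 h2⟩

/-- The path `Γ_X(f)` starts at `f_0`, since integrals over a degenerate interval vanish. -/
theorem coef_Gamma_zero (hT : 0 ≤ T) (hα : 0 < α) (hε : 0 < ε)
    (hε' : ε < 1 - ⌊α⁻¹⌋₊ * α) (X : RoughPath A α T) {f : Forest A → ℝ → ℝ}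
    (hf : IsSmoothData α ε T f) {h : Forest A} (hh : h.deg < ⌊α⁻¹⌋₊) :
    coef h (Gamma P X f 0) = f h 0 := by
  rw [coef_Gamma P X f 0 hh, Finset.sum_eq_zero fun i _ =>
    (hasSewing_germ_Gamma P hT hα hε hε' X hf h i ⟨le_rfl, hT⟩).eq_zero, zero_add]

theorem exists_ctrlDist_Gamma_le (hT : 0 ≤ T) (hα : 0 < α) (hε : 0 < ε)
    (hε' : ε < 1 - ⌊α⁻¹⌋₊ * α) (M : ℝ≥0) :
    ∃ C : ℝ≥0, ∀ X X' : RoughPath A α T, X.norm ≤ M → X'.norm ≤ M →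
      ∀ f : Forest A → ℝ → ℝ, IsSmoothData α ε T f →
        X.ctrlDist X' (Gamma P X f) (Gamma P X' f) ≤ C * dataNorm α ε T f * X.rho X' := by
  have hε1 := lt_one_of_lt_one_sub_floor_mul hα hε'
  let _ : Fintype {h : Forest A // h.deg < ⌊α⁻¹⌋₊} :=
    Fintype.subtype (degIco A 0 ⌊α⁻¹⌋₊) fun h => by simp [mem_degIco]
  set L : ℝ := (1 + T) ^ (⌊α⁻¹⌋₊ * α) with hL
  have hL0 : 0 ≤ L := by positivity
  obtain ⟨C, hC, H⟩ := exists_holderBound_remainder_sub P hT hα (sub_pos.2 hε1)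
    (one_lt_add_one_sub hα hε') (M := M * L) (by positivity)
  refine ⟨Fintype.card {h : Forest A // h.deg < ⌊α⁻¹⌋₊} * (C * L * (1 + T)).toNNReal,
    fun X X' hX hX' f hf => ?_⟩
  set F := (dataNorm α ε T f).toReal with hF
  set r := (X.rho X').toReal with hr
  have hF0 : 0 ≤ F := ENNReal.toReal_nonneg
  have hr0 : 0 ≤ r := ENNReal.toReal_nonneg
  have hF' : dataNorm α ε T f = ENNReal.ofReal F :=
    (ENNReal.ofReal_toReal (hf.dataNorm_ne_top hε.le hε1)).symm
  have hr' : X.rho X' = ENNReal.ofReal r := (ENNReal.ofReal_toReal (X.rho_ne_top X')).symm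
  have key := H X X' (X.holderBound_comp hT hα hX) (X'.holderBound_comp hT hα hX') (r * L)
    (mul_nonneg hr0 hL0) (X.holderBound_sub X' hT hα) f F hF0 (hf.holderBound hε.le hε1)
  have hterm : ∀ h : {h : Forest A // h.deg < ⌊α⁻¹⌋₊},
      ENNReal.ofReal |coef h.1 (Gamma P X f 0) - coef h.1 (Gamma P X' f 0)| +
        holderNorm T (((⌊α⁻¹⌋₊ : ℝ) - h.1.deg) * α) (fun s t =>
          X.remainder (Gamma P X f) h.1 s t - X'.remainder (Gamma P X' f) h.1 s t) ≤
      ENNReal.ofReal (C * L * (1 + T)) * ENNReal.ofReal F * ENNReal.ofReal r := by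
    rintro ⟨h, hh⟩
    obtain ⟨h1, h2⟩ := remainder_exponent hα hε' hh
    have hCF : 0 ≤ C * F * (r * L) := by positivity
    have hpow : (1 + T) ^ (1 - ε - ((⌊α⁻¹⌋₊ : ℝ) - h.deg) * α) ≤ 1 + T := by
      conv_rhs => rw [← Real.rpow_one (1 + T)]
      exact Real.rpow_le_rpow_of_exponent_le (by linarith) (by linarith)
    rw [coef_Gamma_zero P hT hα hε hε' X hf hh, coef_Gamma_zero P hT hα hε hε' X' hf hh, sub_self,
      abs_zero, ENNReal.ofReal_zero, zero_add, ← ENNReal.ofReal_mul (by positivity),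
      ← ENNReal.ofReal_mul (by positivity)]
    refine (((key h (mem_degIco.2 ⟨Nat.zero_le _, hh⟩)).of_exponent_le hCF h1 h2).mono
      ((mul_le_mul_of_nonneg_left hpow hCF).trans (le_of_eq ?_))).holderNorm_le
    ring
  rw [RoughPath.ctrlDist, tsum_fintype]
  refine (Finset.sum_le_card_nsmul _ _ _ fun h _ => hterm h).trans (le_of_eq ?_)
  rw [Finset.card_univ, nsmul_eq_mul, hF', hr', ENNReal.coe_mul, ENNReal.coe_natCast,
    ENNReal.ofReal, mul_assoc, mul_assoc, mul_assoc, mul_assoc]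

end Main

end BranchedRP

theorem mainTheorem3 {A : Type*} [Finite A] [Nonempty A] {ι : Type*}
    (P : BranchedRP.PrimBasis A ι) (α ε T : ℝ) (hα : α ∈ Set.Ioo (0 : ℝ) 1)
    (hα' : ∀ n : ℕ, 1 ≤ n → α ≠ 1 / n) (hT : 0 < T)
    (hε : ε ∈ Set.Ioo (0 : ℝ) (1 - ⌊α⁻¹⌋₊ * α)) :
    (∀ (X : BranchedRP.RoughPath A α T) (f : BranchedRP.Forest A → ℝ → ℝ),
      BranchedRP.IsSmoothData α ε T f →
        X.IsControlled (BranchedRP.Gamma P X f) ∧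
        ∀ h : BranchedRP.Forest A, h.deg < ⌊α⁻¹⌋₊ → ∀ t ∈ Set.Icc 0 T,
          (∀ i : ι, P.deg i < ⌊α⁻¹⌋₊ - h.deg →
            BranchedRP.HasSewing (BranchedRP.germ P X (BranchedRP.Gamma P X f) h i) 0 t
              (BranchedRP.sewing (BranchedRP.germ P X (BranchedRP.Gamma P X f) h i) 0 t)) ∧
          BranchedRP.coef h (BranchedRP.Gamma P X f t) =
            (∑ i ∈ (P.finite_deg_lt (⌊α⁻¹⌋₊ - h.deg)).toFinset,
              BranchedRP.sewing (BranchedRP.germ P X (BranchedRP.Gamma P X f) h i) 0 t)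
              + f h t) ∧
    ∀ M : ℝ≥0, ∃ C : ℝ≥0, ∀ X X' : BranchedRP.RoughPath A α T, X.norm ≤ M → X'.norm ≤ M →
      ∀ f : BranchedRP.Forest A → ℝ → ℝ, BranchedRP.IsSmoothData α ε T f →
        X.ctrlDist X' (BranchedRP.Gamma P X f) (BranchedRP.Gamma P X' f) ≤
          C * BranchedRP.dataNorm α ε T f * X.rho X' := by
  refine ⟨fun X f hf => ⟨BranchedRP.isControlled_Gamma P hT.le hα.1 hε.1 hε.2 X hf,
    fun h hh t ht => ⟨fun i _ => ?_, BranchedRP.coef_Gamma P X f t hh⟩⟩, fun M => ?_⟩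
  · exact BranchedRP.hasSewing_germ_Gamma P hT.le hα.1 hε.1 hε.2 X hf h i ht
  · exact BranchedRP.exists_ctrlDist_Gamma_le P hT.le hα.1 hε.1 hε.2 M
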